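/- Consider a discrete memoryless cognitive interference channel with finite input alphabets $\mathcal X_1,\mathcal X_2$, finite output alphabets $\mathcal Y_1,\mathcal Y_2$ and transition probability $p_{Y_1,Y_2|X_1,X_2}$. For independent messages $W_i$ uniform on a set $\mathcal M_i$ of $\lceil 2^{NR_i}\rceil$ elements ($i=1,2$), a code of blocklength $N$ consists of encoders $X_1^N=f_1(W_1,W_2)$ (transmitter 1 is cognitive and knows both messages) and $X_2^N=f_2(W_2)$ and of decoders $\widehat W_1=g_1(Y_1^N)$, $\widehat W_2=g_2(Y_2^N)$. A pair $(R_1,R_2)$ with $R_1,R_2\ge 0$ is *achievable* if there is a sequence of such codes, one for each $N$, with $\Pr[(\widehat W_1,\widehat W_2)\ne(W_1,W_2)]\to 0$ as $N\to\infty$. The *capacity region* is the closure of the set of achievable pairs. Mutual informations are in bits. **Theorem.** Let $U_{1c},U_{2c},U_{1pb},U_{2pb}$ take values in finite sets, and let $(U_{1c},U_{2c},U_{1pb},U_{2pb},X_1,X_2,Y_1,Y_2)$ have a joint distribution of the form $$p_{U_{1c},U_{2c},U_{1pb},U_{2pb}}\;p_{X_1,X_2|U_{1c},U_{2c},U_{1pb},U_{2pb}}\;p_{Y_1,Y_2|X_1,X_2}$$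 with an arbitrary input distribution (the first two factors). Let $(R'_{1c},R'_{1pb},R'_{2pb},R_{1c},R_{1pb},R_{2c},R_{2pa},R_{2pb})\in\mathbb R_{\ge 0}^8$ satisfy the binning constraints $$\begin{aligned} R'_{1c} &\ge I(U_{1c};X_2|U_{2c}),\\ R'_{1c}+R'_{1pb} &\ge I(U_{1pb},U_{1c};X_2|U_{2c}),\\ R'_{1c}+R'_{1pb}+R'_{2pb} &\ge I(U_{1pb},U_{1c};X_2|U_{2c})+I(U_{2pb};U_{1pb}|U_{1c},U_{2c},X_2), \end{aligned}$$ the decoding constraints of receiver 2 $$\begin{aligned} R_{2c}+R_{2pa}+(R_{1c}+R'_{1c})+(R_{2pb}+R'_{2pb}) &\le I(Y_2;U_{2pb},U_{1c},X_2,U_{2c})+I(U_{1c};X_2|U_{2c}),\\ R_{2pa}+(R_{1c}+R'_{1c})+(R_{2pb}+R'_{2pb}) &\le I(Y_2;U_{2pb},U_{1c},X_2|U_{2c})+I(U_{1c};X_2|U_{2c}),\\ R_{2pa}+(R_{2pb}+R'_{2pb}) &\le I(Y_2;U_{2pb},X_2|U_{1c},U_{2c})+I(U_{1c};X_2|U_{2c}),\\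 (R_{1c}+R'_{1c})+(R_{2pb}+R'_{2pb}) &\le I(Y_2;U_{2pb},U_{1c}|X_2,U_{2c})+I(U_{1c};X_2|U_{2c}),\\ R_{2pb}+R'_{2pb} &\le I(Y_2;U_{2pb}|U_{1c},X_2,U_{2c}), \end{aligned}$$ and the decoding constraints of receiver 1 $$\begin{aligned} R_{2c}+(R_{1c}+R'_{1c})+(R_{1pb}+R'_{1pb}) &\le I(Y_1;U_{1pb},U_{1c},U_{2c}),\\ (R_{1c}+R'_{1c})+(R_{1pb}+R'_{1pb}) &\le I(Y_1;U_{1pb},U_{1c}|U_{2c}),\\ R_{1pb}+R'_{1pb} &\le I(Y_1;U_{1pb}|U_{1c},U_{2c}). \end{aligned}$$ Put $R_1=R_{1c}+R_{1pb}$ and $R_2=R_{2c}+R_{2pa}+R_{2pb}$. Then $(R_1,R_2)$ belongs to the capacity region. If moreover the eight decoding constraints hold with strict inequality, then $(R_1,R_2)$ is itself achievable. -/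

import Mathlib

open Filter Topology

namespace CogIC

noncomputable section

/-! ### Information measures (in bits) for random variables on a discrete probability space -/

/-- The probability that the random variable `f` takes the value `a`, as a real number. -/
def law {Ω A : Type*} (P : PMF Ω) (f : Ω → A) (a : A) : ℝ :=
  ((P.map f) a).toReal

/-- Mutual information `I(f; g)` in bits. Terms of probability zero contribute `0`. -/
def mutualInfo {Ω A B : Type*} [Fintype A] [Fintype B]
    (P : PMF Ω) (f : Ω → A) (g : Ω → B) : ℝ :=
  ∑ a : A, ∑ b : B,
    law P (fun ω => (f ω, g ω)) (a, b) *
      Real.logb 2 (law P (fun ω => (f ω, g ω)) (a, b) / (law P f a * law P g b))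

/-- Conditional mutual information `I(f; g | h)` in bits. Terms of probability zero
contribute `0`. -/
def condMutualInfo {Ω A B C : Type*} [Fintype A] [Fintype B] [Fintype C]
    (P : PMF Ω) (f : Ω → A) (g : Ω → B) (h : Ω → C) : ℝ :=
  ∑ a : A, ∑ b : B, ∑ c : C,
    law P (fun ω => (f ω, g ω, h ω)) (a, b, c) *
      Real.logb 2
        (law P (fun ω => (f ω, g ω, h ω)) (a, b, c) * law P h c /
          (law P (fun ω => (f ω, h ω)) (a, c) * law P (fun ω => (g ω, h ω)) (b, c)))

/-! ### The discrete memoryless cognitive interference channel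

A channel is given by its single-letter transition law `W x₁ x₂`, a distribution on pairs
`(y₁, y₂)`. Transmitter 1 is the cognitive one: its encoder sees both messages. -/

/-- A block code of length `N` with `M₁` and `M₂` messages. -/
structure Code (X₁ X₂ Y₁ Y₂ : Type*) (N M₁ M₂ : ℕ) where
  /-- the cognitive encoder, which knows both messages -/
  enc₁ : Fin M₁ → Fin M₂ → (Fin N → X₁)
  /-- the primary encoder, which knows its own message only -/
  enc₂ : Fin M₂ → (Fin N → X₂)
  /-- the decoder of receiver 1 -/
  dec₁ : (Fin N → Y₁) → Fin M₁
  /-- the decoder of receiver 2 -/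
  dec₂ : (Fin N → Y₂) → Fin M₂

/-- The `N`-letter memoryless transition probability
`∏ i, W(y₁ᵢ, y₂ᵢ | x₁ᵢ, x₂ᵢ)`. -/
def blockProb {X₁ X₂ Y₁ Y₂ : Type*} (W : X₁ → X₂ → PMF (Y₁ × Y₂)) {N : ℕ}
    (x₁ : Fin N → X₁) (x₂ : Fin N → X₂) (y₁ : Fin N → Y₁) (y₂ : Fin N → Y₂) : ℝ :=
  ∏ i : Fin N, (W (x₁ i) (x₂ i) (y₁ i, y₂ i)).toReal

/-- The probability that at least one receiver errs, for independent and uniformly distributed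
messages. -/
def Code.errorProb {X₁ X₂ Y₁ Y₂ : Type*} [Fintype Y₁] [Fintype Y₂] {N M₁ M₂ : ℕ}
    (c : Code X₁ X₂ Y₁ Y₂ N M₁ M₂) (W : X₁ → X₂ → PMF (Y₁ × Y₂)) : ℝ :=
  (∑ w₁ : Fin M₁, ∑ w₂ : Fin M₂, ∑ y₁ : Fin N → Y₁, ∑ y₂ : Fin N → Y₂,
    if c.dec₁ y₁ = w₁ ∧ c.dec₂ y₂ = w₂ then 0
    else blockProb W (c.enc₁ w₁ w₂) (c.enc₂ w₂) y₁ y₂) / ((M₁ : ℝ) * (M₂ : ℝ))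

/-- The number `⌈2 ^ (N R)⌉` of messages at blocklength `N` and rate `R`. -/
def numMessages (R : ℝ) (N : ℕ) : ℕ := ⌈(2 : ℝ) ^ ((N : ℝ) * R)⌉₊

/-- The rate pair `(R₁, R₂)` is achievable: there is a sequence of codes of blocklengths
`N = 0, 1, 2, …` with `⌈2 ^ (N R₁)⌉` and `⌈2 ^ (N R₂)⌉` messages whose error probability
tends to `0`. -/
def Achievable {X₁ X₂ Y₁ Y₂ : Type*} [Fintype Y₁] [Fintype Y₂]
    (W : X₁ → X₂ → PMF (Y₁ × Y₂)) (R₁ R₂ : ℝ) : Prop :=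
  0 ≤ R₁ ∧ 0 ≤ R₂ ∧
    ∃ c : ∀ N : ℕ, Code X₁ X₂ Y₁ Y₂ N (numMessages R₁ N) (numMessages R₂ N),
      Tendsto (fun N => (c N).errorProb W) atTop (𝓝 0)

/-- The capacity region: the closure of the set of achievable rate pairs. -/
def capacityRegion {X₁ X₂ Y₁ Y₂ : Type*} [Fintype Y₁] [Fintype Y₂]
    (W : X₁ → X₂ → PMF (Y₁ × Y₂)) : Set (ℝ × ℝ) :=
  closure {R : ℝ × ℝ | Achievable W R.1 R.2}

/-! ### The single-letter random variables and the rate constraints -/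

/-- A value of the auxiliary random variables and the channel inputs. -/
structure InputSymbols (A1c A2c A1pb A2pb X₁ X₂ : Type*) where
  u1c : A1c
  u2c : A2c
  u1pb : A1pb
  u2pb : A2pb
  x₁ : X₁
  x₂ : X₂

/-- A value of the auxiliary random variables, the channel inputs and the channel outputs. -/
structure AllSymbols (A1c A2c A1pb A2pb X₁ X₂ Y₁ Y₂ : Type*) extends
    InputSymbols A1c A2c A1pb A2pb X₁ X₂ where
  y₁ : Y₁
  y₂ : Y₂

/-- The joint law `q(u, x₁, x₂) W(y₁, y₂ | x₁, x₂)` of all single-letter random variables,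
where `q` is the input distribution. -/
def jointLaw {A1c A2c A1pb A2pb X₁ X₂ Y₁ Y₂ : Type*}
    (q : PMF (InputSymbols A1c A2c A1pb A2pb X₁ X₂)) (W : X₁ → X₂ → PMF (Y₁ × Y₂)) :
    PMF (AllSymbols A1c A2c A1pb A2pb X₁ X₂ Y₁ Y₂) :=
  q.bind fun s => (W s.x₁ s.x₂).map fun y => ⟨s, y.1, y.2⟩

/-- The partial rates; a trailing `b` marks the binning rates `R'`. -/
structure RateTuple where
  R1cb : ℝ
  R1pbb : ℝ
  R2pbb : ℝ
  R1c : ℝ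
  R1pb : ℝ
  R2c : ℝ
  R2pa : ℝ
  R2pb : ℝ

/-- All eight partial rates are nonnegative. -/
def RateTuple.Nonneg (r : RateTuple) : Prop :=
  0 ≤ r.R1cb ∧ 0 ≤ r.R1pbb ∧ 0 ≤ r.R2pbb ∧ 0 ≤ r.R1c ∧ 0 ≤ r.R1pb ∧
    0 ≤ r.R2c ∧ 0 ≤ r.R2pa ∧ 0 ≤ r.R2pb

section Constraints

variable {A1c A2c A1pb A2pb X₁ X₂ Y₁ Y₂ : Type*}
  [Fintype A1c] [Fintype A2c] [Fintype A1pb] [Fintype A2pb]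
  [Fintype X₁] [Fintype X₂] [Fintype Y₁] [Fintype Y₂]

/-- The three binning constraints. -/
def BinningConstraints (P : PMF (AllSymbols A1c A2c A1pb A2pb X₁ X₂ Y₁ Y₂))
    (r : RateTuple) : Prop :=
  condMutualInfo P (fun s => s.u1c) (fun s => s.x₂) (fun s => s.u2c) ≤ r.R1cb ∧
  condMutualInfo P (fun s => (s.u1pb, s.u1c)) (fun s => s.x₂) (fun s => s.u2c)
    ≤ r.R1cb + r.R1pbb ∧
  condMutualInfo P (fun s => (s.u1pb, s.u1c)) (fun s => s.x₂) (fun s => s.u2c)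
      + condMutualInfo P (fun s => s.u2pb) (fun s => s.u1pb) (fun s => (s.u1c, s.u2c, s.x₂))
    ≤ r.R1cb + r.R1pbb + r.R2pbb

/-- The five decoding constraints of receiver 2 and the three of receiver 1, with the comparison
`rel` of the left side with the right side, which is `≤` or `<`. -/
def DecodingConstraints (rel : ℝ → ℝ → Prop)
    (P : PMF (AllSymbols A1c A2c A1pb A2pb X₁ X₂ Y₁ Y₂)) (r : RateTuple) : Prop :=
  -- receiver 2
  rel (r.R2c + r.R2pa + (r.R1c + r.R1cb) + (r.R2pb + r.R2pbb))
    (mutualInfo P (fun s => s.y₂) (fun s => (s.u2pb, s.u1c, s.x₂, s.u2c))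
      + condMutualInfo P (fun s => s.u1c) (fun s => s.x₂) (fun s => s.u2c)) ∧
  rel (r.R2pa + (r.R1c + r.R1cb) + (r.R2pb + r.R2pbb))
    (condMutualInfo P (fun s => s.y₂) (fun s => (s.u2pb, s.u1c, s.x₂)) (fun s => s.u2c)
      + condMutualInfo P (fun s => s.u1c) (fun s => s.x₂) (fun s => s.u2c)) ∧
  rel (r.R2pa + (r.R2pb + r.R2pbb))
    (condMutualInfo P (fun s => s.y₂) (fun s => (s.u2pb, s.x₂)) (fun s => (s.u1c, s.u2c))
      + condMutualInfo P (fun s => s.u1c) (fun s => s.x₂) (fun s => s.u2c)) ∧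
  rel ((r.R1c + r.R1cb) + (r.R2pb + r.R2pbb))
    (condMutualInfo P (fun s => s.y₂) (fun s => (s.u2pb, s.u1c)) (fun s => (s.x₂, s.u2c))
      + condMutualInfo P (fun s => s.u1c) (fun s => s.x₂) (fun s => s.u2c)) ∧
  rel (r.R2pb + r.R2pbb)
    (condMutualInfo P (fun s => s.y₂) (fun s => s.u2pb) (fun s => (s.u1c, s.x₂, s.u2c))) ∧
  -- receiver 1
  rel (r.R2c + (r.R1c + r.R1cb) + (r.R1pb + r.R1pbb))
    (mutualInfo P (fun s => s.y₁) (fun s => (s.u1pb, s.u1c, s.u2c))) ∧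
  rel ((r.R1c + r.R1cb) + (r.R1pb + r.R1pbb))
    (condMutualInfo P (fun s => s.y₁) (fun s => (s.u1pb, s.u1c)) (fun s => s.u2c)) ∧
  rel (r.R1pb + r.R1pbb)
    (condMutualInfo P (fun s => s.y₁) (fun s => s.u1pb) (fun s => (s.u1c, s.u2c)))

end Constraints

end

end CogIC

/-!
The proof is random coding with superposition and binning, for a code book in five layers: `U2c`
carries the common message of user 2; `X₂` (on top of `U2c`) carries its private message `2pa`;
`U1c` (on top of `U2c`), `U1pb` (on top of `U2c, U1c`) and `U2pb` (on top of `U2c, X₂, U1c`) carry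
the messages `1c`, `1pb`, `2pb` together with a bin position. The layers `U1c` and `U1pb` are
generated without regard to `X₂`, and `U2pb` without regard to `U1pb`; the cognitive transmitter
chooses bin positions for which the five codewords look as if drawn from the given input
distribution. The argument is carried out for one use of a channel with general alphabets
(`Model`), and then applied to blocks of length `N` (`Model.pow`).

*Encoding.* Instead of searching a jointly typical bin position, the analysis weights the bin
positions by the likelihood ratio of the input law to the law of the generated codewords. Under the
correspondingly tilted law the codewords and the channel output are distributed exactly as the
single-letter variables (`mean_lik`), so no conditional typicality lemma is needed. The normalizing
sum of the weights, restricted to a typical set, has mean close to `1` and, under the binning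
constraints, small variance (`mean_binSum_sub_one_sq_le`): this is the mutual covering lemma. The
best channel input does at least as well as an input drawn from the weights, so its error
probability is bounded by the error probability under the tilted law and by the variance
(`mean_le_of_le_err`).

*Decoding.* Each receiver looks for a tuple of codewords that is typical with its output, and the
union bound leaves one packing bound for each pattern of shared layers between the true and the
wrong codewords (`packing₁`, `packing₂`, `mean_lik_mul_err_le`). Wrong indices of the right message
do no harm. Therefore a decoding constraint is needed only if it protects a message of positive
rate. The gain `I(U1c; X₂ | U2c)` in the constraints of receiver 2 appears because `U1c` and `X₂`
are generated conditionally independently, whereas the true codewords are jointly typical.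

*Typical sets.* A block is typical if its likelihood ratios have the exponents predicted by the
mutual informations; the weak law of large numbers shows that this fails with vanishing
probability (`tendsto_mass_density`). The single-letter identities that turn mean information
densities into the mutual informations of the theorem are the lemmas `density_*`.

*Rates.* With strict decoding constraints (of the messages of positive rate), a slightly larger
rate `R1cb` leaves slack in all the constraints (`achievable_of_lt`). If the decoding constraints
are not strict, scaling the message rates by `t < 1` makes strict all those that are needed, and the
given rate pair is the limit for `t → 1` (`achievable_scaled`).
-/

namespace CogIC

noncomputable section

/-! ### Finite sums -/

open Classical in
/-- The real-valued indicator of a proposition. -/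
def ind (p : Prop) : ℝ := if p then 1 else 0

theorem ind_nonneg (p : Prop) : 0 ≤ ind p := by unfold ind; split_ifs <;> norm_num

theorem ind_le_one (p : Prop) : ind p ≤ 1 := by unfold ind; split_ifs <;> norm_num

@[simp] theorem ind_of_true {p : Prop} (h : p) : ind p = 1 := by simp [ind, h]

@[simp] theorem ind_of_false {p : Prop} (h : ¬ p) : ind p = 0 := by simp [ind, h]

theorem ind_add_ind_not (p : Prop) : ind p + ind (¬ p) = 1 := by
  by_cases h : p <;> simp [ind, h]

theorem sum_ind_eq {α : Type*} [Fintype α] (a : α) : ∑ x, ind (a = x) = 1 := by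
  classical
  simp [ind]

open Classical in
/-- The marginal weight `∑_{f ω = a} P ω` of a weight `P` on a finite set along `f`. -/
def marg {Ω T : Type*} [Fintype Ω] (P : Ω → ℝ) (f : Ω → T) (t : T) : ℝ :=
  ∑ ω, if f ω = t then P ω else 0

theorem marg_nonneg {Ω T : Type*} [Fintype Ω] {P : Ω → ℝ} (hP : ∀ ω, 0 ≤ P ω) (f : Ω → T) (t : T) :
    0 ≤ marg P f t :=
  Finset.sum_nonneg fun ω _ => by split_ifs <;> simp [hP]

theorem le_marg {Ω T : Type*} [Fintype Ω] {P : Ω → ℝ} (hP : ∀ ω, 0 ≤ P ω) (f : Ω → T) (ω : Ω) :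
    P ω ≤ marg P f (f ω) := by
  classical
  have := Finset.single_le_sum (f := fun ω' => if f ω' = f ω then P ω' else 0)
    (fun ω' _ => by split_ifs <;> simp [hP]) (Finset.mem_univ ω)
  simp only [if_true] at this
  unfold marg
  convert this

theorem sum_mul_comp_eq_sum_marg {Ω T : Type*} [Fintype Ω] [Fintype T] (P : Ω → ℝ) (f : Ω → T)
    (F : T → ℝ) : ∑ ω, P ω * F (f ω) = ∑ t, marg P f t * F t := by
  classical
  simp only [marg, Finset.sum_mul]
  rw [Finset.sum_comm]
  refine Finset.sum_congr rfl fun ω _ => ?_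
  simp [ite_mul]

theorem sum_marg {Ω T : Type*} [Fintype Ω] [Fintype T] (P : Ω → ℝ) (f : Ω → T) :
    ∑ t, marg P f t = ∑ ω, P ω := by
  simpa using (sum_mul_comp_eq_sum_marg P f fun _ => 1).symm

theorem marg_congr {Ω T T' : Type*} [Fintype Ω] (P : Ω → ℝ) {f : Ω → T} {f' : Ω → T'} {t : T}
    {t' : T'} (h : ∀ ω, f ω = t ↔ f' ω = t') : marg P f t = marg P f' t' := by
  classical
  exact Finset.sum_congr rfl fun ω _ => if_congr (h ω) rfl rfl

theorem sum_marg_pair {Ω S T : Type*} [Fintype Ω] [Fintype T] (P : Ω → ℝ) (π : Ω → S) (τ : Ω → T)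
    (s : S) : ∑ t, marg P (fun ω => (π ω, τ ω)) (s, t) = marg P π s := by
  classical
  simp only [marg]
  rw [Finset.sum_comm]
  refine Finset.sum_congr rfl fun ω _ => ?_
  simp only [Prod.mk.injEq]
  by_cases h : π ω = s <;> simp [h]

/-- The packing bound: a fresh sample `t`, drawn given the observation `π ω` from `κ (π ω)`, looks
jointly typical with the observation with small probability, because on the set `G` the true joint
law exceeds the law of the fresh pair by the factor `θ`. -/
theorem sum_fresh_le {Ω S T : Type*} [Fintype Ω] [Fintype S] [Fintype T] {P : Ω → ℝ}
    (hP : ∀ ω, 0 ≤ P ω) (hP1 : ∑ ω, P ω = 1) (π : Ω → S) (τ : Ω → T) (κ : S → T → ℝ)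
    (G : S → T → Prop) {θ : ℝ} (hθ : 0 < θ)
    (hG : ∀ s t, G s t → θ * (marg P π s * κ s t) ≤ marg P (fun ω => (π ω, τ ω)) (s, t)) :
    ∑ ω, P ω * ∑ t, κ (π ω) t * ind (G (π ω) t) ≤ θ⁻¹ := by
  rw [sum_mul_comp_eq_sum_marg P π fun s => ∑ t, κ s t * ind (G s t)]
  calc _ ≤ ∑ s, ∑ t, θ⁻¹ * marg P (fun ω => (π ω, τ ω)) (s, t) := by
        refine Finset.sum_le_sum fun s _ => ?_
        rw [Finset.mul_sum]
        refine Finset.sum_le_sum fun t _ => ?_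
        by_cases h : G s t
        · rw [ind_of_true h, mul_one, ← div_eq_inv_mul, le_div_iff₀ hθ, mul_comm]
          exact hG s t h
        · rw [ind_of_false h, mul_zero, mul_zero]
          exact mul_nonneg (inv_nonneg.2 hθ.le) (marg_nonneg hP _ _)
    _ = θ⁻¹ := by
        rw [← Fintype.sum_prod_type (f := fun st => θ⁻¹ * marg P (fun ω => (π ω, τ ω)) st),
          ← Finset.mul_sum, sum_marg, hP1, mul_one]

/-! ### Means over independent families -/

/-- The mean of `f` over a family of independent letters, the `i`-th one with weight `w i`. -/
def prodMean {ι α : Type*} [Fintype ι] [DecidableEq ι] [Fintype α] (w : ι → α → ℝ)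
    (f : (ι → α) → ℝ) : ℝ :=
  ∑ g, (∏ i, w i (g i)) * f g

/-- The mean of `F` over a second letter, which is the given letter `a` if the two positions
coincide (`same`), and a fresh letter of weight `w` otherwise. -/
def second {α : Type*} [Fintype α] (same : Prop) (a : α) (w : α → ℝ) (F : α → ℝ) : ℝ :=
  open Classical in if same then F a else ∑ a', w a' * F a'

section prodMean

variable {ι α : Type*} [Fintype ι] [DecidableEq ι] [Fintype α] {w : ι → α → ℝ}

theorem prodMean_mono (hw : ∀ i a, 0 ≤ w i a) {f g : (ι → α) → ℝ} (h : ∀ x, f x ≤ g x) :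
    prodMean w f ≤ prodMean w g :=
  Finset.sum_le_sum fun x _ =>
    mul_le_mul_of_nonneg_left (h x) (Finset.prod_nonneg fun i _ => hw i _)

theorem prodMean_add (f g : (ι → α) → ℝ) :
    prodMean w (fun x => f x + g x) = prodMean w f + prodMean w g := by
  simp [prodMean, mul_add, Finset.sum_add_distrib]

theorem prodMean_mul_left (r : ℝ) (f : (ι → α) → ℝ) :
    prodMean w (fun x => r * f x) = r * prodMean w f := by
  simp only [prodMean, Finset.mul_sum]
  exact Finset.sum_congr rfl fun _ _ => by ring

theorem prodMean_sum {κ : Type*} (s : Finset κ) (f : κ → (ι → α) → ℝ) :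
    prodMean w (fun x => ∑ k ∈ s, f k x) = ∑ k ∈ s, prodMean w (f k) := by
  simp only [prodMean, Finset.mul_sum]
  exact Finset.sum_comm

theorem sum_pi_prod (f : ι → α → ℝ) : ∑ g : ι → α, ∏ i, f i (g i) = ∏ i, ∑ a, f i a := by
  rw [Finset.prod_univ_sum, Fintype.piFinset_univ]

theorem prodMean_const (hw : ∀ i, ∑ a, w i a = 1) (r : ℝ) : prodMean w (fun _ => r) = r := by
  simp only [prodMean]
  rw [← Finset.sum_mul, sum_pi_prod]
  simp [hw]

theorem lt_prodMean (hw : ∀ i a, 0 ≤ w i a) (hw1 : ∀ i, ∑ a, w i a = 1)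
    {f : (ι → α) → ℝ} {r : ℝ} (h : ∀ g, r < f g) : r < prodMean w f := by
  have h1 : ∑ g : ι → α, ∏ i, w i (g i) = 1 := by rw [sum_pi_prod]; simp [hw1]
  obtain ⟨g, -, hg⟩ : ∃ g ∈ (Finset.univ : Finset (ι → α)), ∏ i, w i (g i) ≠ 0 := by
    apply Finset.exists_ne_zero_of_sum_ne_zero
    rw [h1]; norm_num
  have hW : ∀ g : ι → α, 0 ≤ ∏ i, w i (g i) := fun g => Finset.prod_nonneg fun i _ => hw i _
  have : prodMean w (fun _ => r) < prodMean w f :=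
    Finset.sum_lt_sum (fun x _ => mul_le_mul_of_nonneg_left (h x).le (hW x))
      ⟨g, Finset.mem_univ _, mul_lt_mul_of_pos_left (h g) (lt_of_le_of_ne (hW g) hg.symm)⟩
  rwa [prodMean_const hw1] at this

/-- Joint law of two positions of an independent family. -/
theorem prodMean_two (hw : ∀ i, ∑ a, w i a = 1) (i i' : ι) (f : α → α → ℝ) :
    prodMean w (fun g => f (g i) (g i')) = ∑ a, w i a * second (i = i') a (w i') (f a) := by
  classical
  have key : ∀ u : ι → α → ℝ, ∑ g : ι → α, (∏ t, w t (g t)) * ∏ t, u t (g t) =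
      ∏ t, ∑ a, w t a * u t a := by
    intro u
    rw [← sum_pi_prod fun t a => w t a * u t a]
    exact Finset.sum_congr rfl fun g _ => Finset.prod_mul_distrib.symm
  have one : ∀ (s : ι) (φ : α → ℝ), ∀ g : ι → α,
      φ (g s) = ∏ t, (if t = s then φ (g t) else 1) := by
    intro s φ g
    rw [Finset.prod_ite_eq' Finset.univ s fun t => φ (g t)]
    simp
  by_cases hii : i = i'
  · subst hii
    simp only [second, if_true, prodMean]
    calc _ = ∑ g : ι → α, (∏ t, w t (g t)) *
          ∏ t, (fun t a => if t = i then f a a else 1) t (g t) := by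
          refine Finset.sum_congr rfl fun g _ => ?_
          rw [one i (fun a => f a a) g]
      _ = ∏ t, if t = i then ∑ a, w t a * f a a else 1 := by
          refine (key fun t a => if t = i then f a a else 1).trans
            (Finset.prod_congr rfl fun t _ => ?_)
          split_ifs <;> simp [hw]
      _ = _ := by
          rw [Finset.prod_ite_eq' Finset.univ i fun t => ∑ a, w t a * f a a]
          simp
  · simp only [second, if_neg hii, prodMean]
    -- expand `f` in products of point indicators, for which means factor over the letters
    have expand : ∀ g : ι → α, f (g i) (g i') =
        ∑ a, ∑ a', f a a' * ∏ t, (fun t b => (if t = i then (if b = a then 1 else 0) else 1) *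
          (if t = i' then (if b = a' then (1 : ℝ) else 0) else 1)) t (g t) := by
      intro g
      simp only [Finset.prod_mul_distrib]
      have e1 := fun a => one i (fun b => if b = a then (1 : ℝ) else 0) g
      have e2 := fun a => one i' (fun b => if b = a then (1 : ℝ) else 0) g
      simp only [← e1, ← e2]
      simp
    calc _ = ∑ a, ∑ a', f a a' * ∑ g : ι → α, (∏ t, w t (g t)) *
          ∏ t, (fun t b => (if t = i then (if b = a then 1 else 0) else 1) *
          (if t = i' then (if b = a' then (1 : ℝ) else 0) else 1)) t (g t) := by
          simp only [expand, Finset.mul_sum]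
          rw [Finset.sum_comm]
          refine Finset.sum_congr rfl fun a _ => ?_
          rw [Finset.sum_comm]
          refine Finset.sum_congr rfl fun a' _ => Finset.sum_congr rfl fun g _ => ?_
          ring
      _ = ∑ a, ∑ a', f a a' * (w i a * w i' a') := by
          refine Finset.sum_congr rfl fun a _ => Finset.sum_congr rfl fun a' _ => ?_
          congr 1
          refine (key fun t b => (if t = i then (if b = a then 1 else 0) else 1) *
            (if t = i' then (if b = a' then (1 : ℝ) else 0) else 1)).trans ?_
          calc _ = ∏ t, ((if t = i then w t a else 1) * (if t = i' then w t a' else 1)) := by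
                refine Finset.prod_congr rfl fun t _ => ?_
                by_cases h1 : t = i
                · have h2 : t ≠ i' := fun h => hii (h1.symm.trans h)
                  simp [h1, hii]
                · by_cases h2 : t = i' <;> simp [h1, h2, hw, Ne.symm hii]
            _ = _ := by
                rw [Finset.prod_mul_distrib, Finset.prod_ite_eq' Finset.univ i fun t => w t a,
                  Finset.prod_ite_eq' Finset.univ i' fun t => w t a']
                simp
      _ = _ := by
          refine Finset.sum_congr rfl fun a _ => ?_
          rw [Finset.mul_sum]
          exact Finset.sum_congr rfl fun a' _ => by ring

end prodMean

section second

variable {α : Type*} [Fintype α] {same : Prop} {a : α} {w : α → ℝ}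

theorem second_of_same (h : same) (F : α → ℝ) : second same a w F = F a := by simp [second, h]

theorem second_of_ne (h : ¬ same) (F : α → ℝ) : second same a w F = ∑ a', w a' * F a' := by
  simp [second, h]

theorem second_const (hw : ∑ a', w a' = 1) (r : ℝ) : second same a w (fun _ => r) = r := by
  unfold second
  split_ifs
  · rfl
  · rw [← Finset.sum_mul, hw, one_mul]

theorem second_mul_left (r : ℝ) (F : α → ℝ) :
    second same a w (fun a' => r * F a') = r * second same a w F := by
  unfold second
  split_ifs
  · rfl
  · rw [Finset.mul_sum]
    exact Finset.sum_congr rfl fun _ _ => by ring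

theorem second_sum {κ : Type*} [Fintype κ] (F : κ → α → ℝ) :
    second same a w (fun a' => ∑ k, F k a') = ∑ k, second same a w (F k) := by
  unfold second
  split_ifs
  · rfl
  · simp only [Finset.mul_sum]
    exact Finset.sum_comm

end second

/-! ### The superposition codebook -/

/-- The generating laws of the codeword layers `U2c`, `X₂`, `U1c`, `U1pb`, `U2pb` (with values in
`C`, `X`, `A`, `B`, `D`). Each layer is superposed on those in its arguments. In particular `U1c`
and `U1pb` are generated without regard to `X₂`. -/
structure LayerLaw (C X A B D : Type*) [Fintype C] [Fintype X] [Fintype A] [Fintype B]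
    [Fintype D] where
  c : C → ℝ
  x : C → X → ℝ
  a : C → A → ℝ
  b : C → A → B → ℝ
  d : C → X → A → D → ℝ
  c_nonneg : ∀ u, 0 ≤ c u
  x_nonneg : ∀ u v, 0 ≤ x u v
  a_nonneg : ∀ u v, 0 ≤ a u v
  b_nonneg : ∀ u v w, 0 ≤ b u v w
  d_nonneg : ∀ u v w t, 0 ≤ d u v w t
  sum_c : ∑ u, c u = 1
  sum_x : ∀ u, ∑ v, x u v = 1
  sum_a : ∀ u, ∑ v, a u v = 1
  sum_b : ∀ u v, ∑ w, b u v w = 1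
  sum_d : ∀ u v w, ∑ t, d u v w t = 1

/-- A codebook: `I`, `L` index the common and the private message of user 2, `J`, `K`, `M` index
the pairs of a message and a bin position of the layers `U1c`, `U1pb`, `U2pb`. -/
structure Codebook (I L J K M C X A B D : Type*) where
  c : I → C
  x : I × L → X
  a : I × J → A
  b : I × J × K → B
  d : I × L × J × M → D

section codebook

variable {I L J K M C X A B D : Type*} [Fintype C] [Fintype X] [Fintype A] [Fintype B] [Fintype D]
  [Fintype I] [Fintype L] [Fintype J] [Fintype K] [Fintype M]
  [DecidableEq I] [DecidableEq L] [DecidableEq J] [DecidableEq K] [DecidableEq M]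

namespace LayerLaw

/-- The law of the five codewords at one position of the random codebook. -/
def word (κ : LayerLaw C X A B D) (c : C) (x : X) (a : A) (b : B) (d : D) : ℝ :=
  κ.c c * κ.x c x * κ.a c a * κ.b c a b * κ.d c x a d

/-- The mean over the random codebook, layer by layer. -/
def mean (κ : LayerLaw C X A B D) (f : Codebook I L J K M C X A B D → ℝ) : ℝ :=
  prodMean (fun _ : I => κ.c) fun c =>
    prodMean (fun t : I × L => κ.x (c t.1)) fun x =>
      prodMean (fun t : I × J => κ.a (c t.1)) fun a =>
        prodMean (fun t : I × J × K => κ.b (c t.1) (a (t.1, t.2.1))) fun b =>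
          prodMean (fun t : I × L × J × M => κ.d (c t.1) (x (t.1, t.2.1)) (a (t.1, t.2.2.1)))
            fun d => f ⟨c, x, a, b, d⟩

variable (κ : LayerLaw C X A B D)

theorem word_nonneg (c : C) (x : X) (a : A) (b : B) (d : D) : 0 ≤ κ.word c x a b d :=
  mul_nonneg (mul_nonneg (mul_nonneg (mul_nonneg (κ.c_nonneg _) (κ.x_nonneg _ _))
    (κ.a_nonneg _ _)) (κ.b_nonneg _ _ _)) (κ.d_nonneg _ _ _ _)

theorem mean_mono {f g : Codebook I L J K M C X A B D → ℝ} (h : ∀ ω, f ω ≤ g ω) :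
    κ.mean f ≤ κ.mean g :=
  prodMean_mono (fun _ _ => κ.c_nonneg _) fun _ =>
    prodMean_mono (fun _ _ => κ.x_nonneg _ _) fun _ =>
      prodMean_mono (fun _ _ => κ.a_nonneg _ _) fun _ =>
        prodMean_mono (fun _ _ => κ.b_nonneg _ _ _) fun _ =>
          prodMean_mono (fun _ _ => κ.d_nonneg _ _ _ _) fun _ => h _

theorem mean_add (f g : Codebook I L J K M C X A B D → ℝ) :
    κ.mean (fun ω => f ω + g ω) = κ.mean f + κ.mean g := by
  simp only [mean, prodMean_add]

theorem mean_mul_left (r : ℝ) (f : Codebook I L J K M C X A B D → ℝ) :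
    κ.mean (fun ω => r * f ω) = r * κ.mean f := by
  simp only [mean, prodMean_mul_left]

theorem mean_sum {S : Type*} (s : Finset S) (f : S → Codebook I L J K M C X A B D → ℝ) :
    κ.mean (fun ω => ∑ k ∈ s, f k ω) = ∑ k ∈ s, κ.mean (f k) := by
  simp only [mean, prodMean_sum]

theorem mean_const (r : ℝ) :
    κ.mean (fun _ : Codebook I L J K M C X A B D => r) = r := by
  simp only [mean, prodMean_const fun _ => κ.sum_d _ _ _, prodMean_const fun _ => κ.sum_b _ _,
    prodMean_const fun _ => κ.sum_a _, prodMean_const fun _ => κ.sum_x _,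
    prodMean_const fun _ => κ.sum_c]

theorem exists_le_of_mean_le {f : Codebook I L J K M C X A B D → ℝ} {r : ℝ}
    (h : κ.mean f ≤ r) : ∃ ω, f ω ≤ r := by
  by_contra! hc
  refine absurd h (not_le.2 ?_)
  unfold mean
  refine lt_prodMean ?_ ?_ fun c => lt_prodMean ?_ ?_ fun x => lt_prodMean ?_ ?_ fun a =>
    lt_prodMean ?_ ?_ fun b => lt_prodMean ?_ ?_ fun d => hc _
  exacts [fun _ => κ.c_nonneg, fun _ => κ.sum_c, fun _ => κ.x_nonneg _, fun _ => κ.sum_x _,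
    fun _ => κ.a_nonneg _, fun _ => κ.sum_a _, fun _ => κ.b_nonneg _ _, fun _ => κ.sum_b _ _,
    fun _ => κ.d_nonneg _ _ _, fun _ => κ.sum_d _ _ _]

/-- Joint law of the codewords at two positions of the random codebook: a layer of the second
position is shared with the first if all indices that the layer carries agree, and is fresh
otherwise. -/
theorem mean_two (i : I) (l : L) (j : J) (k : K) (m : M) (i' : I) (l' : L) (j' : J) (k' : K)
    (m' : M) (f : C → X → A → B → D → C → X → A → B → D → ℝ) :
    κ.mean (fun ω : Codebook I L J K M C X A B D =>
      f (ω.c i) (ω.x (i, l)) (ω.a (i, j)) (ω.b (i, j, k)) (ω.d (i, l, j, m))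
        (ω.c i') (ω.x (i', l')) (ω.a (i', j')) (ω.b (i', j', k')) (ω.d (i', l', j', m'))) =
    ∑ c, ∑ x, ∑ a, ∑ b, ∑ d, κ.word c x a b d *
      second (i = i') c κ.c fun c' =>
        second ((i, l) = (i', l')) x (κ.x c') fun x' =>
          second ((i, j) = (i', j')) a (κ.a c') fun a' =>
            second ((i, j, k) = (i', j', k')) b (κ.b c' a') fun b' =>
              second ((i, l, j, m) = (i', l', j', m')) d (κ.d c' x' a') fun d' =>
                f c x a b d c' x' a' b' d' := by
  set fD : C → X → A → B → C → X → A → B → ℝ := fun c x a b c' x' a' b' =>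
    ∑ d, κ.d c x a d * second ((i, l, j, m) = (i', l', j', m')) d (κ.d c' x' a') fun d' =>
      f c x a b d c' x' a' b' d' with hD
  set fB : C → X → A → C → X → A → ℝ := fun c x a c' x' a' =>
    ∑ b, κ.b c a b * second ((i, j, k) = (i', j', k')) b (κ.b c' a') fun b' =>
      fD c x a b c' x' a' b' with hB
  set fA : C → X → C → X → ℝ := fun c x c' x' =>
    ∑ a, κ.a c a * second ((i, j) = (i', j')) a (κ.a c') fun a' => fB c x a c' x' a' with hA
  set fX : C → C → ℝ := fun c c' =>
    ∑ x, κ.x c x * second ((i, l) = (i', l')) x (κ.x c') fun x' => fA c x c' x' with hX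
  have sD : ∀ (c : I → C) (x : I × L → X) (a : I × J → A) (b : I × J × K → B),
      prodMean (fun t : I × L × J × M => κ.d (c t.1) (x (t.1, t.2.1)) (a (t.1, t.2.2.1)))
        (fun d => f (c i) (x (i, l)) (a (i, j)) (b (i, j, k)) (d (i, l, j, m))
          (c i') (x (i', l')) (a (i', j')) (b (i', j', k')) (d (i', l', j', m'))) =
      fD (c i) (x (i, l)) (a (i, j)) (b (i, j, k)) (c i') (x (i', l')) (a (i', j'))
        (b (i', j', k')) := fun c x a b =>
    prodMean_two (fun _ => κ.sum_d _ _ _) (i, l, j, m) (i', l', j', m') fun d d' =>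
      f (c i) (x (i, l)) (a (i, j)) (b (i, j, k)) d (c i') (x (i', l')) (a (i', j'))
        (b (i', j', k')) d'
  have sB : ∀ (c : I → C) (x : I × L → X) (a : I × J → A),
      prodMean (fun t : I × J × K => κ.b (c t.1) (a (t.1, t.2.1)))
        (fun b => fD (c i) (x (i, l)) (a (i, j)) (b (i, j, k)) (c i') (x (i', l')) (a (i', j'))
          (b (i', j', k'))) =
      fB (c i) (x (i, l)) (a (i, j)) (c i') (x (i', l')) (a (i', j')) := fun c x a =>
    prodMean_two (fun _ => κ.sum_b _ _) (i, j, k) (i', j', k') fun b b' =>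
      fD (c i) (x (i, l)) (a (i, j)) b (c i') (x (i', l')) (a (i', j')) b'
  have sA : ∀ (c : I → C) (x : I × L → X),
      prodMean (fun t : I × J => κ.a (c t.1))
        (fun a => fB (c i) (x (i, l)) (a (i, j)) (c i') (x (i', l')) (a (i', j'))) =
      fA (c i) (x (i, l)) (c i') (x (i', l')) := fun c x =>
    prodMean_two (fun _ => κ.sum_a _) (i, j) (i', j') fun a a' =>
      fB (c i) (x (i, l)) a (c i') (x (i', l')) a'
  have sX : ∀ (c : I → C),
      prodMean (fun t : I × L => κ.x (c t.1)) (fun x => fA (c i) (x (i, l)) (c i') (x (i', l'))) =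
      fX (c i) (c i') := fun c =>
    prodMean_two (fun _ => κ.sum_x _) (i, l) (i', l') fun x x' => fA (c i) x (c i') x'
  have sC : prodMean (fun _ : I => κ.c) (fun c => fX (c i) (c i')) =
      ∑ c, κ.c c * second (i = i') c κ.c (fX c) :=
    prodMean_two (fun _ => κ.sum_c) i i' fX
  simp only [mean, sD, sB, sA, sX, sC]
  simp only [hX, hA, hB, hD, second_sum, second_mul_left, Finset.mul_sum, word, mul_assoc]

end LayerLaw

end codebook

/-! ### Sums over single-letter symbols -/

section symbols

variable {A C B D Z X Y₁ Y₂ : Type*}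

/-- Input symbols as tuples. -/
def inputEquiv : InputSymbols A C B D Z X ≃ C × X × A × B × D × Z where
  toFun s := (s.u2c, s.x₂, s.u1c, s.u1pb, s.u2pb, s.x₁)
  invFun t := ⟨t.2.2.1, t.1, t.2.2.2.1, t.2.2.2.2.1, t.2.2.2.2.2, t.2.1⟩
  left_inv _ := rfl
  right_inv _ := rfl

/-- A symbol consists of the input symbols and the two outputs. -/
def allEquiv : AllSymbols A C B D Z X Y₁ Y₂ ≃ InputSymbols A C B D Z X × Y₁ × Y₂ where
  toFun s := (s.toInputSymbols, s.y₁, s.y₂)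
  invFun t := ⟨t.1, t.2.1, t.2.2⟩
  left_inv _ := rfl
  right_inv _ := rfl

variable [Fintype A] [Fintype C] [Fintype B] [Fintype D] [Fintype Z] [Fintype X]

instance : Fintype (InputSymbols A C B D Z X) := Fintype.ofEquiv _ inputEquiv.symm

theorem sum_inputSymbols (F : InputSymbols A C B D Z X → ℝ) :
    ∑ s, F s = ∑ c, ∑ x, ∑ a, ∑ b, ∑ d, ∑ z, F ⟨a, c, b, d, z, x⟩ := by
  rw [← inputEquiv.symm.sum_comp]
  simp only [Fintype.sum_prod_type]
  rfl

variable [Fintype Y₁] [Fintype Y₂]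

instance : Fintype (AllSymbols A C B D Z X Y₁ Y₂) := Fintype.ofEquiv _ allEquiv.symm

theorem sum_allSymbols (F : AllSymbols A C B D Z X Y₁ Y₂ → ℝ) :
    ∑ s, F s = ∑ s, ∑ y₁, ∑ y₂, F ⟨s, y₁, y₂⟩ := by
  rw [← allEquiv.symm.sum_comp]
  simp only [Fintype.sum_prod_type]
  rfl

end symbols

/-! ### Means under the random codebook tilted to the input law -/

/-- A channel `W` together with a law `p` of auxiliary symbols and inputs, and with laws `κ` that
generate codewords and dominate `p`. The alphabet of the cognitive input `X₁` is `Z`. -/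
structure Model (A C B D Z X Y₁ Y₂ : Type*) [Fintype A] [Fintype C] [Fintype B] [Fintype D]
    [Fintype Z] [Fintype X] [Fintype Y₁] [Fintype Y₂] where
  κ : LayerLaw C X A B D
  p : InputSymbols A C B D Z X → ℝ
  W : Z → X → Y₁ → Y₂ → ℝ
  p_nonneg : ∀ s, 0 ≤ p s
  sum_p : ∑ s, p s = 1
  W_nonneg : ∀ z x y₁ y₂, 0 ≤ W z x y₁ y₂
  sum_W : ∀ z x, ∑ y₁, ∑ y₂, W z x y₁ y₂ = 1
  dominated : ∀ s, κ.word s.u2c s.x₂ s.u1c s.u1pb s.u2pb = 0 → p s = 0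

namespace Model

variable {A C B D Z X Y₁ Y₂ : Type*} [Fintype A] [Fintype C] [Fintype B] [Fintype D]
    [Fintype Z] [Fintype X] [Fintype Y₁] [Fintype Y₂] (μ : Model A C B D Z X Y₁ Y₂)

/-- The joint law of all symbols. -/
def P (s : AllSymbols A C B D Z X Y₁ Y₂) : ℝ := μ.p s.toInputSymbols * μ.W s.x₁ s.x₂ s.y₁ s.y₂

/-- The likelihood ratio of the input law to the law of the generated codewords. -/
def lik (s : InputSymbols A C B D Z X) : ℝ :=
  μ.p s / μ.κ.word s.u2c s.x₂ s.u1c s.u1pb s.u2pb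

theorem P_nonneg (s : AllSymbols A C B D Z X Y₁ Y₂) : 0 ≤ μ.P s :=
  mul_nonneg (μ.p_nonneg _) (μ.W_nonneg _ _ _ _)

theorem sum_P : ∑ s, μ.P s = 1 := by
  rw [sum_allSymbols, ← μ.sum_p]
  refine Finset.sum_congr rfl fun s _ => ?_
  simp only [P, ← Finset.mul_sum, μ.sum_W, mul_one]

theorem lik_nonneg (s : InputSymbols A C B D Z X) : 0 ≤ μ.lik s :=
  div_nonneg (μ.p_nonneg _) (μ.κ.word_nonneg _ _ _ _ _)

theorem word_mul_lik (s : InputSymbols A C B D Z X) :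
    μ.κ.word s.u2c s.x₂ s.u1c s.u1pb s.u2pb * μ.lik s = μ.p s := by
  by_cases h : μ.κ.word s.u2c s.x₂ s.u1c s.u1pb s.u2pb = 0
  · rw [h, zero_mul, μ.dominated s h]
  · rw [lik, mul_div_cancel₀ _ h]

/-- The law of the five auxiliary symbols that are carried by codewords. -/
def pv (c : C) (x : X) (a : A) (b : B) (d : D) : ℝ :=
  marg μ.P (fun s => (s.u2c, s.x₂, s.u1c, s.u1pb, s.u2pb)) (c, x, a, b, d)

theorem sum_p_eq_pv (c : C) (x : X) (a : A) (b : B) (d : D) :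
    ∑ z, μ.p ⟨a, c, b, d, z, x⟩ = μ.pv c x a b d := by
  classical
  have : ∀ s : InputSymbols A C B D Z X, ∑ y₁, ∑ y₂,
      (if (s.u2c, s.x₂, s.u1c, s.u1pb, s.u2pb) = (c, x, a, b, d)
        then μ.P ⟨s, y₁, y₂⟩ else 0) =
      if s.u2c = c then if s.x₂ = x then if s.u1c = a then if s.u1pb = b then
        if s.u2pb = d then μ.p s else 0 else 0 else 0 else 0 else 0 := by
    intro s
    simp only [Prod.mk.injEq, ← ite_and]
    split_ifs with h
    · simp only [P, ← Finset.mul_sum, μ.sum_W, mul_one]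
    · simp
  simp only [pv, marg]
  rw [sum_allSymbols]
  refine Eq.symm ?_
  calc _ = ∑ s : InputSymbols A C B D Z X, ∑ y₁, ∑ y₂,
      (if (s.u2c, s.x₂, s.u1c, s.u1pb, s.u2pb) = (c, x, a, b, d)
        then μ.P ⟨s, y₁, y₂⟩ else 0) := by
        refine Finset.sum_congr rfl fun s _ => Finset.sum_congr rfl fun y₁ _ =>
          Finset.sum_congr rfl fun y₂ _ => ?_
        congr
    _ = _ := by
        simp only [this]
        rw [sum_inputSymbols]
        simp only [Finset.sum_ite_irrel, Finset.sum_const_zero, Finset.sum_ite_eq',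
          Finset.mem_univ, if_true]
        rw [Finset.sum_comm]
        simp

variable {I L J K M : Type*} [Fintype I] [Fintype L] [Fintype J] [Fintype K] [Fintype M]
  [DecidableEq I] [DecidableEq L] [DecidableEq J] [DecidableEq K] [DecidableEq M]

/-- Tilting the codewords at one position by the likelihood ratio gives the joint law of all
symbols; the codewords at another position remain fresh, except for the shared layers. -/
theorem mean_lik (i : I) (l : L) (j : J) (k : K) (m : M) (i' : I) (l' : L) (j' : J) (k' : K)
    (m' : M) (h : AllSymbols A C B D Z X Y₁ Y₂ → C → X → A → B → D → ℝ) :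
    μ.κ.mean (fun ω : Codebook I L J K M C X A B D => ∑ z, ∑ y₁, ∑ y₂,
      μ.lik ⟨ω.a (i, j), ω.c i, ω.b (i, j, k), ω.d (i, l, j, m), z, ω.x (i, l)⟩ *
        μ.W z (ω.x (i, l)) y₁ y₂ *
        h ⟨⟨ω.a (i, j), ω.c i, ω.b (i, j, k), ω.d (i, l, j, m), z, ω.x (i, l)⟩, y₁, y₂⟩
        (ω.c i') (ω.x (i', l')) (ω.a (i', j')) (ω.b (i', j', k')) (ω.d (i', l', j', m'))) =
    ∑ s, μ.P s *
      second (i = i') s.u2c μ.κ.c fun c' =>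
        second ((i, l) = (i', l')) s.x₂ (μ.κ.x c') fun x' =>
          second ((i, j) = (i', j')) s.u1c (μ.κ.a c') fun a' =>
            second ((i, j, k) = (i', j', k')) s.u1pb (μ.κ.b c' a') fun b' =>
              second ((i, l, j, m) = (i', l', j', m')) s.u2pb (μ.κ.d c' x' a') fun d' =>
                h s c' x' a' b' d' := by
  rw [μ.κ.mean_two i l j k m i' l' j' k' m' fun c x a b d c' x' a' b' d' =>
    ∑ z, ∑ y₁, ∑ y₂, μ.lik ⟨a, c, b, d, z, x⟩ * μ.W z x y₁ y₂ *
      h ⟨⟨a, c, b, d, z, x⟩, y₁, y₂⟩ c' x' a' b' d', sum_allSymbols, sum_inputSymbols]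
  refine Finset.sum_congr rfl fun c _ => Finset.sum_congr rfl fun x _ =>
    Finset.sum_congr rfl fun a _ => Finset.sum_congr rfl fun b _ =>
    Finset.sum_congr rfl fun d _ => ?_
  simp only [second_sum, second_mul_left, Finset.mul_sum]
  refine Finset.sum_congr rfl fun z _ => Finset.sum_congr rfl fun y₁ _ =>
    Finset.sum_congr rfl fun y₂ _ => ?_
  simp only [P]
  rw [← μ.word_mul_lik ⟨a, c, b, d, z, x⟩]
  simp only [mul_assoc]

/-! ### Packing -/

/-- A wrong codeword triple is rarely typical with the output of receiver 1. -/
theorem packing₁ {T : C → A → B → Y₁ → Prop} {θ₁ θ₂ θ₃ : ℝ} (hθ₁ : 0 < θ₁) (hθ₂ : 0 < θ₂)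
    (hθ₃ : 0 < θ₃)
    (h₁ : ∀ c a b y, T c a b y →
      θ₁ * (marg μ.P (fun s => s.y₁) y * (μ.κ.c c * μ.κ.a c a * μ.κ.b c a b)) ≤
        marg μ.P (fun s => (s.y₁, s.u2c, s.u1c, s.u1pb)) (y, c, a, b))
    (h₂ : ∀ c a b y, T c a b y →
      θ₂ * (marg μ.P (fun s => (s.u2c, s.y₁)) (c, y) * (μ.κ.a c a * μ.κ.b c a b)) ≤
        marg μ.P (fun s => ((s.u2c, s.y₁), s.u1c, s.u1pb)) ((c, y), a, b))
    (h₃ : ∀ c a b y, T c a b y →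
      θ₃ * (marg μ.P (fun s => (s.u2c, s.u1c, s.y₁)) (c, a, y) * μ.κ.b c a b) ≤
        marg μ.P (fun s => ((s.u2c, s.u1c, s.y₁), s.u1pb)) ((c, a, y), b))
    (i : I) (l : L) (j : J) (k : K) (m : M) (i' : I) (j' : J) (k' : K)
    (hne : (i', j', k') ≠ (i, j, k)) :
    μ.κ.mean (fun ω : Codebook I L J K M C X A B D => ∑ z, ∑ y₁, ∑ y₂,
      μ.lik ⟨ω.a (i, j), ω.c i, ω.b (i, j, k), ω.d (i, l, j, m), z, ω.x (i, l)⟩ *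
        μ.W z (ω.x (i, l)) y₁ y₂ *
        ind (T (ω.c i') (ω.a (i', j')) (ω.b (i', j', k')) y₁)) ≤
    if i' ≠ i then θ₁⁻¹ else if j' ≠ j then θ₂⁻¹ else θ₃⁻¹ := by
  rw [μ.mean_lik i l j k m i' l j' k' m fun s c' _ a' b' _ => ind (T c' a' b' s.y₁)]
  simp only [second_const (μ.κ.sum_d _ _ _), second_const (μ.κ.sum_x _)]
  by_cases hi : i' = i
  · subst hi
    by_cases hj : j' = j
    · subst hj
      have hk : k ≠ k' := fun h => hne (by rw [h])
      simp only [second_of_same, second_of_ne, Prod.mk.injEq, true_and, hk, ne_eq, not_true,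
        if_false, not_false_eq_true]
      exact sum_fresh_le μ.P_nonneg μ.sum_P (fun s => (s.u2c, s.u1c, s.y₁)) (fun s => s.u1pb)
        (fun s t => μ.κ.b s.1 s.2.1 t) (fun s t => T s.1 s.2.1 t s.2.2) hθ₃
        fun s t h => h₃ _ _ _ _ h
    · simp only [second_of_same, second_of_ne, Prod.mk.injEq, true_and, Ne.symm hj, hj, ne_eq,
        not_true, if_false, not_false_eq_true, if_true, false_and]
      have := sum_fresh_le μ.P_nonneg μ.sum_P (fun s => (s.u2c, s.y₁)) (fun s => (s.u1c, s.u1pb))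
        (fun s t => μ.κ.a s.1 t.1 * μ.κ.b s.1 t.1 t.2) (fun s t => T s.1 t.1 t.2 s.2) hθ₂
        fun s t h => h₂ _ _ _ _ h
      simpa only [Fintype.sum_prod_type, Finset.mul_sum, mul_assoc] using this
  · simp only [second_of_ne, Prod.mk.injEq, Ne.symm hi, hi, ne_eq,
      not_false_eq_true, if_true, false_and]
    have := sum_fresh_le μ.P_nonneg μ.sum_P (fun s => s.y₁) (fun s => (s.u2c, s.u1c, s.u1pb))
      (fun _ t => μ.κ.c t.1 * μ.κ.a t.1 t.2.1 * μ.κ.b t.1 t.2.1 t.2.2)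
      (fun s t => T t.1 t.2.1 t.2.2 s) hθ₁ fun s t h => h₁ _ _ _ _ h
    simpa only [Fintype.sum_prod_type, Finset.mul_sum, mul_assoc] using this

/-- A wrong codeword quadruple is rarely typical with the output of receiver 2. -/
theorem packing₂ {T : C → X → A → D → Y₂ → Prop} {θ₁ θ₂ θ₃ θ₄ θ₅ : ℝ} (hθ₁ : 0 < θ₁)
    (hθ₂ : 0 < θ₂) (hθ₃ : 0 < θ₃) (hθ₄ : 0 < θ₄) (hθ₅ : 0 < θ₅)
    (h₁ : ∀ c x a d y, T c x a d y →
      θ₁ * (marg μ.P (fun s => s.y₂) y * (μ.κ.c c * μ.κ.x c x * μ.κ.a c a * μ.κ.d c x a d)) ≤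
        marg μ.P (fun s => (s.y₂, s.u2c, s.x₂, s.u1c, s.u2pb)) (y, c, x, a, d))
    (h₂ : ∀ c x a d y, T c x a d y →
      θ₂ * (marg μ.P (fun s => (s.u2c, s.y₂)) (c, y) *
          (μ.κ.x c x * μ.κ.a c a * μ.κ.d c x a d)) ≤
        marg μ.P (fun s => ((s.u2c, s.y₂), s.x₂, s.u1c, s.u2pb)) ((c, y), x, a, d))
    (h₃ : ∀ c x a d y, T c x a d y →
      θ₃ * (marg μ.P (fun s => (s.u2c, s.u1c, s.y₂)) (c, a, y) * (μ.κ.x c x * μ.κ.d c x a d)) ≤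
        marg μ.P (fun s => ((s.u2c, s.u1c, s.y₂), s.x₂, s.u2pb)) ((c, a, y), x, d))
    (h₄ : ∀ c x a d y, T c x a d y →
      θ₄ * (marg μ.P (fun s => (s.u2c, s.x₂, s.y₂)) (c, x, y) * (μ.κ.a c a * μ.κ.d c x a d)) ≤
        marg μ.P (fun s => ((s.u2c, s.x₂, s.y₂), s.u1c, s.u2pb)) ((c, x, y), a, d))
    (h₅ : ∀ c x a d y, T c x a d y →
      θ₅ * (marg μ.P (fun s => (s.u2c, s.x₂, s.u1c, s.y₂)) (c, x, a, y) * μ.κ.d c x a d) ≤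
        marg μ.P (fun s => ((s.u2c, s.x₂, s.u1c, s.y₂), s.u2pb)) ((c, x, a, y), d))
    (i : I) (l : L) (j : J) (k : K) (m : M) (i' : I) (l' : L) (j' : J) (m' : M)
    (hne : (i', l', j', m') ≠ (i, l, j, m)) :
    μ.κ.mean (fun ω : Codebook I L J K M C X A B D => ∑ z, ∑ y₁, ∑ y₂,
      μ.lik ⟨ω.a (i, j), ω.c i, ω.b (i, j, k), ω.d (i, l, j, m), z, ω.x (i, l)⟩ *
        μ.W z (ω.x (i, l)) y₁ y₂ *
        ind (T (ω.c i') (ω.x (i', l')) (ω.a (i', j')) (ω.d (i', l', j', m')) y₂)) ≤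
    if i' ≠ i then θ₁⁻¹ else if l' ≠ l then (if j' ≠ j then θ₂⁻¹ else θ₃⁻¹)
      else if j' ≠ j then θ₄⁻¹ else θ₅⁻¹ := by
  rw [μ.mean_lik i l j k m i' l' j' k m' fun s c' x' a' _ d' => ind (T c' x' a' d' s.y₂)]
  simp only [second_const (μ.κ.sum_b _ _)]
  by_cases hi : i' = i
  · subst hi
    by_cases hl : l' = l
    · subst hl
      by_cases hj : j' = j
      · subst hj
        have hm : m ≠ m' := fun h => hne (by rw [h])
        simp only [second_of_same, second_of_ne, Prod.mk.injEq, true_and, hm, ne_eq, not_true,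
          if_false, not_false_eq_true]
        exact sum_fresh_le μ.P_nonneg μ.sum_P (fun s => (s.u2c, s.x₂, s.u1c, s.y₂))
          (fun s => s.u2pb) (fun s t => μ.κ.d s.1 s.2.1 s.2.2.1 t)
          (fun s t => T s.1 s.2.1 s.2.2.1 t s.2.2.2) hθ₅ fun s t h => h₅ _ _ _ _ _ h
      · simp only [second_of_same, second_of_ne, Prod.mk.injEq, true_and, Ne.symm hj, hj, ne_eq,
          not_true, if_false, not_false_eq_true, if_true, false_and]
        have := sum_fresh_le μ.P_nonneg μ.sum_P (fun s => (s.u2c, s.x₂, s.y₂))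
          (fun s => (s.u1c, s.u2pb))
          (fun s t => μ.κ.a s.1 t.1 * μ.κ.d s.1 s.2.1 t.1 t.2)
          (fun s t => T s.1 s.2.1 t.1 t.2 s.2.2) hθ₄ fun s t h => h₄ _ _ _ _ _ h
        simpa only [Fintype.sum_prod_type, Finset.mul_sum, mul_assoc] using this
    · by_cases hj : j' = j
      · subst hj
        simp only [second_of_same, second_of_ne, Prod.mk.injEq, true_and, Ne.symm hl, hl, ne_eq,
          not_true, if_false, not_false_eq_true, if_true, false_and]
        have := sum_fresh_le μ.P_nonneg μ.sum_P (fun s => (s.u2c, s.u1c, s.y₂))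
          (fun s => (s.x₂, s.u2pb))
          (fun s t => μ.κ.x s.1 t.1 * μ.κ.d s.1 t.1 s.2.1 t.2)
          (fun s t => T s.1 t.1 s.2.1 t.2 s.2.2) hθ₃ fun s t h => h₃ _ _ _ _ _ h
        simpa only [Fintype.sum_prod_type, Finset.mul_sum, mul_assoc] using this
      · simp only [second_of_same, second_of_ne, Prod.mk.injEq, true_and, Ne.symm hl, hl,
          Ne.symm hj, hj, ne_eq, not_true, if_false, not_false_eq_true, if_true, false_and]
        have := sum_fresh_le μ.P_nonneg μ.sum_P (fun s => (s.u2c, s.y₂))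
          (fun s => (s.x₂, s.u1c, s.u2pb))
          (fun s t => μ.κ.x s.1 t.1 * μ.κ.a s.1 t.2.1 * μ.κ.d s.1 t.1 t.2.1 t.2.2)
          (fun s t => T s.1 t.1 t.2.1 t.2.2 s.2) hθ₂ fun s t h => h₂ _ _ _ _ _ h
        simpa only [Fintype.sum_prod_type, Finset.mul_sum, mul_assoc] using this
  · simp only [second_of_ne, Prod.mk.injEq, Ne.symm hi, hi, ne_eq,
      not_false_eq_true, if_true, false_and]
    have := sum_fresh_le μ.P_nonneg μ.sum_P (fun s => s.y₂) (fun s => (s.u2c, s.x₂, s.u1c, s.u2pb))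
      (fun _ t => μ.κ.c t.1 * μ.κ.x t.1 t.2.1 * μ.κ.a t.1 t.2.2.1 * μ.κ.d t.1 t.2.1 t.2.2.1 t.2.2.2)
      (fun s t => T t.1 t.2.1 t.2.2.1 t.2.2.2 s) hθ₁ fun s t h => h₁ _ _ _ _ _ h
    simpa only [Fintype.sum_prod_type, Finset.mul_sum, mul_assoc] using this

end Model

/-! ### Covering -/

theorem sum_mul_div_le {T : Type*} [Fintype T] {κ g : T → ℝ} {q r : ℝ} (hκ : ∀ t, 0 ≤ κ t)
    (hg : ∀ t, 0 ≤ g t) (hq : 0 ≤ q) (hr : 0 ≤ r) (h : ∑ t, g t ≤ r * q) :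
    ∑ t, κ t * (g t / (q * κ t)) ≤ r := by
  calc _ ≤ ∑ t, g t / q := by
        refine Finset.sum_le_sum fun t _ => ?_
        rcases eq_or_lt_of_le (hκ t) with h0 | h0
        · rw [← h0, zero_mul]
          exact div_nonneg (hg t) hq
        · rw [mul_div_assoc', mul_comm q, mul_div_mul_left _ _ h0.ne']
    _ = (∑ t, g t) / q := (Finset.sum_div _ _ _).symm
    _ ≤ r := div_le_of_le_mul₀ hq hr h

namespace Model

variable {A C B D Z X Y₁ Y₂ : Type*} [Fintype A] [Fintype C] [Fintype B] [Fintype D]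
    [Fintype Z] [Fintype X] [Fintype Y₁] [Fintype Y₂] (μ : Model A C B D Z X Y₁ Y₂)
  {I L J K M : Type*} [Fintype I] [Fintype L] [Fintype J] [Fintype K] [Fintype M]
  [DecidableEq I] [DecidableEq L] [DecidableEq J] [DecidableEq K] [DecidableEq M]

theorem pv_nonneg (c : C) (x : X) (a : A) (b : B) (d : D) : 0 ≤ μ.pv c x a b d :=
  marg_nonneg μ.P_nonneg _ _

/-- The likelihood ratio of the codeword symbols, restricted to the set `T`. -/
def setLik (T : C → X → A → B → D → Prop) (c : C) (x : X) (a : A) (b : B) (d : D) : ℝ :=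
  ind (T c x a b d) * (μ.pv c x a b d / μ.κ.word c x a b d)

theorem sum_lik_mul (c : C) (x : X) (a : A) (b : B) (d : D) (r : ℝ) :
    ∑ z, ∑ y₁, ∑ y₂, μ.lik ⟨a, c, b, d, z, x⟩ * μ.W z x y₁ y₂ * r =
      μ.pv c x a b d / μ.κ.word c x a b d * r := by
  rw [← μ.sum_p_eq_pv, Finset.sum_div, Finset.sum_mul]
  refine Finset.sum_congr rfl fun z _ => ?_
  simp only [← Finset.sum_mul, ← Finset.mul_sum, μ.sum_W, mul_one, lik]

theorem mean_setLik (T : C → X → A → B → D → Prop) (i : I) (l : L) (j : J) (k : K) (m : M) :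
    μ.κ.mean (fun ω : Codebook I L J K M C X A B D => μ.setLik T (ω.c i) (ω.x (i, l))
      (ω.a (i, j)) (ω.b (i, j, k)) (ω.d (i, l, j, m))) =
    ∑ s, μ.P s * ind (T s.u2c s.x₂ s.u1c s.u1pb s.u2pb) := by
  have := μ.mean_lik i l j k m i l j k m fun s _ _ _ _ _ => ind (T s.u2c s.x₂ s.u1c s.u1pb s.u2pb)
  simp only [second_of_same, sum_lik_mul] at this
  rw [← this]
  simp only [setLik, mul_comm]

/-- Second moment of the restricted likelihood ratio at two positions that carry the same messages:
it is at most `1` if they share no layer with a bin position, and at most `K₁`, `K₂` or `K₃` if they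
share one (`U1c`, with or without `U2pb` agreeing in its bin position), two (`U1c`, `U1pb`) or all
three of these layers. -/
theorem mean_setLik_mul_le {T : C → X → A → B → D → Prop} {K₁ K₂ K₃ : ℝ} (hK₁ : 0 ≤ K₁)
    (hK₂ : 0 ≤ K₂) (hK₃ : 0 ≤ K₃)
    (h₀ : ∀ c x, marg μ.P (fun s => (s.u2c, s.x₂)) (c, x) ≤ μ.κ.c c * μ.κ.x c x)
    (h₁ : ∀ c x a b d, T c x a b d → marg μ.P (fun s => (s.u2c, s.x₂, s.u1c)) (c, x, a) ≤
      K₁ * (μ.κ.c c * μ.κ.x c x * μ.κ.a c a))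
    (h₁' : ∀ c x a b d, T c x a b d →
      marg μ.P (fun s => (s.u2c, s.x₂, s.u1c, s.u2pb)) (c, x, a, d) ≤
      K₁ * (μ.κ.c c * μ.κ.x c x * μ.κ.a c a * μ.κ.d c x a d))
    (h₂ : ∀ c x a b d, T c x a b d →
      marg μ.P (fun s => (s.u2c, s.x₂, s.u1c, s.u1pb)) (c, x, a, b) ≤
      K₂ * (μ.κ.c c * μ.κ.x c x * μ.κ.a c a * μ.κ.b c a b))
    (h₃ : ∀ c x a b d, T c x a b d → μ.pv c x a b d ≤ K₃ * μ.κ.word c x a b d)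
    (i : I) (l : L) (j : J) (k : K) (m : M) (j' : J) (k' : K) (m' : M) :
    μ.κ.mean (fun ω : Codebook I L J K M C X A B D =>
      μ.setLik T (ω.c i) (ω.x (i, l)) (ω.a (i, j)) (ω.b (i, j, k)) (ω.d (i, l, j, m)) *
      μ.setLik T (ω.c i) (ω.x (i, l)) (ω.a (i, j')) (ω.b (i, j', k')) (ω.d (i, l, j', m'))) ≤
    if j = j' then (if k = k' then (if m = m' then K₃ else K₂) else K₁) else 1 := by
  have key := μ.mean_lik i l j k m i l j' k' m' fun s c' x' a' b' d' =>
    ind (T s.u2c s.x₂ s.u1c s.u1pb s.u2pb) * μ.setLik T c' x' a' b' d'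
  have hle : ∀ c x a b d, μ.setLik T c x a b d ≤ μ.pv c x a b d / μ.κ.word c x a b d :=
    fun c x a b d => mul_le_of_le_one_left
      (div_nonneg (μ.pv_nonneg _ _ _ _ _) (μ.κ.word_nonneg _ _ _ _ _)) (ind_le_one _)
  -- a mean over the typical set is at most the bound that holds on this set
  have fin : ∀ (F : AllSymbols A C B D Z X Y₁ Y₂ → ℝ) (r : ℝ), 0 ≤ r →
      (∀ s, T s.u2c s.x₂ s.u1c s.u1pb s.u2pb → F s ≤ r) →
      ∑ s, μ.P s * (ind (T s.u2c s.x₂ s.u1c s.u1pb s.u2pb) * F s) ≤ r := by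
    intro F r hr hF
    calc _ ≤ ∑ s, μ.P s * r := by
          refine Finset.sum_le_sum fun s _ => mul_le_mul_of_nonneg_left ?_ (μ.P_nonneg s)
          by_cases h : T s.u2c s.x₂ s.u1c s.u1pb s.u2pb
          · rw [ind_of_true h, one_mul]; exact hF s h
          · rw [ind_of_false h, zero_mul]; exact hr
      _ = r := by rw [← Finset.sum_mul, μ.sum_P, one_mul]
  calc _ = ∑ s, μ.P s * (ind (T s.u2c s.x₂ s.u1c s.u1pb s.u2pb) *
        second ((i, j) = (i, j')) s.u1c (μ.κ.a s.u2c) fun a' =>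
          second ((i, j, k) = (i, j', k')) s.u1pb (μ.κ.b s.u2c a') fun b' =>
            second ((i, l, j, m) = (i, l, j', m')) s.u2pb (μ.κ.d s.u2c s.x₂ a') fun d' =>
              μ.setLik T s.u2c s.x₂ a' b' d') := by
        simp only [second_of_same, second_mul_left, sum_lik_mul] at key
        rw [← key]
        congr 1
        funext ω
        simp only [setLik]
        ring
    _ ≤ _ := by
        -- In each case the fresh layers of the second position integrate to `1`, and the ratio that
        -- remains is the likelihood ratio of the shared layers.
        by_cases hj : j = j'
        · subst hj
          by_cases hk : k = k'
          · subst hk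
            by_cases hm : m = m'
            · subst hm
              simp only [second_of_same, if_true]
              refine fin _ _ hK₃ fun s hs => (hle _ _ _ _ _).trans ?_
              exact div_le_of_le_mul₀ (μ.κ.word_nonneg _ _ _ _ _) hK₃ (h₃ _ _ _ _ _ hs)
            · simp only [second_of_same, second_of_ne, Prod.mk.injEq, true_and, hm,
                not_false_eq_true, if_true, if_false]
              refine fin _ _ hK₂ fun s hs => ?_
              refine (Finset.sum_le_sum fun d _ =>
                mul_le_mul_of_nonneg_left (hle _ _ _ _ _) (μ.κ.d_nonneg _ _ _ _)).trans ?_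
              refine sum_mul_div_le (fun d => μ.κ.d_nonneg _ _ _ d)
                (fun d => μ.pv_nonneg _ _ _ _ d) (mul_nonneg (mul_nonneg (mul_nonneg
                  (μ.κ.c_nonneg _) (μ.κ.x_nonneg _ _)) (μ.κ.a_nonneg _ _)) (μ.κ.b_nonneg _ _ _))
                hK₂ (le_trans (le_of_eq ?_) (h₂ _ _ _ _ _ hs))
              rw [← sum_marg_pair μ.P (fun s => (s.u2c, s.x₂, s.u1c, s.u1pb)) fun s => s.u2pb]
              exact Finset.sum_congr rfl fun d _ => marg_congr _ fun s => by
                simp only [Prod.mk.injEq, and_assoc]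
          · by_cases hm : m = m'
            -- `U2pb` does not depend on the `U1pb` index, so it can be shared without `U1pb`
            · subst hm
              simp only [second_of_same, second_of_ne, Prod.mk.injEq, true_and, hk,
                not_false_eq_true, if_true, if_false]
              refine fin _ _ hK₁ fun s hs => ?_
              refine (Finset.sum_le_sum fun b _ =>
                mul_le_mul_of_nonneg_left (hle _ _ _ _ _) (μ.κ.b_nonneg _ _ _)).trans ?_
              have := sum_mul_div_le (fun b => μ.κ.b_nonneg s.u2c s.u1c b)
                (fun b => μ.pv_nonneg s.u2c s.x₂ s.u1c b s.u2pb) (mul_nonneg (mul_nonneg (mul_nonneg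
                  (μ.κ.c_nonneg s.u2c) (μ.κ.x_nonneg s.u2c s.x₂)) (μ.κ.a_nonneg s.u2c s.u1c))
                    (μ.κ.d_nonneg s.u2c s.x₂ s.u1c s.u2pb))
                hK₁ (le_trans (le_of_eq ?_) (h₁' _ _ _ _ _ hs))
              · simpa only [LayerLaw.word, mul_right_comm _ (μ.κ.d _ _ _ _)] using this
              rw [← sum_marg_pair μ.P (fun s => (s.u2c, s.x₂, s.u1c, s.u2pb)) fun s => s.u1pb]
              exact Finset.sum_congr rfl fun d _ => marg_congr _ fun s => by
                simp only [Prod.mk.injEq]; tauto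
            · simp only [second_of_same, second_of_ne, Prod.mk.injEq, true_and, hk, hm,
                not_false_eq_true, if_true, if_false]
              refine fin _ _ hK₁ fun s hs => ?_
              refine (Finset.sum_le_sum fun b _ => mul_le_mul_of_nonneg_left
                (Finset.sum_le_sum fun d _ =>
                mul_le_mul_of_nonneg_left (hle _ _ _ _ _) (μ.κ.d_nonneg _ _ _ _))
                (μ.κ.b_nonneg _ _ _)).trans ?_
              have := sum_mul_div_le (T := B × D)
                (κ := fun t => μ.κ.b s.u2c s.u1c t.1 * μ.κ.d s.u2c s.x₂ s.u1c t.2)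
                (fun t => mul_nonneg (μ.κ.b_nonneg _ _ _) (μ.κ.d_nonneg _ _ _ _))
                (fun t => μ.pv_nonneg s.u2c s.x₂ s.u1c t.1 t.2) (mul_nonneg (mul_nonneg
                  (μ.κ.c_nonneg s.u2c) (μ.κ.x_nonneg s.u2c s.x₂)) (μ.κ.a_nonneg s.u2c s.u1c))
                hK₁ (le_trans (le_of_eq ?_) (h₁ _ _ _ _ _ hs))
              · simpa only [LayerLaw.word, Fintype.sum_prod_type, Finset.mul_sum, mul_assoc]
                  using this
              rw [← sum_marg_pair μ.P (fun s => (s.u2c, s.x₂, s.u1c)) fun s => (s.u1pb, s.u2pb)]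
              exact Finset.sum_congr rfl fun d _ => marg_congr _ fun s => by
                simp only [Prod.ext_iff, and_assoc]
        · simp only [second_of_ne, Prod.mk.injEq, true_and, hj, false_and,
            not_false_eq_true, if_false]
          refine fin _ _ zero_le_one fun s hs => ?_
          refine (Finset.sum_le_sum fun a _ => mul_le_mul_of_nonneg_left
            (Finset.sum_le_sum fun b _ => mul_le_mul_of_nonneg_left
            (Finset.sum_le_sum fun d _ =>
            mul_le_mul_of_nonneg_left (hle _ _ _ _ _) (μ.κ.d_nonneg _ _ _ _))
            (μ.κ.b_nonneg _ _ _)) (μ.κ.a_nonneg _ _)).trans ?_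
          have := sum_mul_div_le (T := A × B × D)
            (κ := fun t => μ.κ.a s.u2c t.1 * μ.κ.b s.u2c t.1 t.2.1 * μ.κ.d s.u2c s.x₂ t.1 t.2.2)
            (fun t => mul_nonneg (mul_nonneg (μ.κ.a_nonneg _ _) (μ.κ.b_nonneg _ _ _))
              (μ.κ.d_nonneg _ _ _ _))
            (fun t => μ.pv_nonneg s.u2c s.x₂ t.1 t.2.1 t.2.2) (mul_nonneg
              (μ.κ.c_nonneg s.u2c) (μ.κ.x_nonneg s.u2c s.x₂))
            zero_le_one (le_trans (le_of_eq ?_) ((h₀ _ _).trans_eq (one_mul _).symm))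
          · simpa only [LayerLaw.word, Fintype.sum_prod_type, Finset.mul_sum, mul_assoc]
              using this
          rw [← sum_marg_pair μ.P (fun s => (s.u2c, s.x₂)) fun s => (s.u1c, s.u1pb, s.u2pb)]
          exact Finset.sum_congr rfl fun d _ => marg_congr _ fun s => by
            simp only [Prod.ext_iff, and_assoc]

end Model

/-! ### Typical sets and mutual covering -/

open Classical in
/-- The decoder that returns the message `msg t` of some index `t` in `G`, if there is one. -/
def pick {τ V : Type*} (G : τ → Prop) (msg : τ → V) (v₀ : V) : V :=
  if h : ∃ t, G t then msg h.choose else v₀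

/-- If the decoder errs, then the true index is not in `G` or an index of a wrong message is. Wrong
indices of the right message do no harm. -/
theorem ind_pick_ne_le {τ V : Type*} [Fintype τ] (G : τ → Prop) (msg : τ → V) (v₀ : V) (t₀ : τ) :
    ind (pick G msg v₀ ≠ msg t₀) ≤ ind (¬ G t₀) + ∑ t, ind (msg t ≠ msg t₀) * ind (G t) := by
  have hsum : ∀ t, 0 ≤ ind (msg t ≠ msg t₀) * ind (G t) := fun t =>
    mul_nonneg (ind_nonneg _) (ind_nonneg _)
  by_cases h0 : G t₀
  · have hex : ∃ t, G t := ⟨t₀, h0⟩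
    by_cases hm : msg hex.choose = msg t₀
    · have : ¬ (pick G msg v₀ ≠ msg t₀) := by simp [pick, hex, hm]
      rw [ind_of_false this]
      exact add_nonneg (ind_nonneg _) (Finset.sum_nonneg fun t _ => hsum t)
    · refine (ind_le_one _).trans ?_
      have := Finset.single_le_sum (fun t _ => hsum t) (Finset.mem_univ hex.choose)
      rw [ind_of_true hm, ind_of_true hex.choose_spec] at this
      linarith [ind_nonneg (¬ G t₀)]
  · rw [ind_of_true h0]
    linarith [ind_le_one (pick G msg v₀ ≠ msg t₀), Finset.sum_nonneg fun t (_ : t ∈ Finset.univ) =>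
        hsum t]

namespace Model

variable {A C B D Z X Y₁ Y₂ : Type*} [Fintype A] [Fintype C] [Fintype B] [Fintype D]
    [Fintype Z] [Fintype X] [Fintype Y₁] [Fintype Y₂] (μ : Model A C B D Z X Y₁ Y₂)

/-- Sets of jointly typical symbols: `T` for the binning encoder, `T₁` and `T₂` for the receivers,
with the bounds on the likelihood ratios that hold on them. -/
structure TypicalSets where
  T : C → X → A → B → D → Prop
  T₁ : C → A → B → Y₁ → Prop
  T₂ : C → X → A → D → Y₂ → Prop
  (K₁ K₂ K₃ α₁ α₂ α₃ β₁ β₂ β₃ β₄ β₅ : ℝ)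
  K₁_nonneg : 0 ≤ K₁
  K₂_nonneg : 0 ≤ K₂
  K₃_nonneg : 0 ≤ K₃
  α₁_pos : 0 < α₁
  α₂_pos : 0 < α₂
  α₃_pos : 0 < α₃
  β₁_pos : 0 < β₁
  β₂_pos : 0 < β₂
  β₃_pos : 0 < β₃
  β₄_pos : 0 < β₄
  β₅_pos : 0 < β₅
  k₀ : ∀ c x, marg μ.P (fun s => (s.u2c, s.x₂)) (c, x) ≤ μ.κ.c c * μ.κ.x c x
  k₁ : ∀ c x a b d, T c x a b d → marg μ.P (fun s => (s.u2c, s.x₂, s.u1c)) (c, x, a) ≤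
    K₁ * (μ.κ.c c * μ.κ.x c x * μ.κ.a c a)
  k₁' : ∀ c x a b d, T c x a b d →
    marg μ.P (fun s => (s.u2c, s.x₂, s.u1c, s.u2pb)) (c, x, a, d) ≤
      K₁ * (μ.κ.c c * μ.κ.x c x * μ.κ.a c a * μ.κ.d c x a d)
  k₂ : ∀ c x a b d, T c x a b d →
    marg μ.P (fun s => (s.u2c, s.x₂, s.u1c, s.u1pb)) (c, x, a, b) ≤
      K₂ * (μ.κ.c c * μ.κ.x c x * μ.κ.a c a * μ.κ.b c a b)
  k₃ : ∀ c x a b d, T c x a b d → μ.pv c x a b d ≤ K₃ * μ.κ.word c x a b d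
  a₁ : ∀ c a b y, T₁ c a b y →
    α₁ * (marg μ.P (fun s => s.y₁) y * (μ.κ.c c * μ.κ.a c a * μ.κ.b c a b)) ≤
      marg μ.P (fun s => (s.y₁, s.u2c, s.u1c, s.u1pb)) (y, c, a, b)
  a₂ : ∀ c a b y, T₁ c a b y →
    α₂ * (marg μ.P (fun s => (s.u2c, s.y₁)) (c, y) * (μ.κ.a c a * μ.κ.b c a b)) ≤
      marg μ.P (fun s => ((s.u2c, s.y₁), s.u1c, s.u1pb)) ((c, y), a, b)
  a₃ : ∀ c a b y, T₁ c a b y →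
    α₃ * (marg μ.P (fun s => (s.u2c, s.u1c, s.y₁)) (c, a, y) * μ.κ.b c a b) ≤
      marg μ.P (fun s => ((s.u2c, s.u1c, s.y₁), s.u1pb)) ((c, a, y), b)
  b₁ : ∀ c x a d y, T₂ c x a d y →
    β₁ * (marg μ.P (fun s => s.y₂) y * (μ.κ.c c * μ.κ.x c x * μ.κ.a c a * μ.κ.d c x a d)) ≤
      marg μ.P (fun s => (s.y₂, s.u2c, s.x₂, s.u1c, s.u2pb)) (y, c, x, a, d)
  b₂ : ∀ c x a d y, T₂ c x a d y →
    β₂ * (marg μ.P (fun s => (s.u2c, s.y₂)) (c, y) *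
        (μ.κ.x c x * μ.κ.a c a * μ.κ.d c x a d)) ≤
      marg μ.P (fun s => ((s.u2c, s.y₂), s.x₂, s.u1c, s.u2pb)) ((c, y), x, a, d)
  b₃ : ∀ c x a d y, T₂ c x a d y →
    β₃ * (marg μ.P (fun s => (s.u2c, s.u1c, s.y₂)) (c, a, y) * (μ.κ.x c x * μ.κ.d c x a d)) ≤
      marg μ.P (fun s => ((s.u2c, s.u1c, s.y₂), s.x₂, s.u2pb)) ((c, a, y), x, d)
  b₄ : ∀ c x a d y, T₂ c x a d y →
    β₄ * (marg μ.P (fun s => (s.u2c, s.x₂, s.y₂)) (c, x, y) * (μ.κ.a c a * μ.κ.d c x a d)) ≤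
      marg μ.P (fun s => ((s.u2c, s.x₂, s.y₂), s.u1c, s.u2pb)) ((c, x, y), a, d)
  b₅ : ∀ c x a d y, T₂ c x a d y →
    β₅ * (marg μ.P (fun s => (s.u2c, s.x₂, s.u1c, s.y₂)) (c, x, a, y) * μ.κ.d c x a d) ≤
      marg μ.P (fun s => ((s.u2c, s.x₂, s.u1c, s.y₂), s.u2pb)) ((c, x, a, y), d)

variable {μ} (τ : μ.TypicalSets)
  (I L Wa Ba Wb Bb Wd Bd : Type*) [Fintype I] [Fintype L] [Fintype Wa] [Fintype Ba] [Fintype Wb]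
  [Fintype Bb] [Fintype Wd] [Fintype Bd]

/-- The typical sets have mass at least `1 - η`, and the numbers of codewords are small for the
receivers and large for the binning encoder, up to the factor `ρ`. The indices of the layers `U1c`,
`U1pb`, `U2pb` are pairs of a message (`Wa`, `Wb`, `Wd`) and a bin position (`Ba`, `Bb`, `Bd`).
A receiver's bound is needed only if a message of its own can be wrong. -/
structure TypicalSets.Fits (ρ η : ℝ) : Prop where
  ρ_nonneg : 0 ≤ ρ
  mass : ∑ s, μ.P s * ind (¬ τ.T s.u2c s.x₂ s.u1c s.u1pb s.u2pb) ≤ η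
  mass₁ : ∑ s, μ.P s * ind (¬ τ.T₁ s.u2c s.u1c s.u1pb s.y₁) ≤ η
  mass₂ : ∑ s, μ.P s * ind (¬ τ.T₂ s.u2c s.x₂ s.u1c s.u2pb s.y₂) ≤ η
  bin₁ : τ.K₁ ≤ ρ * Fintype.card Ba
  bin₂ : τ.K₂ ≤ ρ * (Fintype.card Ba * Fintype.card Bb)
  bin₃ : τ.K₃ ≤ ρ * (Fintype.card Ba * Fintype.card Bb * Fintype.card Bd)
  α₁_le : Nontrivial (Wa × Wb) → τ.α₁⁻¹ * (Fintype.card I * (Fintype.card (Wa × Ba) *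
    Fintype.card (Wb × Bb))) ≤ ρ
  α₂_le : Nontrivial (Wa × Wb) → τ.α₂⁻¹ * (Fintype.card (Wa × Ba) * Fintype.card (Wb × Bb)) ≤ ρ
  α₃_le : Nontrivial Wb → τ.α₃⁻¹ * Fintype.card (Wb × Bb) ≤ ρ
  β₁_le : Nontrivial I → τ.β₁⁻¹ * (Fintype.card I * (Fintype.card L * (Fintype.card (Wa × Ba) *
    Fintype.card (Wd × Bd)))) ≤ ρ
  β₂_le : Nontrivial L → τ.β₂⁻¹ * (Fintype.card L * (Fintype.card (Wa × Ba) *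
    Fintype.card (Wd × Bd))) ≤ ρ
  β₃_le : Nontrivial L → τ.β₃⁻¹ * (Fintype.card L * Fintype.card (Wd × Bd)) ≤ ρ
  β₄_le : Nontrivial Wd → τ.β₄⁻¹ * (Fintype.card (Wa × Ba) * Fintype.card (Wd × Bd)) ≤ ρ
  β₅_le : Nontrivial Wd → τ.β₅⁻¹ * Fintype.card (Wd × Bd) ≤ ρ

variable {I L Wa Ba Wb Bb Wd Bd} {τ}
  [DecidableEq I] [DecidableEq L] [DecidableEq Wa] [DecidableEq Ba] [DecidableEq Wb]
  [DecidableEq Bb] [DecidableEq Wd] [DecidableEq Bd] {ρ η : ℝ}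

/-- The normalized sum of the likelihood ratios over the bins of given messages. -/
def binSum (τ : μ.TypicalSets) (i : I) (l : L) (wa : Wa) (wb : Wb) (wd : Wd)
    (ω : Codebook I L (Wa × Ba) (Wb × Bb) (Wd × Bd) C X A B D) : ℝ :=
  (Fintype.card (Ba × Bb × Bd) : ℝ)⁻¹ * ∑ β : Ba × Bb × Bd,
    μ.setLik τ.T (ω.c i) (ω.x (i, l)) (ω.a (i, wa, β.1)) (ω.b (i, (wa, β.1), wb, β.2.1))
      (ω.d (i, l, (wa, β.1), wd, β.2.2))

/-- The mutual covering lemma: the normalized sum over the bins concentrates at `1`. -/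
theorem mean_binSum_sub_one_sq_le [Nonempty Ba] [Nonempty Bb] [Nonempty Bd]
    (h : τ.Fits I L Wa Ba Wb Bb Wd Bd ρ η) (i : I) (l : L) (wa : Wa) (wb : Wb) (wd : Wd) :
    μ.κ.mean (fun ω : Codebook I L (Wa × Ba) (Wb × Bb) (Wd × Bd) C X A B D =>
      (1 - binSum τ i l wa wb wd ω) ^ 2) ≤ 2 * η + 4 * ρ := by
  set n : ℝ := ((Fintype.card (Ba × Bb × Bd) : ℕ) : ℝ) with hn
  have hn0 : 0 < n := by rw [hn]; exact_mod_cast Fintype.card_pos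
  set ℓ : Ba × Bb × Bd → Codebook I L (Wa × Ba) (Wb × Bb) (Wd × Bd) C X A B D → ℝ := fun β ω =>
    μ.setLik τ.T (ω.c i) (ω.x (i, l)) (ω.a (i, wa, β.1)) (ω.b (i, (wa, β.1), wb, β.2.1))
      (ω.d (i, l, (wa, β.1), wd, β.2.2)) with hℓ
  have first : ∀ β, 1 - η ≤ μ.κ.mean (ℓ β) := by
    intro β
    rw [hℓ]
    simp only []
    rw [μ.mean_setLik τ.T i l (wa, β.1) (wb, β.2.1) (wd, β.2.2)]
    have h1 : ∑ s, μ.P s * ind (τ.T s.u2c s.x₂ s.u1c s.u1pb s.u2pb) +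
        ∑ s, μ.P s * ind (¬ τ.T s.u2c s.x₂ s.u1c s.u1pb s.u2pb) = 1 := by
      rw [← Finset.sum_add_distrib]
      simp only [← mul_add, ind_add_ind_not, mul_one, μ.sum_P]
    linarith [h.mass]
  have second : ∀ β β', μ.κ.mean (fun ω => ℓ β ω * ℓ β' ω) ≤
      1 + ind (β.1 = β'.1) * (τ.K₁ + ind (β.2.1 = β'.2.1) * (τ.K₂ +
        ind (β.2.2 = β'.2.2) * τ.K₃)) := by
    intro β β'
    refine (μ.mean_setLik_mul_le τ.K₁_nonneg τ.K₂_nonneg τ.K₃_nonneg τ.k₀ τ.k₁ τ.k₁' τ.k₂ τ.k₃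
      i l (wa, β.1) (wb, β.2.1) (wd, β.2.2) (wa, β'.1) (wb, β'.2.1) (wd, β'.2.2)).trans ?_
    have := τ.K₁_nonneg
    have := τ.K₂_nonneg
    have := τ.K₃_nonneg
    simp only [Prod.mk.injEq, true_and, ind]
    split_ifs <;> linarith
  -- the pairs that share layers are so few that they contribute `3 ρ` to the mean
  have sumsecond : ∀ β, ∑ β', μ.κ.mean (fun ω => ℓ β ω * ℓ β' ω) ≤ n * (1 + 3 * ρ) := by
    intro β
    refine (Finset.sum_le_sum fun β' _ => second β β').trans ?_
    simp only [Fintype.sum_prod_type, Finset.sum_add_distrib, ← Finset.mul_sum, ← Finset.sum_mul,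
      sum_ind_eq, Finset.sum_const, Finset.card_univ, nsmul_eq_mul, mul_add]
    have ha : (0 : ℝ) < Fintype.card Ba := by exact_mod_cast Fintype.card_pos
    have hb : (0 : ℝ) < Fintype.card Bb := by exact_mod_cast Fintype.card_pos
    have hd : (0 : ℝ) < Fintype.card Bd := by exact_mod_cast Fintype.card_pos
    have e1 := mul_le_mul_of_nonneg_left h.bin₁ (mul_pos hb hd).le
    have e2 := mul_le_mul_of_nonneg_left h.bin₂ hd.le
    have e3 := h.bin₃
    rw [hn]
    simp only [Fintype.card_prod, Nat.cast_mul]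
    nlinarith [e1, e2, e3]
  -- `(1 - S)² = 1 - 2 S + S²`, with first moments at least `1 - η` and second moments `sumsecond`
  have expand : ∀ ω, (1 - binSum τ i l wa wb wd ω) ^ 2 =
      1 + (-(2 * n⁻¹)) * ∑ β, ℓ β ω + (n⁻¹ * n⁻¹) * ∑ β, ∑ β', ℓ β ω * ℓ β' ω := by
    intro ω
    rw [← Finset.sum_mul_sum]
    simp only [binSum, hℓ, hn]
    ring
  simp only [expand, LayerLaw.mean_add, LayerLaw.mean_mul_left, LayerLaw.mean_sum,
    LayerLaw.mean_const]
  have e1 : n * (1 - η) ≤ ∑ β, μ.κ.mean (ℓ β) := by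
    have := Finset.card_nsmul_le_sum Finset.univ (fun β => μ.κ.mean (ℓ β)) (1 - η)
      fun β _ => first β
    simpa [hn] using this
  have e2 : ∑ β, ∑ β', μ.κ.mean (fun ω => ℓ β ω * ℓ β' ω) ≤ n * (n * (1 + 3 * ρ)) := by
    have := Finset.sum_le_card_nsmul Finset.univ
      (fun β => ∑ β', μ.κ.mean (fun ω => ℓ β ω * ℓ β' ω)) _ fun β _ => sumsecond β
    simpa [hn] using this
  have i1 : n⁻¹ * n = 1 := inv_mul_cancel₀ hn0.ne'
  have f1 := mul_le_mul_of_nonneg_left e1 (inv_nonneg.2 hn0.le)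
  have f2 := mul_le_mul_of_nonneg_left e2 (mul_nonneg (inv_nonneg.2 hn0.le) (inv_nonneg.2 hn0.le))
  have g1 : n⁻¹ * (n * (1 - η)) = 1 - η := by rw [← mul_assoc, i1, one_mul]
  have g2 : n⁻¹ * n⁻¹ * (n * (n * (1 + 3 * ρ))) = 1 + 3 * ρ := by
    calc _ = (n⁻¹ * n) * (n⁻¹ * n) * (1 + 3 * ρ) := by ring
      _ = _ := by rw [i1]; ring
  rw [g1] at f1
  rw [g2] at f2
  linarith [h.ρ_nonneg]

end Model

/-! ### Typicality decoding -/

theorem inv_card_mul_card {α : Type*} [Fintype α] (a : α) :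
    (Fintype.card α : ℝ) * (Fintype.card α : ℝ)⁻¹ = 1 :=
  have : Nonempty α := ⟨a⟩
  mul_inv_cancel₀ (by exact_mod_cast Fintype.card_ne_zero)

/-- Weights of total `3 r` for the ways in which a triple can differ from `(i, j, k)`. -/
theorem sum_triple_weights {I J K : Type*} [Fintype I] [Fintype J] [Fintype K] (i : I) (j : J)
    (k : K) (r : ℝ) :
    ∑ t : I × J × K, (r * ((Fintype.card I : ℝ)⁻¹ * ((Fintype.card J : ℝ)⁻¹ *
      (Fintype.card K : ℝ)⁻¹)) + ind (i = t.1) * (r * ((Fintype.card J : ℝ)⁻¹ *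
      (Fintype.card K : ℝ)⁻¹)) + ind (i = t.1) * (ind (j = t.2.1) * (r * (Fintype.card K : ℝ)⁻¹)))
    = 3 * r := by
  simp only [Fintype.sum_prod_type, Finset.sum_add_distrib, ← Finset.mul_sum, ← Finset.sum_mul,
    sum_ind_eq, Finset.sum_const, Finset.card_univ, nsmul_eq_mul, Fintype.card_prod, Nat.cast_mul]
  have h1 := inv_card_mul_card i
  have h2 := inv_card_mul_card j
  have h3 := inv_card_mul_card k
  generalize (Fintype.card I : ℝ) = x at *
  generalize (Fintype.card J : ℝ) = y at *
  generalize (Fintype.card K : ℝ) = z at *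
  linear_combination r * (y * y⁻¹) * (z * z⁻¹) * h1 + 2 * r * (z * z⁻¹) * h2 + 3 * r * h3

/-- Weights of total `5 r` for the ways in which a quadruple can differ from `(i, l, j, m)`. -/
theorem sum_quadruple_weights {I L J M : Type*} [Fintype I] [Fintype L] [Fintype J] [Fintype M]
    (i : I) (l : L) (j : J) (m : M) (r : ℝ) :
    ∑ t : I × L × J × M, (r * ((Fintype.card I : ℝ)⁻¹ * ((Fintype.card L : ℝ)⁻¹ *
        ((Fintype.card J : ℝ)⁻¹ * (Fintype.card M : ℝ)⁻¹))) +
      ind (i = t.1) * (r * ((Fintype.card L : ℝ)⁻¹ * ((Fintype.card J : ℝ)⁻¹ *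
        (Fintype.card M : ℝ)⁻¹)) +
        ind (j = t.2.2.1) * (r * ((Fintype.card L : ℝ)⁻¹ * (Fintype.card M : ℝ)⁻¹)) +
        ind (l = t.2.1) * (r * ((Fintype.card J : ℝ)⁻¹ * (Fintype.card M : ℝ)⁻¹) +
        ind (j = t.2.2.1) * (r * (Fintype.card M : ℝ)⁻¹))))
    = 5 * r := by
  simp only [Fintype.sum_prod_type, Finset.sum_add_distrib, ← Finset.mul_sum, ← Finset.sum_mul,
    sum_ind_eq, Finset.sum_const, Finset.card_univ, nsmul_eq_mul, mul_add, Fintype.card_prod,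
        Nat.cast_mul]
  have h1 := inv_card_mul_card i
  have h2 := inv_card_mul_card j
  have h3 := inv_card_mul_card m
  have h4 := inv_card_mul_card l
  generalize (Fintype.card I : ℝ) = x at *
  generalize (Fintype.card J : ℝ) = y at *
  generalize (Fintype.card M : ℝ) = z at *
  generalize (Fintype.card L : ℝ) = w at *
  linear_combination r * (w * w⁻¹) * (y * y⁻¹) * (z * z⁻¹) * h1 +
    (2 * r * (y * y⁻¹) * (z * z⁻¹) + r * (z * z⁻¹)) * h4 + 3 * r * (z * z⁻¹) * h2 + 5 * r * h3

theorem sum_mul_sum_swap {α β γ τ : Type*} [Fintype α] [Fintype β] [Fintype γ] [Fintype τ]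
    (f : α → β → γ → ℝ) (c : τ → ℝ) (g : τ → β → γ → ℝ) :
    ∑ x, ∑ y, ∑ z, f x y z * ∑ t, c t * g t y z = ∑ t, c t * ∑ x, ∑ y, ∑ z, f x y z * g t y z := by
  simp only [Finset.mul_sum]
  rw [Finset.sum_comm (s := (Finset.univ : Finset τ))]
  refine Finset.sum_congr rfl fun x _ => ?_
  rw [Finset.sum_comm (s := (Finset.univ : Finset τ))]
  refine Finset.sum_congr rfl fun y _ => ?_
  rw [Finset.sum_comm (s := (Finset.univ : Finset τ))]
  exact Finset.sum_congr rfl fun z _ => Finset.sum_congr rfl fun t _ => by ring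

theorem le_mul_inv_card {α : Type*} [Fintype α] (x : α) {a r : ℝ}
    (h : a * Fintype.card α ≤ r) : a ≤ r * (Fintype.card α : ℝ)⁻¹ := by
  have : Nonempty α := ⟨x⟩
  exact (le_mul_inv_iff₀ (by exact_mod_cast Fintype.card_pos)).2 h

namespace Model

variable {A C B D Z X Y₁ Y₂ : Type*} [Fintype A] [Fintype C] [Fintype B] [Fintype D]
    [Fintype Z] [Fintype X] [Fintype Y₁] [Fintype Y₂] {μ : Model A C B D Z X Y₁ Y₂}
  {τ : μ.TypicalSets}
  {I L Wa Ba Wb Bb Wd Bd : Type*}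

/-- The typicality decoder of receiver 1. -/
def decode₁ (τ : μ.TypicalSets) (v₀ : Wa × Wb)
    (ω : Codebook I L (Wa × Ba) (Wb × Bb) (Wd × Bd) C X A B D) (y : Y₁) : Wa × Wb :=
  pick (fun t : I × (Wa × Ba) × (Wb × Bb) =>
    τ.T₁ (ω.c t.1) (ω.a (t.1, t.2.1)) (ω.b (t.1, t.2.1, t.2.2)) y)
    (fun t => (t.2.1.1, t.2.2.1)) v₀

/-- The typicality decoder of receiver 2. -/
def decode₂ (τ : μ.TypicalSets) (v₀ : I × L × Wd)
    (ω : Codebook I L (Wa × Ba) (Wb × Bb) (Wd × Bd) C X A B D) (y : Y₂) : I × L × Wd :=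
  pick (fun t : I × L × (Wa × Ba) × (Wd × Bd) =>
    τ.T₂ (ω.c t.1) (ω.x (t.1, t.2.1)) (ω.a (t.1, t.2.2.1)) (ω.d (t.1, t.2.1, t.2.2.1, t.2.2.2)) y)
    (fun t => (t.1, t.2.1, t.2.2.2.1)) v₀

/-- The error probability of given messages if the cognitive transmitter sends `z`. -/
def err (τ : μ.TypicalSets) (v₁ : Wa × Wb) (v₂ : I × L × Wd)
    (ω : Codebook I L (Wa × Ba) (Wb × Bb) (Wd × Bd) C X A B D) (w₁ : Wa × Wb) (w₂ : I × L × Wd)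
    (z : Z) : ℝ :=
  ∑ y₁, ∑ y₂, μ.W z (ω.x (w₂.1, w₂.2.1)) y₁ y₂ *
    ind (¬ (decode₁ τ v₁ ω y₁ = w₁ ∧ decode₂ τ v₂ ω y₂ = w₂))

theorem err_le_one (v₁ : Wa × Wb) (v₂ : I × L × Wd)
    (ω : Codebook I L (Wa × Ba) (Wb × Bb) (Wd × Bd) C X A B D) (w₁ : Wa × Wb) (w₂ : I × L × Wd)
    (z : Z) : err τ v₁ v₂ ω w₁ w₂ z ≤ 1 := by
  rw [← μ.sum_W z (ω.x (w₂.1, w₂.2.1))]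
  exact Finset.sum_le_sum fun _ _ => Finset.sum_le_sum fun _ _ =>
    mul_le_of_le_one_right (μ.W_nonneg _ _ _ _) (ind_le_one _)

variable [Fintype I] [Fintype L] [Fintype Wa] [Fintype Ba] [Fintype Wb]
  [Fintype Bb] [Fintype Wd] [Fintype Bd]
  [DecidableEq I] [DecidableEq L] [DecidableEq Wa] [DecidableEq Ba] [DecidableEq Wb]
  [DecidableEq Bb] [DecidableEq Wd] [DecidableEq Bd] {ρ η : ℝ}

/-- Under the tilted law, where the codewords of the true position are jointly distributed as the
single-letter symbols, the error probability is small. -/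
theorem mean_lik_mul_err_le (h : τ.Fits I L Wa Ba Wb Bb Wd Bd ρ η) (v₁ : Wa × Wb)
    (v₂ : I × L × Wd) (i : I) (l : L) (wa : Wa) (wb : Wb) (wd : Wd) (ba : Ba) (bb : Bb) (bd : Bd) :
    μ.κ.mean (fun ω : Codebook I L (Wa × Ba) (Wb × Bb) (Wd × Bd) C X A B D => ∑ z,
      μ.lik ⟨ω.a (i, wa, ba), ω.c i, ω.b (i, (wa, ba), wb, bb), ω.d (i, l, (wa, ba), wd, bd), z,
        ω.x (i, l)⟩ * err τ v₁ v₂ ω (wa, wb) (i, l, wd) z) ≤ 2 * η + 8 * ρ := by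
  set G₁ : I × (Wa × Ba) × (Wb × Bb) → Codebook I L (Wa × Ba) (Wb × Bb) (Wd × Bd) C X A B D →
    Y₁ → Prop := fun t ω y => τ.T₁ (ω.c t.1) (ω.a (t.1, t.2.1)) (ω.b (t.1, t.2.1, t.2.2)) y with hG₁
  set G₂ : I × L × (Wa × Ba) × (Wd × Bd) → Codebook I L (Wa × Ba) (Wb × Bb) (Wd × Bd) C X A B D →
    Y₂ → Prop := fun t ω y => τ.T₂ (ω.c t.1) (ω.x (t.1, t.2.1)) (ω.a (t.1, t.2.2.1))
      (ω.d (t.1, t.2.1, t.2.2.1, t.2.2.2)) y with hG₂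
  set t₁ : I × (Wa × Ba) × (Wb × Bb) := (i, (wa, ba), wb, bb) with ht₁
  set t₂ : I × L × (Wa × Ba) × (Wd × Bd) := (i, l, (wa, ba), wd, bd) with ht₂
  set m₁ : I × (Wa × Ba) × (Wb × Bb) → Wa × Wb := fun t => (t.2.1.1, t.2.2.1) with hm₁
  set m₂ : I × L × (Wa × Ba) × (Wd × Bd) → I × L × Wd := fun t => (t.1, t.2.1, t.2.2.2.1) with hm₂
  set ℓ : Codebook I L (Wa × Ba) (Wb × Bb) (Wd × Bd) C X A B D → Z → ℝ := fun ω z =>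
    μ.lik ⟨ω.a (i, wa, ba), ω.c i, ω.b (i, (wa, ba), wb, bb), ω.d (i, l, (wa, ba), wd, bd), z,
        ω.x (i, l)⟩ with hℓ
  have hℓ0 : ∀ ω z, 0 ≤ ℓ ω z := fun ω z => μ.lik_nonneg _
  -- The error event is covered by the atypicality of the true codewords and by the typicality of
  -- codewords of wrong messages.
  have cover : ∀ ω y₁ y₂, ind (¬ (decode₁ τ v₁ ω y₁ = (wa, wb) ∧ decode₂ τ v₂ ω y₂ = (i, l, wd))) ≤
      (ind (¬ G₁ t₁ ω y₁) + ∑ t, ind (m₁ t ≠ (wa, wb)) * ind (G₁ t ω y₁)) +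
      (ind (¬ G₂ t₂ ω y₂) + ∑ t, ind (m₂ t ≠ (i, l, wd)) * ind (G₂ t ω y₂)) := by
    intro ω y₁ y₂
    have c1 := ind_pick_ne_le (fun t => G₁ t ω y₁) m₁ v₁ t₁
    have c2 := ind_pick_ne_le (fun t => G₂ t ω y₂) m₂ v₂ t₂
    refine le_trans ?_ (add_le_add c1 c2)
    change ind (¬ (decode₁ τ v₁ ω y₁ = (wa, wb) ∧ decode₂ τ v₂ ω y₂ = (i, l, wd))) ≤
      ind (decode₁ τ v₁ ω y₁ ≠ (wa, wb)) + ind (decode₂ τ v₂ ω y₂ ≠ (i, l, wd))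
    by_cases e1 : decode₁ τ v₁ ω y₁ = (wa, wb) <;> by_cases e2 : decode₂ τ v₂ ω y₂ = (i, l, wd) <;>
      simp [ind, e1, e2]
  have true₁ : μ.κ.mean (fun ω => ∑ z, ∑ y₁, ∑ y₂, ℓ ω z * μ.W z (ω.x (i, l)) y₁ y₂ *
      ind (¬ G₁ t₁ ω y₁)) ≤ η := by
    refine le_trans (le_of_eq ?_) h.mass₁
    have := μ.mean_lik i l (wa, ba) (wb, bb) (wd, bd) i l (wa, ba) (wb, bb) (wd, bd)
      fun s c' _ a' b' _ => ind (¬ τ.T₁ c' a' b' s.y₁)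
    simpa only [second_of_same] using this
  have true₂ : μ.κ.mean (fun ω => ∑ z, ∑ y₁, ∑ y₂, ℓ ω z * μ.W z (ω.x (i, l)) y₁ y₂ *
      ind (¬ G₂ t₂ ω y₂)) ≤ η := by
    refine le_trans (le_of_eq ?_) h.mass₂
    have := μ.mean_lik i l (wa, ba) (wb, bb) (wd, bd) i l (wa, ba) (wb, bb) (wd, bd)
      fun s c' x' a' _ d' => ind (¬ τ.T₂ c' x' a' d' s.y₂)
    simpa only [second_of_same] using this
  have wrong₁ : ∑ t, ind (m₁ t ≠ (wa, wb)) * μ.κ.mean (fun ω => ∑ z, ∑ y₁, ∑ y₂,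
      ℓ ω z * μ.W z (ω.x (i, l)) y₁ y₂ * ind (G₁ t ω y₁)) ≤ 3 * ρ := by
    -- weights of total `3 ρ`: one family for each pattern of shared layers
    rw [← sum_triple_weights i (wa, ba) (wb, bb) ρ]
    refine Finset.sum_le_sum fun t _ => ?_
    obtain ⟨i', ⟨wa', ba'⟩, ⟨wb', bb'⟩⟩ := t
    have hI := inv_card_mul_card i
    have hJ := inv_card_mul_card (wa, ba)
    have hK := inv_card_mul_card (wb, bb)
    have w1 : 0 ≤ ρ * ((Fintype.card I : ℝ)⁻¹ * ((Fintype.card (Wa × Ba) : ℝ)⁻¹ *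
      (Fintype.card (Wb × Bb) : ℝ)⁻¹)) := mul_nonneg h.ρ_nonneg (by positivity)
    have w2 : 0 ≤ ρ * ((Fintype.card (Wa × Ba) : ℝ)⁻¹ * (Fintype.card (Wb × Bb) : ℝ)⁻¹) :=
      mul_nonneg h.ρ_nonneg (by positivity)
    have w3 : 0 ≤ ρ * (Fintype.card (Wb × Bb) : ℝ)⁻¹ := mul_nonneg h.ρ_nonneg (by positivity)
    by_cases hw : m₁ (i', (wa', ba'), wb', bb') ≠ (wa, wb)
    swap
    · rw [ind_of_false hw, zero_mul]
      exact add_nonneg (add_nonneg w1 (mul_nonneg (ind_nonneg _) w2))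
        (mul_nonneg (ind_nonneg _) (mul_nonneg (ind_nonneg _) w3))
    rw [ind_of_true hw, one_mul]
    -- a wrong message exists, so the bounds of `Fits` are available
    have hnt : Nontrivial (Wa × Wb) := ⟨_, _, hw⟩
    have hne : (i', (wa', ba'), wb', bb') ≠ (i, (wa, ba), wb, bb) := by
      rintro e
      simp only [Prod.mk.injEq] at e
      exact hw (by simp [hm₁, e])
    have pk := μ.packing₁ τ.α₁_pos τ.α₂_pos τ.α₃_pos τ.a₁ τ.a₂ τ.a₃ i l (wa, ba) (wb, bb) (wd, bd)
      i' (wa', ba') (wb', bb') hne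
    refine le_trans pk ?_
    by_cases hi : i' = i
    · by_cases hj : (wa', ba') = (wa, ba)
      · have hb : wb' ≠ wb := by
          rintro e
          simp only [Prod.mk.injEq] at hj
          exact hw (by simp [hm₁, e, hj])
        have hnt : Nontrivial Wb := ⟨_, _, hb⟩
        have := h.α₃_le hnt
        rw [ind_of_true hi.symm, ind_of_true hj.symm, if_neg (not_not.2 hi), if_neg (not_not.2 hj)]
        have e3 : τ.α₃⁻¹ ≤ ρ * (Fintype.card (Wb × Bb) : ℝ)⁻¹ := by
          exact le_mul_inv_card (wb, bb) this
        linarith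
      · have := h.α₂_le hnt
        rw [ind_of_true hi.symm, ind_of_false (Ne.symm hj), if_neg (not_not.2 hi), if_pos hj]
        have e2 := le_mul_inv_card ((wa, ba), (wb, bb)) (a := τ.α₂⁻¹) (r := ρ)
          (by simpa only [Fintype.card_prod, Nat.cast_mul] using this)
        rw [Fintype.card_prod, Nat.cast_mul, mul_inv] at e2
        linarith
    · have := h.α₁_le hnt
      rw [ind_of_false (Ne.symm hi), if_pos hi]
      have e1 := le_mul_inv_card (i, (wa, ba), (wb, bb)) (a := τ.α₁⁻¹) (r := ρ)
        (by simpa only [Fintype.card_prod, Nat.cast_mul] using this)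
      rw [Fintype.card_prod, Fintype.card_prod (Wa × Ba), Nat.cast_mul, Nat.cast_mul, mul_inv,
        mul_inv] at e1
      linarith
  have wrong₂ : ∑ t, ind (m₂ t ≠ (i, l, wd)) * μ.κ.mean (fun ω => ∑ z, ∑ y₁, ∑ y₂,
      ℓ ω z * μ.W z (ω.x (i, l)) y₁ y₂ * ind (G₂ t ω y₂)) ≤ 5 * ρ := by
    rw [← sum_quadruple_weights i l (wa, ba) (wd, bd) ρ]
    refine Finset.sum_le_sum fun t _ => ?_
    obtain ⟨i', l', ⟨wa', ba'⟩, ⟨wd', bd'⟩⟩ := t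
    have w0 : 0 ≤ ρ := h.ρ_nonneg
    have iL := ind_nonneg (l = l')
    have iI := ind_nonneg (i = i')
    have iJ := ind_nonneg ((wa, ba) = (wa', ba'))
    by_cases hw : m₂ (i', l', (wa', ba'), wd', bd') ≠ (i, l, wd)
    swap
    · rw [ind_of_false hw, zero_mul]
      positivity
    rw [ind_of_true hw, one_mul]
    have hne : (i', l', (wa', ba'), wd', bd') ≠ (i, l, (wa, ba), wd, bd) := by
      rintro e
      simp only [Prod.mk.injEq] at e
      exact hw (by simp [hm₂, e])
    have pk := μ.packing₂ τ.β₁_pos τ.β₂_pos τ.β₃_pos τ.β₄_pos τ.β₅_pos τ.b₁ τ.b₂ τ.b₃ τ.b₄ τ.b₅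
      i l (wa, ba) (wb, bb) (wd, bd) i' l' (wa', ba') (wd', bd') hne
    refine le_trans pk ?_
    by_cases hi : i' = i
    · rw [ind_of_true hi.symm, if_neg (not_not.2 hi), one_mul]
      have p1 : 0 ≤ ρ * ((Fintype.card I : ℝ)⁻¹ * ((Fintype.card L : ℝ)⁻¹ *
        ((Fintype.card (Wa × Ba) : ℝ)⁻¹ * (Fintype.card (Wd × Bd) : ℝ)⁻¹))) := by positivity
      have p2 : 0 ≤ ρ * ((Fintype.card L : ℝ)⁻¹ * ((Fintype.card (Wa × Ba) : ℝ)⁻¹ *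
        (Fintype.card (Wd × Bd) : ℝ)⁻¹)) := by positivity
      have p3 : 0 ≤ ρ * ((Fintype.card L : ℝ)⁻¹ * (Fintype.card (Wd × Bd) : ℝ)⁻¹) := by positivity
      have p4 : 0 ≤ ρ * ((Fintype.card (Wa × Ba) : ℝ)⁻¹ * (Fintype.card (Wd × Bd) : ℝ)⁻¹) := by
        positivity
      have p5 : 0 ≤ ρ * (Fintype.card (Wd × Bd) : ℝ)⁻¹ := by positivity
      by_cases hl : l' = l
      · have hd : wd' ≠ wd := by
          rintro e
          exact hw (by simp [hm₂, e, hi, hl])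
        have hnt : Nontrivial Wd := ⟨_, _, hd⟩
        rw [ind_of_true hl.symm, if_neg (not_not.2 hl), one_mul]
        by_cases hj : (wa', ba') = (wa, ba)
        · rw [ind_of_true hj.symm, if_neg (not_not.2 hj)]
          have e5 := le_mul_inv_card (wd, bd) (h.β₅_le hnt)
          linarith
        · rw [ind_of_false (Ne.symm hj), if_pos hj]
          have e4 := le_mul_inv_card ((wa, ba), (wd, bd)) (a := τ.β₄⁻¹) (r := ρ)
            (by simpa only [Fintype.card_prod, Nat.cast_mul] using h.β₄_le hnt)
          rw [Fintype.card_prod, Nat.cast_mul, mul_inv] at e4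
          linarith
      · have hnt : Nontrivial L := ⟨_, _, hl⟩
        rw [ind_of_false (Ne.symm hl), if_pos hl]
        by_cases hj : (wa', ba') = (wa, ba)
        · rw [ind_of_true hj.symm, if_neg (not_not.2 hj)]
          have e3 := le_mul_inv_card (l, (wd, bd)) (a := τ.β₃⁻¹) (r := ρ)
            (by simpa only [Fintype.card_prod, Nat.cast_mul] using h.β₃_le hnt)
          rw [Fintype.card_prod, Nat.cast_mul, mul_inv] at e3
          linarith
        · rw [ind_of_false (Ne.symm hj), if_pos hj]
          have e2 := le_mul_inv_card (l, (wa, ba), (wd, bd)) (a := τ.β₂⁻¹) (r := ρ)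
            (by simpa only [Fintype.card_prod, Nat.cast_mul] using h.β₂_le hnt)
          rw [Fintype.card_prod, Fintype.card_prod (Wa × Ba), Nat.cast_mul, Nat.cast_mul, mul_inv,
            mul_inv] at e2
          linarith
    · have hnt : Nontrivial I := ⟨_, _, hi⟩
      rw [ind_of_false (Ne.symm hi), if_pos hi]
      have e1 := le_mul_inv_card (i, l, (wa, ba), (wd, bd)) (a := τ.β₁⁻¹) (r := ρ)
        (by simpa only [Fintype.card_prod, Nat.cast_mul] using h.β₁_le hnt)
      rw [Fintype.card_prod, Fintype.card_prod L, Fintype.card_prod (Wa × Ba), Nat.cast_mul,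
        Nat.cast_mul, Nat.cast_mul, mul_inv, mul_inv, mul_inv] at e1
      linarith
  calc _ ≤ μ.κ.mean (fun ω => ∑ z, ∑ y₁, ∑ y₂, ℓ ω z * μ.W z (ω.x (i, l)) y₁ y₂ *
        ((ind (¬ G₁ t₁ ω y₁) + ∑ t, ind (m₁ t ≠ (wa, wb)) * ind (G₁ t ω y₁)) +
        (ind (¬ G₂ t₂ ω y₂) + ∑ t, ind (m₂ t ≠ (i, l, wd)) * ind (G₂ t ω y₂)))) := by
        refine μ.κ.mean_mono fun ω => Finset.sum_le_sum fun z _ => ?_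
        simp only [err, Finset.mul_sum, ← mul_assoc]
        refine Finset.sum_le_sum fun y₁ _ => Finset.sum_le_sum fun y₂ _ => ?_
        exact mul_le_mul_of_nonneg_left (cover ω y₁ y₂) (mul_nonneg (hℓ0 ω z) (μ.W_nonneg _ _ _ _))
    _ = μ.κ.mean (fun ω => ∑ z, ∑ y₁, ∑ y₂, ℓ ω z * μ.W z (ω.x (i, l)) y₁ y₂ *
          ind (¬ G₁ t₁ ω y₁)) +
        ∑ t, ind (m₁ t ≠ (wa, wb)) * μ.κ.mean (fun ω => ∑ z, ∑ y₁, ∑ y₂,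
          ℓ ω z * μ.W z (ω.x (i, l)) y₁ y₂ * ind (G₁ t ω y₁)) +
        (μ.κ.mean (fun ω => ∑ z, ∑ y₁, ∑ y₂, ℓ ω z * μ.W z (ω.x (i, l)) y₁ y₂ *
          ind (¬ G₂ t₂ ω y₂)) +
        ∑ t, ind (m₂ t ≠ (i, l, wd)) * μ.κ.mean (fun ω => ∑ z, ∑ y₁, ∑ y₂,
          ℓ ω z * μ.W z (ω.x (i, l)) y₁ y₂ * ind (G₂ t ω y₂))) := by
        simp only [← LayerLaw.mean_mul_left, ← LayerLaw.mean_sum]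
        rw [← LayerLaw.mean_add, ← LayerLaw.mean_add, ← LayerLaw.mean_add]
        congr 1
        funext ω
        simp only [← sum_mul_sum_swap, ← Finset.sum_add_distrib, ← mul_add]
    _ ≤ 2 * η + 8 * ρ := by linarith

end Model

/-! ### Existence of a code -/

namespace Model

variable {A C B D Z X Y₁ Y₂ : Type*} [Fintype A] [Fintype C] [Fintype B] [Fintype D]
    [Fintype Z] [Fintype X] [Fintype Y₁] [Fintype Y₂] {μ : Model A C B D Z X Y₁ Y₂}
  {τ : μ.TypicalSets}
  {I L Wa Ba Wb Bb Wd Bd : Type*} [Fintype I] [Fintype L] [Fintype Wa] [Fintype Ba] [Fintype Wb]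
  [Fintype Bb] [Fintype Wd] [Fintype Bd]
  [DecidableEq I] [DecidableEq L] [DecidableEq Wa] [DecidableEq Ba] [DecidableEq Wb]
  [DecidableEq Bb] [DecidableEq Wd] [DecidableEq Bd] {ρ η : ℝ}

theorem setLik_le_sum_lik (T : C → X → A → B → D → Prop) (c : C) (x : X) (a : A) (b : B) (d : D) :
    μ.setLik T c x a b d ≤ ∑ z, μ.lik ⟨a, c, b, d, z, x⟩ := by
  have : ∑ z, μ.lik ⟨a, c, b, d, z, x⟩ = μ.pv c x a b d / μ.κ.word c x a b d := by
    rw [← μ.sum_p_eq_pv, Finset.sum_div]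
    rfl
  rw [this]
  exact mul_le_of_le_one_left
    (div_nonneg (μ.pv_nonneg _ _ _ _ _) (μ.κ.word_nonneg _ _ _ _ _)) (ind_le_one _)

/-- The best channel input for given messages does at least as well as an input drawn together with
a bin position in proportion to the likelihood ratio. Where the normalizing sum is at least `1/2`,
this costs a factor `2`; elsewhere the mutual covering lemma applies. -/
theorem mean_le_of_le_err [Nonempty Ba] [Nonempty Bb] [Nonempty Bd]
    (h : τ.Fits I L Wa Ba Wb Bb Wd Bd ρ η) (v₁ : Wa × Wb) (v₂ : I × L × Wd) (i : I) (l : L)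
    (wa : Wa) (wb : Wb) (wd : Wd)
    {e : Codebook I L (Wa × Ba) (Wb × Bb) (Wd × Bd) C X A B D → ℝ} (he0 : ∀ ω, 0 ≤ e ω)
    (he1 : ∀ ω, e ω ≤ 1) (he : ∀ ω z, e ω ≤ err τ v₁ v₂ ω (wa, wb) (i, l, wd) z) :
    μ.κ.mean e ≤ 12 * η + 32 * ρ := by
  set n : ℝ := ((Fintype.card (Ba × Bb × Bd) : ℕ) : ℝ) with hn
  have hn0 : 0 < n := by rw [hn]; exact_mod_cast Fintype.card_pos
  set g : Ba × Bb × Bd → Codebook I L (Wa × Ba) (Wb × Bb) (Wd × Bd) C X A B D → ℝ := fun β ω =>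
    ∑ z, μ.lik ⟨ω.a (i, wa, β.1), ω.c i, ω.b (i, (wa, β.1), wb, β.2.1),
      ω.d (i, l, (wa, β.1), wd, β.2.2), z, ω.x (i, l)⟩ *
      err τ v₁ v₂ ω (wa, wb) (i, l, wd) z with hg
  have hmul : ∀ ω, e ω * binSum τ i l wa wb wd ω ≤ n⁻¹ * ∑ β, g β ω := by
    intro ω
    rw [binSum, ← hn, mul_left_comm]
    refine mul_le_mul_of_nonneg_left ?_ (inv_nonneg.2 hn0.le)
    rw [Finset.mul_sum]
    refine Finset.sum_le_sum fun β _ => ?_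
    refine (mul_le_mul_of_nonneg_left (setLik_le_sum_lik _ _ _ _ _ _) (he0 ω)).trans ?_
    rw [Finset.mul_sum]
    refine Finset.sum_le_sum fun z _ => ?_
    rw [mul_comm]
    exact mul_le_mul_of_nonneg_left (he ω z) (μ.lik_nonneg _)
  have hX : ∀ ω, 0 ≤ n⁻¹ * ∑ β, g β ω := fun ω =>
    mul_nonneg (inv_nonneg.2 hn0.le) (Finset.sum_nonneg fun β _ => Finset.sum_nonneg fun z _ =>
      mul_nonneg (μ.lik_nonneg _) ((he0 ω).trans (he ω z)))
  -- With `S` the normalizing sum and `x` the weighted error: if `S ≥ 1/2` then `e ≤ 2 e S ≤ 2 x`,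
  -- and if `S ≤ 1/2` then `e ≤ 1 ≤ 4 (1 - S)²`.
  have point : ∀ ω, e ω ≤ 2 * (n⁻¹ * ∑ β, g β ω) + 4 * (1 - binSum τ i l wa wb wd ω) ^ 2 := by
    intro ω
    have h1 := hmul ω
    have h2 := hX ω
    generalize n⁻¹ * ∑ β, g β ω = x at *
    generalize binSum τ i l wa wb wd ω = s at *
    rcases le_total s (1 / 2) with hs | hs
    · nlinarith [he1 ω, sq_nonneg (1 - s)]
    · nlinarith [he0 ω, sq_nonneg (1 - s)]
  have gmean : ∀ β, μ.κ.mean (g β) ≤ 2 * η + 8 * ρ := fun β =>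
    mean_lik_mul_err_le h v₁ v₂ i l wa wb wd β.1 β.2.1 β.2.2
  have sq := mean_binSum_sub_one_sq_le h i l wa wb wd
  have hsum : n⁻¹ * ∑ β, μ.κ.mean (g β) ≤ 2 * η + 8 * ρ := by
    have := Finset.sum_le_card_nsmul Finset.univ (fun β => μ.κ.mean (g β)) _ fun β _ => gmean β
    rw [nsmul_eq_mul, Finset.card_univ, ← hn] at this
    rw [inv_mul_le_iff₀ hn0]
    exact this
  calc μ.κ.mean e ≤ μ.κ.mean (fun ω =>
        2 * (n⁻¹ * ∑ β, g β ω) + 4 * (1 - binSum τ i l wa wb wd ω) ^ 2) := μ.κ.mean_mono point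
    _ = 2 * (n⁻¹ * ∑ β, μ.κ.mean (g β)) +
        4 * μ.κ.mean (fun ω : Codebook I L (Wa × Ba) (Wb × Bb) (Wd × Bd) C X A B D =>
          (1 - binSum τ i l wa wb wd ω) ^ 2) := by
      simp only [LayerLaw.mean_add, LayerLaw.mean_mul_left, LayerLaw.mean_sum]
    _ ≤ 12 * η + 32 * ρ := by linarith

/-- The coding theorem for one use of the channel. The message sets `V₁` and `V₂` of the code are
embedded into the products of the partial messages. -/
theorem exists_code [Nonempty Z] [Nonempty Ba] [Nonempty Bb] [Nonempty Bd]
    (h : τ.Fits I L Wa Ba Wb Bb Wd Bd ρ η) {V₁ V₂ : Type*} [Fintype V₁] [Fintype V₂]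
    [Nonempty V₁] [Nonempty V₂] [DecidableEq V₁] [DecidableEq V₂] {ι₁ : V₁ → Wa × Wb}
    {ι₂ : V₂ → I × L × Wd} (hι₁ : Function.Injective ι₁) (hι₂ : Function.Injective ι₂) :
    ∃ (enc₁ : V₁ → V₂ → Z) (enc₂ : V₂ → X) (dec₁ : Y₁ → V₁) (dec₂ : Y₂ → V₂),
      ∑ w₁, ∑ w₂, ∑ y₁, ∑ y₂, (if dec₁ y₁ = w₁ ∧ dec₂ y₂ = w₂ then 0
        else μ.W (enc₁ w₁ w₂) (enc₂ w₂) y₁ y₂) ≤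
      (12 * η + 32 * ρ) * (Fintype.card V₁ * Fintype.card V₂) := by
  let v₁ : Wa × Wb := ι₁ (Classical.arbitrary V₁)
  let v₂ : I × L × Wd := ι₂ (Classical.arbitrary V₂)
  -- the cognitive transmitter knows both messages and sends the input of least error probability
  choose enc henc using fun (ω : Codebook I L (Wa × Ba) (Wb × Bb) (Wd × Bd) C X A B D) (w₁ : V₁)
    (w₂ : V₂) => Finite.exists_min fun z => err τ v₁ v₂ ω (ι₁ w₁) (ι₂ w₂) z
  have err_nonneg : ∀ (ω : Codebook I L (Wa × Ba) (Wb × Bb) (Wd × Bd) C X A B D) w₁ w₂ z, 0 ≤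
      err τ v₁ v₂ ω w₁ w₂ z := fun ω w₁ w₂ z =>
    Finset.sum_nonneg fun _ _ => Finset.sum_nonneg fun _ _ =>
      mul_nonneg (μ.W_nonneg _ _ _ _) (ind_nonneg _)
  have hmean : ∀ w₁ w₂, μ.κ.mean (fun ω => err τ v₁ v₂ ω (ι₁ w₁) (ι₂ w₂) (enc ω w₁ w₂)) ≤
      12 * η + 32 * ρ := fun w₁ w₂ =>
    mean_le_of_le_err h v₁ v₂ (ι₂ w₂).1 (ι₂ w₂).2.1 (ι₁ w₁).1 (ι₁ w₁).2 (ι₂ w₂).2.2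
      (fun ω => err_nonneg _ _ _ _) (fun ω => err_le_one _ _ _ _ _ _) fun ω z => henc ω w₁ w₂ z
  have htotal : μ.κ.mean (fun ω : Codebook I L (Wa × Ba) (Wb × Bb) (Wd × Bd) C X A B D => ∑ w₁,
      ∑ w₂, err τ v₁ v₂ ω (ι₁ w₁) (ι₂ w₂) (enc ω w₁ w₂)) ≤
      (12 * η + 32 * ρ) * (Fintype.card V₁ * Fintype.card V₂) := by
    simp only [LayerLaw.mean_sum]
    refine (Finset.sum_le_sum fun w₁ _ => Finset.sum_le_sum fun w₂ _ => hmean w₁ w₂).trans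
      (le_of_eq ?_)
    simp only [Finset.sum_const, Finset.card_univ, nsmul_eq_mul]
    ring
  obtain ⟨ω, hω⟩ := μ.κ.exists_le_of_mean_le htotal
  -- `invFun` returns an arbitrary message if the decoded tuple does not represent one
  refine ⟨enc ω, fun w₂ => ω.x ((ι₂ w₂).1, (ι₂ w₂).2.1),
    fun y => Function.invFun ι₁ (decode₁ τ v₁ ω y), fun y => Function.invFun ι₂ (decode₂ τ v₂ ω y),
    le_trans ?_ hω⟩
  refine Finset.sum_le_sum fun w₁ _ => Finset.sum_le_sum fun w₂ _ =>
    Finset.sum_le_sum fun y₁ _ => Finset.sum_le_sum fun y₂ _ => ?_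
  split_ifs with hc
  · exact mul_nonneg (μ.W_nonneg _ _ _ _) (ind_nonneg _)
  · have : ¬ (decode₁ τ v₁ ω y₁ = ι₁ w₁ ∧ decode₂ τ v₂ ω y₂ = ι₂ w₂) := by
      rintro ⟨e1, e2⟩
      exact hc ⟨by simp only [e1, Function.leftInverse_invFun hι₁ w₁], by
        simp only [e2, Function.leftInverse_invFun hι₂ w₂]⟩
    rw [ind_of_true this, mul_one]

end Model

/-! ### The weak law of large numbers for information densities -/

section lln

variable {S : Type*} [Fintype S]

/-- The mean of the information density `log₂ (num / den)`. -/
def density (P num den : S → ℝ) : ℝ := ∑ s, P s * Real.logb 2 (num s / den s)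

theorem prodMean_sum_sq {P : S → ℝ} (hP1 : ∑ s, P s = 1) {g : S → ℝ} (hg : ∑ s, P s * g s = 0)
    (N : ℕ) : prodMean (fun _ : Fin N => P) (fun z => (∑ i, g (z i)) ^ 2) =
      N * ∑ s, P s * g s ^ 2 := by
  have h : ∀ z : Fin N → S, (∑ i, g (z i)) ^ 2 = ∑ i, ∑ j, g (z i) * g (z j) := fun z => by
    rw [sq, Finset.sum_mul_sum]
  have two : ∀ i j : Fin N, prodMean (fun _ : Fin N => P) (fun z => g (z i) * g (z j)) =
      if i = j then ∑ s, P s * g s ^ 2 else 0 := by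
    intro i j
    rw [prodMean_two (fun _ => hP1) i j fun a b => g a * g b]
    split_ifs with hij
    · exact Finset.sum_congr rfl fun s _ => by rw [second_of_same hij, sq]
    · refine Finset.sum_eq_zero fun s _ => ?_
      rw [second_of_ne hij]
      have : ∑ t, P t * (g s * g t) = g s * ∑ t, P t * g t := by
        rw [Finset.mul_sum]
        exact Finset.sum_congr rfl fun _ _ => by ring
      rw [this, hg, mul_zero, mul_zero]
  simp only [h, prodMean_sum, two, Finset.sum_ite_eq, Finset.mem_univ, if_true, Finset.sum_const,
    Finset.card_univ, Fintype.card_fin, nsmul_eq_mul]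

theorem prod_lt_imp_sum_logb_lt {N : ℕ} {a b : Fin N → ℝ} (ha : ∀ i, 0 < a i) (hb : ∀ i, 0 < b i)
    {r : ℝ} (h : ∏ i, a i < 2 ^ r * ∏ i, b i) : ∑ i, Real.logb 2 (a i / b i) < r := by
  have hA : 0 < ∏ i, a i := Finset.prod_pos fun i _ => ha i
  have hB : 0 < ∏ i, b i := Finset.prod_pos fun i _ => hb i
  rw [← Real.logb_prod Finset.univ _ fun i _ => (div_pos (ha i) (hb i)).ne',
      Finset.prod_div_distrib]
  rw [Real.logb_lt_iff_lt_rpow one_lt_two (div_pos hA hB), div_lt_iff₀ hB]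
  exact h

/-- The information density of a block of independent symbols is rarely below its mean by more
than `N δ`. -/
theorem tendsto_mass_density {P num den : S → ℝ} (hP : ∀ s, 0 ≤ P s) (hP1 : ∑ s, P s = 1)
    (hnum : ∀ s, P s ≠ 0 → 0 < num s) (hden : ∀ s, P s ≠ 0 → 0 < den s) {δ : ℝ} (hδ : 0 < δ) :
    Tendsto (fun N : ℕ => ∑ z : Fin N → S, (∏ i, P (z i)) *
      ind (¬ ((2 : ℝ) ^ ((N : ℝ) * (density P num den - δ)) * ∏ i, den (z i) ≤ ∏ i, num (z i))))
      atTop (𝓝 0) := by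
  set E := density P num den with hE
  set g : S → ℝ := fun s => Real.logb 2 (num s / den s) - E with hg
  have hg0 : ∑ s, P s * g s = 0 := by
    simp only [hg, mul_sub, Finset.sum_sub_distrib, ← Finset.sum_mul, hP1, hE, density]
    ring
  set V := ∑ s, P s * g s ^ 2 with hV
  have bound : ∀ N : ℕ, 0 < N → ∑ z : Fin N → S, (∏ i, P (z i)) *
      ind (¬ ((2 : ℝ) ^ ((N : ℝ) * (E - δ)) * ∏ i, den (z i) ≤ ∏ i, num (z i))) ≤
      V / δ ^ 2 * (N : ℝ)⁻¹ := by
    intro N hN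
    have hN0 : (0 : ℝ) < N := by exact_mod_cast hN
    calc _ ≤ prodMean (fun _ : Fin N => P)
          (fun z => ((N : ℝ) * δ)⁻¹ ^ 2 * (∑ i, g (z i)) ^ 2) := by
          refine Finset.sum_le_sum fun z _ => ?_
          by_cases h0 : ∏ i, P (z i) = 0
          · rw [h0, zero_mul, zero_mul]
          refine mul_le_mul_of_nonneg_left ?_ (Finset.prod_nonneg fun i _ => hP _)
          by_cases h : (2 : ℝ) ^ ((N : ℝ) * (E - δ)) * ∏ i, den (z i) ≤ ∏ i, num (z i)
          · rw [ind_of_false (not_not.2 h)]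
            positivity
          rw [ind_of_true h]
          beta_reduce
          rw [← mul_pow]
          -- Chebyshev: on an atypical block the centered sum is below `-N δ`
          have hz : ∀ i, P (z i) ≠ 0 := fun i => Finset.prod_ne_zero_iff.1 h0 i (Finset.mem_univ i)
          have hlt := prod_lt_imp_sum_logb_lt (fun i => hnum _ (hz i)) (fun i => hden _ (hz i))
            (not_le.1 h)
          have hs : ∑ i, g (z i) < -((N : ℝ) * δ) := by
            simp only [hg, Finset.sum_sub_distrib, Finset.sum_const, Finset.card_univ,
              Fintype.card_fin, nsmul_eq_mul]
            linarith
          have hNδ : 0 < (N : ℝ) * δ := by positivity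
          have : 1 ≤ -(((N : ℝ) * δ)⁻¹ * ∑ i, g (z i)) := by
            rw [← mul_neg, ← div_eq_inv_mul, le_div_iff₀ hNδ]
            linarith
          nlinarith
      _ = V / δ ^ 2 * (N : ℝ)⁻¹ := by
          rw [prodMean_mul_left, prodMean_sum_sq hP1 hg0, ← hV]
          field_simp
  refine squeeze_zero' (Eventually.of_forall fun N => Finset.sum_nonneg fun z _ =>
    mul_nonneg (Finset.prod_nonneg fun i _ => hP _) (ind_nonneg _))
    ((eventually_gt_atTop 0).mono bound) ?_
  simpa using tendsto_inv_atTop_nhds_zero_nat.const_mul (V / δ ^ 2)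

end lln

/-! ### Blocks of independent symbols -/

section block

variable {A C B D Z X Y₁ Y₂ : Type*}

/-- Blocks of input symbols as symbols over the block alphabets. -/
def inputBlock (N : ℕ) : (Fin N → InputSymbols A C B D Z X) ≃
    InputSymbols (Fin N → A) (Fin N → C) (Fin N → B) (Fin N → D) (Fin N → Z) (Fin N → X) where
  toFun z := ⟨fun i => (z i).u1c, fun i => (z i).u2c, fun i => (z i).u1pb, fun i => (z i).u2pb,
    fun i => (z i).x₁, fun i => (z i).x₂⟩
  invFun s i := ⟨s.u1c i, s.u2c i, s.u1pb i, s.u2pb i, s.x₁ i, s.x₂ i⟩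
  left_inv _ := rfl
  right_inv _ := rfl

/-- Blocks of symbols as symbols over the block alphabets. -/
def allBlock (N : ℕ) : (Fin N → AllSymbols A C B D Z X Y₁ Y₂) ≃
    AllSymbols (Fin N → A) (Fin N → C) (Fin N → B) (Fin N → D) (Fin N → Z) (Fin N → X)
      (Fin N → Y₁) (Fin N → Y₂) where
  toFun z := ⟨inputBlock N fun i => (z i).toInputSymbols, fun i => (z i).y₁, fun i => (z i).y₂⟩
  invFun s i := ⟨(inputBlock N).symm s.toInputSymbols i, s.y₁ i, s.y₂ i⟩
  left_inv _ := rfl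
  right_inv _ := rfl

variable [Fintype A] [Fintype C] [Fintype B] [Fintype D]
    [Fintype Z] [Fintype X] [Fintype Y₁] [Fintype Y₂]

/-- Codewords of length `N` with independent letters. -/
def LayerLaw.pow (κ : LayerLaw C X A B D) (N : ℕ) :
    LayerLaw (Fin N → C) (Fin N → X) (Fin N → A) (Fin N → B) (Fin N → D) where
  c u := ∏ i, κ.c (u i)
  x u v := ∏ i, κ.x (u i) (v i)
  a u v := ∏ i, κ.a (u i) (v i)
  b u v w := ∏ i, κ.b (u i) (v i) (w i)
  d u v w t := ∏ i, κ.d (u i) (v i) (w i) (t i)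
  c_nonneg _ := Finset.prod_nonneg fun _ _ => κ.c_nonneg _
  x_nonneg _ _ := Finset.prod_nonneg fun _ _ => κ.x_nonneg _ _
  a_nonneg _ _ := Finset.prod_nonneg fun _ _ => κ.a_nonneg _ _
  b_nonneg _ _ _ := Finset.prod_nonneg fun _ _ => κ.b_nonneg _ _ _
  d_nonneg _ _ _ _ := Finset.prod_nonneg fun _ _ => κ.d_nonneg _ _ _ _
  sum_c := by rw [sum_pi_prod]; simp [κ.sum_c]
  sum_x u := by rw [sum_pi_prod fun i => κ.x (u i)]; simp [κ.sum_x]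
  sum_a u := by rw [sum_pi_prod fun i => κ.a (u i)]; simp [κ.sum_a]
  sum_b u v := by rw [sum_pi_prod fun i => κ.b (u i) (v i)]; simp [κ.sum_b]
  sum_d u v w := by rw [sum_pi_prod fun i => κ.d (u i) (v i) (w i)]; simp [κ.sum_d]

theorem LayerLaw.pow_word (κ : LayerLaw C X A B D) (N : ℕ) (c : Fin N → C) (x : Fin N → X)
    (a : Fin N → A) (b : Fin N → B) (d : Fin N → D) :
    (κ.pow N).word c x a b d = ∏ i, κ.word (c i) (x i) (a i) (b i) (d i) := by
  simp only [LayerLaw.word, LayerLaw.pow, Finset.prod_mul_distrib]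

/-- `N` independent uses of the channel with independent input symbols. -/
def Model.pow (μ : Model A C B D Z X Y₁ Y₂) (N : ℕ) : Model (Fin N → A) (Fin N → C) (Fin N → B)
    (Fin N → D) (Fin N → Z) (Fin N → X) (Fin N → Y₁) (Fin N → Y₂) where
  κ := μ.κ.pow N
  p s := ∏ i, μ.p ((inputBlock N).symm s i)
  W z x y₁ y₂ := ∏ i, μ.W (z i) (x i) (y₁ i) (y₂ i)
  p_nonneg _ := Finset.prod_nonneg fun _ _ => μ.p_nonneg _
  sum_p := by
    rw [(inputBlock N).symm.sum_comp fun z => ∏ i, μ.p (z i), sum_pi_prod fun _ => μ.p]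
    simp [μ.sum_p]
  W_nonneg _ _ _ _ := Finset.prod_nonneg fun _ _ => μ.W_nonneg _ _ _ _
  sum_W z x := by
    have h : ∀ y₁ : Fin N → Y₁, ∑ y₂ : Fin N → Y₂, ∏ i, μ.W (z i) (x i) (y₁ i) (y₂ i) =
        ∏ i, ∑ y₂, μ.W (z i) (x i) (y₁ i) y₂ := fun y₁ =>
      sum_pi_prod fun i => μ.W (z i) (x i) (y₁ i)
    simp only [h]
    rw [sum_pi_prod fun i y₁ => ∑ y₂, μ.W (z i) (x i) y₁ y₂]
    simp [μ.sum_W]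
  dominated s hs := by
    rw [LayerLaw.pow_word, Finset.prod_eq_zero_iff] at hs
    obtain ⟨i, hi, h0⟩ := hs
    exact Finset.prod_eq_zero hi (μ.dominated ((inputBlock N).symm s i) h0)

variable (μ : Model A C B D Z X Y₁ Y₂)

theorem Model.pow_P_allBlock (N : ℕ) (z : Fin N → AllSymbols A C B D Z X Y₁ Y₂) :
    (μ.pow N).P (allBlock N z) = ∏ i, μ.P (z i) := by
  simp only [Model.P, Finset.prod_mul_distrib]
  rfl

/-- Marginals of a block of independent symbols are products. -/
theorem Model.marg_pow {N : ℕ} {TB T : Type*} (f : AllSymbols A C B D Z X Y₁ Y₂ → T)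
    (t : Fin N → T) (fB : AllSymbols (Fin N → A) (Fin N → C) (Fin N → B) (Fin N → D) (Fin N → Z)
      (Fin N → X) (Fin N → Y₁) (Fin N → Y₂) → TB) (tB : TB)
    (h : ∀ z, fB (allBlock N z) = tB ↔ ∀ i, f (z i) = t i) :
    marg (μ.pow N).P fB tB = ∏ i, marg μ.P f (t i) := by
  classical
  simp only [marg]
  rw [← sum_pi_prod fun i s => if f s = t i then μ.P s else 0, ← (allBlock N).sum_comp]
  refine Finset.sum_congr rfl fun z _ => ?_
  rw [Finset.prod_ite_zero, μ.pow_P_allBlock]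
  simp only [h, Finset.mem_univ, true_implies]

/-- A block event that contains the blocks of large information density has mass tending to `1`. -/
theorem Model.tendsto_mass_not {num den : AllSymbols A C B D Z X Y₁ Y₂ → ℝ}
    (hnum : ∀ s, μ.P s ≠ 0 → 0 < num s) (hden : ∀ s, μ.P s ≠ 0 → 0 < den s) {δ : ℝ} (hδ : 0 < δ)
    {G : ∀ N : ℕ, AllSymbols (Fin N → A) (Fin N → C) (Fin N → B) (Fin N → D) (Fin N → Z)
      (Fin N → X) (Fin N → Y₁) (Fin N → Y₂) → Prop}
    (hG : ∀ (N : ℕ) z, (2 : ℝ) ^ ((N : ℝ) * (density μ.P num den - δ)) * ∏ i, den (z i) ≤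
      ∏ i, num (z i) → G N (allBlock N z)) :
    Tendsto (fun N : ℕ => ∑ s, (μ.pow N).P s * ind (¬ G N s)) atTop (𝓝 0) := by
  refine squeeze_zero (fun N => Finset.sum_nonneg fun s _ => mul_nonneg ((μ.pow N).P_nonneg s)
    (ind_nonneg _)) (fun N => ?_) (tendsto_mass_density μ.P_nonneg μ.sum_P hnum hden hδ)
  rw [← (allBlock N).sum_comp]
  refine Finset.sum_le_sum fun z _ => ?_
  rw [μ.pow_P_allBlock]
  refine mul_le_mul_of_nonneg_left ?_ (Finset.prod_nonneg fun i _ => μ.P_nonneg _)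
  by_cases h : G N (allBlock N z)
  · rw [ind_of_false (not_not.2 h)]
    exact ind_nonneg _
  · rw [ind_of_true h, ind_of_true fun h' => h (hG N z h')]

end block

/-! ### Typical sets of blocks -/

section block

variable {A C B D Z X Y₁ Y₂ : Type*} [Fintype A] [Fintype C] [Fintype B] [Fintype D]
    [Fintype Z] [Fintype X] [Fintype Y₁] [Fintype Y₂] (μ : Model A C B D Z X Y₁ Y₂)

theorem tendsto_mass_not_and {S : ℕ → Type*} [∀ N, Fintype (S N)] {P : ∀ N, S N → ℝ}
    (hP : ∀ N s, 0 ≤ P N s) {G H : ∀ N, S N → Prop}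
    (hG : Tendsto (fun N => ∑ s, P N s * ind (¬ G N s)) atTop (𝓝 0))
    (hH : Tendsto (fun N => ∑ s, P N s * ind (¬ H N s)) atTop (𝓝 0)) :
    Tendsto (fun N => ∑ s, P N s * ind (¬ (G N s ∧ H N s))) atTop (𝓝 0) := by
  have hsum := hG.add hH
  rw [add_zero] at hsum
  refine squeeze_zero (fun N => Finset.sum_nonneg fun s _ => mul_nonneg (hP N s) (ind_nonneg _))
    (fun N => ?_) hsum
  rw [← Finset.sum_add_distrib]
  refine Finset.sum_le_sum fun s _ => ?_
  rw [← mul_add]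
  refine mul_le_mul_of_nonneg_left ?_ (hP N s)
  by_cases hg : G N s <;> by_cases hh : H N s <;> simp [ind, hg, hh]

namespace Model

theorem κ_pos_of_P_ne_zero {s : AllSymbols A C B D Z X Y₁ Y₂} (hs : μ.P s ≠ 0) :
    0 < μ.κ.c s.u2c ∧ 0 < μ.κ.x s.u2c s.x₂ ∧ 0 < μ.κ.a s.u2c s.u1c ∧ 0 < μ.κ.b s.u2c s.u1c s.u1pb ∧
      0 < μ.κ.d s.u2c s.x₂ s.u1c s.u2pb := by
  have h : μ.κ.word s.u2c s.x₂ s.u1c s.u1pb s.u2pb ≠ 0 := fun h0 =>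
    hs (by rw [P, μ.dominated _ h0, zero_mul])
  simp only [LayerLaw.word, mul_ne_zero_iff] at h
  obtain ⟨⟨⟨⟨h1, h2⟩, h3⟩, h4⟩, h5⟩ := h
  exact ⟨lt_of_le_of_ne (μ.κ.c_nonneg _) h1.symm, lt_of_le_of_ne (μ.κ.x_nonneg _ _) h2.symm,
    lt_of_le_of_ne (μ.κ.a_nonneg _ _) h3.symm, lt_of_le_of_ne (μ.κ.b_nonneg _ _ _) h4.symm,
    lt_of_le_of_ne (μ.κ.d_nonneg _ _ _ _) h5.symm⟩

theorem marg_pos_of_P_ne_zero {s : AllSymbols A C B D Z X Y₁ Y₂} (hs : μ.P s ≠ 0) {T : Type*}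
    (f : AllSymbols A C B D Z X Y₁ Y₂ → T) : 0 < marg μ.P f (f s) :=
  (lt_of_le_of_ne (μ.P_nonneg s) hs.symm).trans_le (le_marg μ.P_nonneg f s)

/-- A block whose likelihood ratio `marg / k` has mean exponent `i` rarely exceeds it by more than
`N δ`. -/
theorem tendsto_mass_marg_le {T : Type*} {TB : ℕ → Type*} {f : AllSymbols A C B D Z X Y₁ Y₂ → T}
    {fB : ∀ N, AllSymbols (Fin N → A) (Fin N → C) (Fin N → B) (Fin N → D) (Fin N → Z)
      (Fin N → X) (Fin N → Y₁) (Fin N → Y₂) → TB N} {k : AllSymbols A C B D Z X Y₁ Y₂ → ℝ}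
    {kB : ∀ N, AllSymbols (Fin N → A) (Fin N → C) (Fin N → B) (Fin N → D) (Fin N → Z)
      (Fin N → X) (Fin N → Y₁) (Fin N → Y₂) → ℝ}
    (hf : ∀ N z z', fB N (allBlock N z) = fB N (allBlock N z') ↔ ∀ i, f (z i) = f (z' i))
    (hk : ∀ N z, ∏ i, k (z i) = kB N (allBlock N z)) (hk0 : ∀ s, μ.P s ≠ 0 → 0 < k s) {i : ℝ}
    (hi : density μ.P k (fun s => marg μ.P f (f s)) = -i) {δ : ℝ} (hδ : 0 < δ) :
    Tendsto (fun N : ℕ => ∑ s, (μ.pow N).P s * ind (¬ (marg (μ.pow N).P (fB N) (fB N s) ≤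
      (2 : ℝ) ^ ((N : ℝ) * (i + δ)) * kB N s))) atTop (𝓝 0) := by
  refine μ.tendsto_mass_not hk0 (fun s hs => μ.marg_pos_of_P_ne_zero hs f) hδ fun N z h => ?_
  rw [hi, show (N : ℝ) * (-i - δ) = -((N : ℝ) * (i + δ)) by ring, Real.rpow_neg zero_le_two,
    inv_mul_le_iff₀ (by positivity), hk] at h
  rwa [μ.marg_pow f (fun i => f (z i)) _ _ fun z' => hf N z' z]

/-- A block whose likelihood ratio `marg g / (marg f * k)` has mean exponent `e` rarely falls below
it by more than `N δ`. -/
theorem tendsto_mass_le_marg {T U : Type*} {TB UB : ℕ → Type*}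
    {f : AllSymbols A C B D Z X Y₁ Y₂ → T} {g : AllSymbols A C B D Z X Y₁ Y₂ → U}
    {fB : ∀ N, AllSymbols (Fin N → A) (Fin N → C) (Fin N → B) (Fin N → D) (Fin N → Z)
      (Fin N → X) (Fin N → Y₁) (Fin N → Y₂) → TB N}
    {gB : ∀ N, AllSymbols (Fin N → A) (Fin N → C) (Fin N → B) (Fin N → D) (Fin N → Z)
      (Fin N → X) (Fin N → Y₁) (Fin N → Y₂) → UB N} {k : AllSymbols A C B D Z X Y₁ Y₂ → ℝ}
    {kB : ∀ N, AllSymbols (Fin N → A) (Fin N → C) (Fin N → B) (Fin N → D) (Fin N → Z)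
      (Fin N → X) (Fin N → Y₁) (Fin N → Y₂) → ℝ}
    (hf : ∀ N z z', fB N (allBlock N z) = fB N (allBlock N z') ↔ ∀ i, f (z i) = f (z' i))
    (hg : ∀ N z z', gB N (allBlock N z) = gB N (allBlock N z') ↔ ∀ i, g (z i) = g (z' i))
    (hk : ∀ N z, ∏ i, k (z i) = kB N (allBlock N z)) (hk0 : ∀ s, μ.P s ≠ 0 → 0 < k s) {e : ℝ}
    (he : density μ.P (fun s => marg μ.P g (g s)) (fun s => marg μ.P f (f s) * k s) = e) {δ : ℝ}
    (hδ : 0 < δ) :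
    Tendsto (fun N : ℕ => ∑ s, (μ.pow N).P s * ind (¬ ((2 : ℝ) ^ ((N : ℝ) * (e - δ)) *
      (marg (μ.pow N).P (fB N) (fB N s) * kB N s) ≤ marg (μ.pow N).P (gB N) (gB N s))))
      atTop (𝓝 0) := by
  refine μ.tendsto_mass_not (fun s hs => μ.marg_pos_of_P_ne_zero hs g)
    (fun s hs => mul_pos (μ.marg_pos_of_P_ne_zero hs f) (hk0 s hs)) hδ fun N z h => ?_
  rw [he, Finset.prod_mul_distrib, hk] at h
  rwa [μ.marg_pow f (fun i => f (z i)) _ _ fun z' => hf N z' z,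
    μ.marg_pow g (fun i => g (z i)) _ _ fun z' => hg N z' z]

/-- The mean information densities of the covering conditions (`i`) and of the packing conditions of
receiver 1 (`e`) and of receiver 2 (`d`). The covering conditions bound the likelihood ratios from
above, hence their densities are stated for the inverse ratio and carry a minus sign; those of `U1c`
alone and of `U1c` with `U2pb` have the same exponent `i₁`. -/
structure Exponents where
  (i₁ i₂ i₃ e₁ e₂ e₃ d₁ d₂ d₃ d₄ d₅ : ℝ)
  density_k₁ : density μ.P
    (fun s => μ.κ.c s.u2c * μ.κ.x s.u2c s.x₂ * μ.κ.a s.u2c s.u1c)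
    (fun s => marg μ.P (fun s => (s.u2c, s.x₂, s.u1c)) (s.u2c, s.x₂, s.u1c)) = -i₁
  density_k₁' : density μ.P
    (fun s => μ.κ.c s.u2c * μ.κ.x s.u2c s.x₂ * μ.κ.a s.u2c s.u1c * μ.κ.d s.u2c s.x₂ s.u1c s.u2pb)
    (fun s => marg μ.P (fun s => (s.u2c, s.x₂, s.u1c, s.u2pb)) (s.u2c, s.x₂, s.u1c, s.u2pb)) = -i₁
  density_k₂ : density μ.P
    (fun s => μ.κ.c s.u2c * μ.κ.x s.u2c s.x₂ * μ.κ.a s.u2c s.u1c * μ.κ.b s.u2c s.u1c s.u1pb)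
    (fun s => marg μ.P (fun s => (s.u2c, s.x₂, s.u1c, s.u1pb)) (s.u2c, s.x₂, s.u1c, s.u1pb)) = -i₂
  density_k₃ : density μ.P
    (fun s => μ.κ.c s.u2c * μ.κ.x s.u2c s.x₂ * μ.κ.a s.u2c s.u1c * μ.κ.b s.u2c s.u1c s.u1pb *
        μ.κ.d s.u2c s.x₂ s.u1c s.u2pb)
    (fun s => marg μ.P (fun s => (s.u2c, s.x₂, s.u1c, s.u1pb, s.u2pb)) (s.u2c, s.x₂, s.u1c, s.u1pb,
        s.u2pb)) = -i₃
  density_e₁ : density μ.P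
    (fun s => marg μ.P (fun s => (s.y₁, s.u2c, s.u1c, s.u1pb)) (s.y₁, s.u2c, s.u1c, s.u1pb))
    (fun s => marg μ.P (fun s => s.y₁) s.y₁ * (μ.κ.c s.u2c * μ.κ.a s.u2c s.u1c *
        μ.κ.b s.u2c s.u1c s.u1pb)) = e₁
  density_e₂ : density μ.P
    (fun s => marg μ.P (fun s => ((s.u2c, s.y₁), s.u1c, s.u1pb)) ((s.u2c, s.y₁), s.u1c, s.u1pb))
    (fun s => marg μ.P (fun s => (s.u2c, s.y₁)) (s.u2c, s.y₁) *
        (μ.κ.a s.u2c s.u1c * μ.κ.b s.u2c s.u1c s.u1pb)) = e₂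
  density_e₃ : density μ.P
    (fun s => marg μ.P (fun s => ((s.u2c, s.u1c, s.y₁), s.u1pb)) ((s.u2c, s.u1c, s.y₁), s.u1pb))
    (fun s => marg μ.P (fun s => (s.u2c, s.u1c, s.y₁)) (s.u2c, s.u1c, s.y₁) *
        (μ.κ.b s.u2c s.u1c s.u1pb)) = e₃
  density_d₁ : density μ.P
    (fun s => marg μ.P (fun s => (s.y₂, s.u2c, s.x₂, s.u1c, s.u2pb)) (s.y₂, s.u2c, s.x₂, s.u1c,
        s.u2pb))
    (fun s => marg μ.P (fun s => s.y₂) s.y₂ * (μ.κ.c s.u2c * μ.κ.x s.u2c s.x₂ * μ.κ.a s.u2c s.u1c *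
        μ.κ.d s.u2c s.x₂ s.u1c s.u2pb)) = d₁
  density_d₂ : density μ.P
    (fun s => marg μ.P (fun s => ((s.u2c, s.y₂), s.x₂, s.u1c, s.u2pb)) ((s.u2c, s.y₂), s.x₂, s.u1c,
        s.u2pb))
    (fun s => marg μ.P (fun s => (s.u2c, s.y₂)) (s.u2c, s.y₂) *
        (μ.κ.x s.u2c s.x₂ * μ.κ.a s.u2c s.u1c * μ.κ.d s.u2c s.x₂ s.u1c s.u2pb)) = d₂
  density_d₃ : density μ.P
    (fun s => marg μ.P (fun s => ((s.u2c, s.u1c, s.y₂), s.x₂, s.u2pb)) ((s.u2c, s.u1c, s.y₂), s.x₂,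
        s.u2pb))
    (fun s => marg μ.P (fun s => (s.u2c, s.u1c, s.y₂)) (s.u2c, s.u1c, s.y₂) *
        (μ.κ.x s.u2c s.x₂ * μ.κ.d s.u2c s.x₂ s.u1c s.u2pb)) = d₃
  density_d₄ : density μ.P
    (fun s => marg μ.P (fun s => ((s.u2c, s.x₂, s.y₂), s.u1c, s.u2pb)) ((s.u2c, s.x₂, s.y₂), s.u1c,
        s.u2pb))
    (fun s => marg μ.P (fun s => (s.u2c, s.x₂, s.y₂)) (s.u2c, s.x₂, s.y₂) *
        (μ.κ.a s.u2c s.u1c * μ.κ.d s.u2c s.x₂ s.u1c s.u2pb)) = d₄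
  density_d₅ : density μ.P
    (fun s => marg μ.P (fun s => ((s.u2c, s.x₂, s.u1c, s.y₂), s.u2pb)) ((s.u2c, s.x₂, s.u1c, s.y₂),
        s.u2pb))
    (fun s => marg μ.P (fun s => (s.u2c, s.x₂, s.u1c, s.y₂)) (s.u2c, s.x₂, s.u1c, s.y₂) *
        (μ.κ.d s.u2c s.x₂ s.u1c s.u2pb)) = d₅

variable {μ}

/-- The typical sets of blocks: the information densities are within `N δ` of their means. -/
def Exponents.typicalSets (E : μ.Exponents) (δ : ℝ)
    (h₀ : ∀ c x, marg μ.P (fun s => (s.u2c, s.x₂)) (c, x) ≤ μ.κ.c c * μ.κ.x c x) (N : ℕ) :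
    (μ.pow N).TypicalSets where
  T c x a b d :=
    marg (μ.pow N).P (fun s => (s.u2c, s.x₂, s.u1c)) (c, x, a) ≤
      (2 : ℝ) ^ ((N : ℝ) * (E.i₁ + δ)) * ((μ.pow N).κ.c c * (μ.pow N).κ.x c x * (μ.pow N).κ.a c a) ∧
    marg (μ.pow N).P (fun s => (s.u2c, s.x₂, s.u1c, s.u2pb)) (c, x, a, d) ≤
      (2 : ℝ) ^ ((N : ℝ) * (E.i₁ + δ)) * ((μ.pow N).κ.c c * (μ.pow N).κ.x c x * (μ.pow N).κ.a c a *
          (μ.pow N).κ.d c x a d) ∧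
    marg (μ.pow N).P (fun s => (s.u2c, s.x₂, s.u1c, s.u1pb)) (c, x, a, b) ≤
      (2 : ℝ) ^ ((N : ℝ) * (E.i₂ + δ)) * ((μ.pow N).κ.c c * (μ.pow N).κ.x c x * (μ.pow N).κ.a c a *
          (μ.pow N).κ.b c a b) ∧
    marg (μ.pow N).P (fun s => (s.u2c, s.x₂, s.u1c, s.u1pb, s.u2pb)) (c, x, a, b, d) ≤
      (2 : ℝ) ^ ((N : ℝ) * (E.i₃ + δ)) * ((μ.pow N).κ.c c * (μ.pow N).κ.x c x * (μ.pow N).κ.a c a *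
          (μ.pow N).κ.b c a b * (μ.pow N).κ.d c x a d)
  T₁ c a b y :=
    (2 : ℝ) ^ ((N : ℝ) * (E.e₁ - δ)) * (marg (μ.pow N).P (fun s => s.y₁) y *
      ((μ.pow N).κ.c c * (μ.pow N).κ.a c a * (μ.pow N).κ.b c a b)) ≤
      marg (μ.pow N).P (fun s => (s.y₁, s.u2c, s.u1c, s.u1pb)) (y, c, a, b) ∧
    (2 : ℝ) ^ ((N : ℝ) * (E.e₂ - δ)) * (marg (μ.pow N).P (fun s => (s.u2c, s.y₁)) (c, y) *
      ((μ.pow N).κ.a c a * (μ.pow N).κ.b c a b)) ≤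
      marg (μ.pow N).P (fun s => ((s.u2c, s.y₁), s.u1c, s.u1pb)) ((c, y), a, b) ∧
    (2 : ℝ) ^ ((N : ℝ) * (E.e₃ - δ)) * (marg (μ.pow N).P (fun s => (s.u2c, s.u1c, s.y₁)) (c, a, y) *
      ((μ.pow N).κ.b c a b)) ≤
      marg (μ.pow N).P (fun s => ((s.u2c, s.u1c, s.y₁), s.u1pb)) ((c, a, y), b)
  T₂ c x a d y :=
    (2 : ℝ) ^ ((N : ℝ) * (E.d₁ - δ)) * (marg (μ.pow N).P (fun s => s.y₂) y *
      ((μ.pow N).κ.c c * (μ.pow N).κ.x c x * (μ.pow N).κ.a c a * (μ.pow N).κ.d c x a d)) ≤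
      marg (μ.pow N).P (fun s => (s.y₂, s.u2c, s.x₂, s.u1c, s.u2pb)) (y, c, x, a, d) ∧
    (2 : ℝ) ^ ((N : ℝ) * (E.d₂ - δ)) * (marg (μ.pow N).P (fun s => (s.u2c, s.y₂)) (c, y) *
      ((μ.pow N).κ.x c x * (μ.pow N).κ.a c a * (μ.pow N).κ.d c x a d)) ≤
      marg (μ.pow N).P (fun s => ((s.u2c, s.y₂), s.x₂, s.u1c, s.u2pb)) ((c, y), x, a, d) ∧
    (2 : ℝ) ^ ((N : ℝ) * (E.d₃ - δ)) * (marg (μ.pow N).P (fun s => (s.u2c, s.u1c, s.y₂)) (c, a, y) *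
      ((μ.pow N).κ.x c x * (μ.pow N).κ.d c x a d)) ≤
      marg (μ.pow N).P (fun s => ((s.u2c, s.u1c, s.y₂), s.x₂, s.u2pb)) ((c, a, y), x, d) ∧
    (2 : ℝ) ^ ((N : ℝ) * (E.d₄ - δ)) * (marg (μ.pow N).P (fun s => (s.u2c, s.x₂, s.y₂)) (c, x, y) *
      ((μ.pow N).κ.a c a * (μ.pow N).κ.d c x a d)) ≤
      marg (μ.pow N).P (fun s => ((s.u2c, s.x₂, s.y₂), s.u1c, s.u2pb)) ((c, x, y), a, d) ∧
    (2 : ℝ) ^ ((N : ℝ) * (E.d₅ - δ)) * (marg (μ.pow N).P (fun s => (s.u2c, s.x₂, s.u1c, s.y₂)) (c,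
        x, a, y) *
      ((μ.pow N).κ.d c x a d)) ≤
      marg (μ.pow N).P (fun s => ((s.u2c, s.x₂, s.u1c, s.y₂), s.u2pb)) ((c, x, a, y), d)
  K₁ := (2 : ℝ) ^ ((N : ℝ) * (E.i₁ + δ))
  K₂ := (2 : ℝ) ^ ((N : ℝ) * (E.i₂ + δ))
  K₃ := (2 : ℝ) ^ ((N : ℝ) * (E.i₃ + δ))
  α₁ := (2 : ℝ) ^ ((N : ℝ) * (E.e₁ - δ))
  α₂ := (2 : ℝ) ^ ((N : ℝ) * (E.e₂ - δ))
  α₃ := (2 : ℝ) ^ ((N : ℝ) * (E.e₃ - δ))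
  β₁ := (2 : ℝ) ^ ((N : ℝ) * (E.d₁ - δ))
  β₂ := (2 : ℝ) ^ ((N : ℝ) * (E.d₂ - δ))
  β₃ := (2 : ℝ) ^ ((N : ℝ) * (E.d₃ - δ))
  β₄ := (2 : ℝ) ^ ((N : ℝ) * (E.d₄ - δ))
  β₅ := (2 : ℝ) ^ ((N : ℝ) * (E.d₅ - δ))
  K₁_nonneg := by positivity
  K₂_nonneg := by positivity
  K₃_nonneg := by positivity
  α₁_pos := by positivity
  α₂_pos := by positivity
  α₃_pos := by positivity
  β₁_pos := by positivity
  β₂_pos := by positivity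
  β₃_pos := by positivity
  β₄_pos := by positivity
  β₅_pos := by positivity
  k₀ c x := by
    rw [μ.marg_pow (fun s => (s.u2c, s.x₂)) (fun i => (c i, x i)) _ _ fun z => by
      simp [allBlock, inputBlock, funext_iff, forall_and]]
    simp only [pow, LayerLaw.pow, ← Finset.prod_mul_distrib]
    exact Finset.prod_le_prod (fun _ _ => marg_nonneg μ.P_nonneg _ _) fun _ _ => h₀ _ _
  k₁ _ _ _ _ _ h := h.1
  k₁' _ _ _ _ _ h := h.2.1
  k₂ _ _ _ _ _ h := h.2.2.1
  k₃ _ _ _ _ _ h := h.2.2.2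
  a₁ _ _ _ _ h := h.1
  a₂ _ _ _ _ h := h.2.1
  a₃ _ _ _ _ h := h.2.2
  b₁ _ _ _ _ _ h := h.1
  b₂ _ _ _ _ _ h := h.2.1
  b₃ _ _ _ _ _ h := h.2.2.1
  b₄ _ _ _ _ _ h := h.2.2.2.1
  b₅ _ _ _ _ _ h := h.2.2.2.2

variable (E : μ.Exponents) {δ : ℝ}
  (h₀ : ∀ c x, marg μ.P (fun s => (s.u2c, s.x₂)) (c, x) ≤ μ.κ.c c * μ.κ.x c x)

theorem Exponents.tendsto_mass (hδ : 0 < δ) : Tendsto (fun N => ∑ s, (μ.pow N).P s *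
    ind (¬ (E.typicalSets δ h₀ N).T s.u2c s.x₂ s.u1c s.u1pb s.u2pb)) atTop (𝓝 0) := by
  refine tendsto_mass_not_and (fun N => (μ.pow N).P_nonneg) ?_
    (tendsto_mass_not_and (fun N => (μ.pow N).P_nonneg) ?_
    (tendsto_mass_not_and (fun N => (μ.pow N).P_nonneg) ?_ ?_))
  · exact μ.tendsto_mass_marg_le (f := fun s => (s.u2c, s.x₂, s.u1c))
      (fB := fun N s => (s.u2c, s.x₂, s.u1c))
      (k := fun s => μ.κ.c s.u2c * μ.κ.x s.u2c s.x₂ * μ.κ.a s.u2c s.u1c)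
      (kB := fun N s => (μ.pow N).κ.c s.u2c * (μ.pow N).κ.x s.u2c s.x₂ * (μ.pow N).κ.a s.u2c s.u1c)
      (fun N z z' => by simp [allBlock, inputBlock, funext_iff, forall_and]) (fun N z =>
          by simp only [Finset.prod_mul_distrib]; rfl)
      (fun s hs => by
        obtain ⟨h1, h2, h3, h4, h5⟩ := μ.κ_pos_of_P_ne_zero hs
        positivity) E.density_k₁ hδ
  · exact μ.tendsto_mass_marg_le (f := fun s => (s.u2c, s.x₂, s.u1c, s.u2pb))
      (fB := fun N s => (s.u2c, s.x₂, s.u1c, s.u2pb))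
      (k := fun s => μ.κ.c s.u2c * μ.κ.x s.u2c s.x₂ * μ.κ.a s.u2c s.u1c *
          μ.κ.d s.u2c s.x₂ s.u1c s.u2pb)
      (kB := fun N s => (μ.pow N).κ.c s.u2c * (μ.pow N).κ.x s.u2c s.x₂ * (μ.pow N).κ.a s.u2c s.u1c *
          (μ.pow N).κ.d s.u2c s.x₂ s.u1c s.u2pb)
      (fun N z z' => by simp [allBlock, inputBlock, funext_iff, forall_and]) (fun N z =>
          by simp only [Finset.prod_mul_distrib]; rfl)
      (fun s hs => by
        obtain ⟨h1, h2, h3, h4, h5⟩ := μ.κ_pos_of_P_ne_zero hs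
        positivity) E.density_k₁' hδ
  · exact μ.tendsto_mass_marg_le (f := fun s => (s.u2c, s.x₂, s.u1c, s.u1pb))
      (fB := fun N s => (s.u2c, s.x₂, s.u1c, s.u1pb))
      (k := fun s => μ.κ.c s.u2c * μ.κ.x s.u2c s.x₂ * μ.κ.a s.u2c s.u1c * μ.κ.b s.u2c s.u1c s.u1pb)
      (kB := fun N s => (μ.pow N).κ.c s.u2c * (μ.pow N).κ.x s.u2c s.x₂ * (μ.pow N).κ.a s.u2c s.u1c *
          (μ.pow N).κ.b s.u2c s.u1c s.u1pb)
      (fun N z z' => by simp [allBlock, inputBlock, funext_iff, forall_and]) (fun N z =>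
          by simp only [Finset.prod_mul_distrib]; rfl)
      (fun s hs => by
        obtain ⟨h1, h2, h3, h4, h5⟩ := μ.κ_pos_of_P_ne_zero hs
        positivity) E.density_k₂ hδ
  · exact μ.tendsto_mass_marg_le (f := fun s => (s.u2c, s.x₂, s.u1c, s.u1pb, s.u2pb))
      (fB := fun N s => (s.u2c, s.x₂, s.u1c, s.u1pb, s.u2pb))
      (k := fun s => μ.κ.c s.u2c * μ.κ.x s.u2c s.x₂ * μ.κ.a s.u2c s.u1c * μ.κ.b s.u2c s.u1c s.u1pb *
          μ.κ.d s.u2c s.x₂ s.u1c s.u2pb)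
      (kB := fun N s => (μ.pow N).κ.c s.u2c * (μ.pow N).κ.x s.u2c s.x₂ * (μ.pow N).κ.a s.u2c s.u1c *
          (μ.pow N).κ.b s.u2c s.u1c s.u1pb * (μ.pow N).κ.d s.u2c s.x₂ s.u1c s.u2pb)
      (fun N z z' => by simp [allBlock, inputBlock, funext_iff, forall_and]) (fun N z =>
          by simp only [Finset.prod_mul_distrib]; rfl)
      (fun s hs => by
        obtain ⟨h1, h2, h3, h4, h5⟩ := μ.κ_pos_of_P_ne_zero hs
        positivity) E.density_k₃ hδ

theorem Exponents.tendsto_mass₁ (hδ : 0 < δ) : Tendsto (fun N => ∑ s, (μ.pow N).P s *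
    ind (¬ (E.typicalSets δ h₀ N).T₁ s.u2c s.u1c s.u1pb s.y₁)) atTop (𝓝 0) := by
  refine tendsto_mass_not_and (fun N => (μ.pow N).P_nonneg) ?_
    (tendsto_mass_not_and (fun N => (μ.pow N).P_nonneg) ?_ ?_)
  · exact μ.tendsto_mass_le_marg (f := fun s => s.y₁)
      (g := fun s => (s.y₁, s.u2c, s.u1c, s.u1pb))
      (fB := fun N s => s.y₁)
      (gB := fun N s => (s.y₁, s.u2c, s.u1c, s.u1pb))
      (k := fun s => μ.κ.c s.u2c * μ.κ.a s.u2c s.u1c * μ.κ.b s.u2c s.u1c s.u1pb)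
      (kB := fun N s => (μ.pow N).κ.c s.u2c * (μ.pow N).κ.a s.u2c s.u1c * (μ.pow N).κ.b s.u2c s.u1c
          s.u1pb)
      (fun N z z' => by simp [allBlock, inputBlock, funext_iff])
      (fun N z z' => by simp [allBlock, inputBlock, funext_iff, forall_and])
      (fun N z => by simp only [Finset.prod_mul_distrib]; rfl)
      (fun s hs => by
        obtain ⟨h1, h2, h3, h4, h5⟩ := μ.κ_pos_of_P_ne_zero hs
        positivity) E.density_e₁ hδ
  · exact μ.tendsto_mass_le_marg (f := fun s => (s.u2c, s.y₁))
      (g := fun s => ((s.u2c, s.y₁), s.u1c, s.u1pb))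
      (fB := fun N s => (s.u2c, s.y₁))
      (gB := fun N s => ((s.u2c, s.y₁), s.u1c, s.u1pb))
      (k := fun s => μ.κ.a s.u2c s.u1c * μ.κ.b s.u2c s.u1c s.u1pb)
      (kB := fun N s => (μ.pow N).κ.a s.u2c s.u1c * (μ.pow N).κ.b s.u2c s.u1c s.u1pb)
      (fun N z z' => by simp [allBlock, inputBlock, funext_iff, forall_and])
      (fun N z z' => by simp [allBlock, inputBlock, funext_iff, forall_and])
      (fun N z => by simp only [Finset.prod_mul_distrib]; rfl)
      (fun s hs => by
        obtain ⟨h1, h2, h3, h4, h5⟩ := μ.κ_pos_of_P_ne_zero hs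
        positivity) E.density_e₂ hδ
  · exact μ.tendsto_mass_le_marg (f := fun s => (s.u2c, s.u1c, s.y₁))
      (g := fun s => ((s.u2c, s.u1c, s.y₁), s.u1pb))
      (fB := fun N s => (s.u2c, s.u1c, s.y₁))
      (gB := fun N s => ((s.u2c, s.u1c, s.y₁), s.u1pb))
      (k := fun s => μ.κ.b s.u2c s.u1c s.u1pb)
      (kB := fun N s => (μ.pow N).κ.b s.u2c s.u1c s.u1pb)
      (fun N z z' => by simp [allBlock, inputBlock, funext_iff, forall_and])
      (fun N z z' => by simp [allBlock, inputBlock, funext_iff, forall_and])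
      (fun N z => rfl)
      (fun s hs => by
        obtain ⟨h1, h2, h3, h4, h5⟩ := μ.κ_pos_of_P_ne_zero hs
        positivity) E.density_e₃ hδ

theorem Exponents.tendsto_mass₂ (hδ : 0 < δ) : Tendsto (fun N => ∑ s, (μ.pow N).P s *
    ind (¬ (E.typicalSets δ h₀ N).T₂ s.u2c s.x₂ s.u1c s.u2pb s.y₂)) atTop (𝓝 0) := by
  refine tendsto_mass_not_and (fun N => (μ.pow N).P_nonneg) ?_
    (tendsto_mass_not_and (fun N => (μ.pow N).P_nonneg) ?_
    (tendsto_mass_not_and (fun N => (μ.pow N).P_nonneg) ?_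
    (tendsto_mass_not_and (fun N => (μ.pow N).P_nonneg) ?_ ?_)))
  · exact μ.tendsto_mass_le_marg (f := fun s => s.y₂)
      (g := fun s => (s.y₂, s.u2c, s.x₂, s.u1c, s.u2pb))
      (fB := fun N s => s.y₂)
      (gB := fun N s => (s.y₂, s.u2c, s.x₂, s.u1c, s.u2pb))
      (k := fun s => μ.κ.c s.u2c * μ.κ.x s.u2c s.x₂ * μ.κ.a s.u2c s.u1c *
          μ.κ.d s.u2c s.x₂ s.u1c s.u2pb)
      (kB := fun N s => (μ.pow N).κ.c s.u2c * (μ.pow N).κ.x s.u2c s.x₂ * (μ.pow N).κ.a s.u2c s.u1c *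
          (μ.pow N).κ.d s.u2c s.x₂ s.u1c s.u2pb)
      (fun N z z' => by simp [allBlock, inputBlock, funext_iff])
      (fun N z z' => by simp [allBlock, inputBlock, funext_iff, forall_and])
      (fun N z => by simp only [Finset.prod_mul_distrib]; rfl)
      (fun s hs => by
        obtain ⟨h1, h2, h3, h4, h5⟩ := μ.κ_pos_of_P_ne_zero hs
        positivity) E.density_d₁ hδ
  · exact μ.tendsto_mass_le_marg (f := fun s => (s.u2c, s.y₂))
      (g := fun s => ((s.u2c, s.y₂), s.x₂, s.u1c, s.u2pb))
      (fB := fun N s => (s.u2c, s.y₂))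
      (gB := fun N s => ((s.u2c, s.y₂), s.x₂, s.u1c, s.u2pb))
      (k := fun s => μ.κ.x s.u2c s.x₂ * μ.κ.a s.u2c s.u1c * μ.κ.d s.u2c s.x₂ s.u1c s.u2pb)
      (kB := fun N s => (μ.pow N).κ.x s.u2c s.x₂ * (μ.pow N).κ.a s.u2c s.u1c *
          (μ.pow N).κ.d s.u2c s.x₂ s.u1c s.u2pb)
      (fun N z z' => by simp [allBlock, inputBlock, funext_iff, forall_and])
      (fun N z z' => by simp [allBlock, inputBlock, funext_iff, forall_and])
      (fun N z => by simp only [Finset.prod_mul_distrib]; rfl)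
      (fun s hs => by
        obtain ⟨h1, h2, h3, h4, h5⟩ := μ.κ_pos_of_P_ne_zero hs
        positivity) E.density_d₂ hδ
  · exact μ.tendsto_mass_le_marg (f := fun s => (s.u2c, s.u1c, s.y₂))
      (g := fun s => ((s.u2c, s.u1c, s.y₂), s.x₂, s.u2pb))
      (fB := fun N s => (s.u2c, s.u1c, s.y₂))
      (gB := fun N s => ((s.u2c, s.u1c, s.y₂), s.x₂, s.u2pb))
      (k := fun s => μ.κ.x s.u2c s.x₂ * μ.κ.d s.u2c s.x₂ s.u1c s.u2pb)
      (kB := fun N s => (μ.pow N).κ.x s.u2c s.x₂ * (μ.pow N).κ.d s.u2c s.x₂ s.u1c s.u2pb)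
      (fun N z z' => by simp [allBlock, inputBlock, funext_iff, forall_and])
      (fun N z z' => by simp [allBlock, inputBlock, funext_iff, forall_and])
      (fun N z => by simp only [Finset.prod_mul_distrib]; rfl)
      (fun s hs => by
        obtain ⟨h1, h2, h3, h4, h5⟩ := μ.κ_pos_of_P_ne_zero hs
        positivity) E.density_d₃ hδ
  · exact μ.tendsto_mass_le_marg (f := fun s => (s.u2c, s.x₂, s.y₂))
      (g := fun s => ((s.u2c, s.x₂, s.y₂), s.u1c, s.u2pb))
      (fB := fun N s => (s.u2c, s.x₂, s.y₂))
      (gB := fun N s => ((s.u2c, s.x₂, s.y₂), s.u1c, s.u2pb))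
      (k := fun s => μ.κ.a s.u2c s.u1c * μ.κ.d s.u2c s.x₂ s.u1c s.u2pb)
      (kB := fun N s => (μ.pow N).κ.a s.u2c s.u1c * (μ.pow N).κ.d s.u2c s.x₂ s.u1c s.u2pb)
      (fun N z z' => by simp [allBlock, inputBlock, funext_iff, forall_and])
      (fun N z z' => by simp [allBlock, inputBlock, funext_iff, forall_and])
      (fun N z => by simp only [Finset.prod_mul_distrib]; rfl)
      (fun s hs => by
        obtain ⟨h1, h2, h3, h4, h5⟩ := μ.κ_pos_of_P_ne_zero hs
        positivity) E.density_d₄ hδ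
  · exact μ.tendsto_mass_le_marg (f := fun s => (s.u2c, s.x₂, s.u1c, s.y₂))
      (g := fun s => ((s.u2c, s.x₂, s.u1c, s.y₂), s.u2pb))
      (fB := fun N s => (s.u2c, s.x₂, s.u1c, s.y₂))
      (gB := fun N s => ((s.u2c, s.x₂, s.u1c, s.y₂), s.u2pb))
      (k := fun s => μ.κ.d s.u2c s.x₂ s.u1c s.u2pb)
      (kB := fun N s => (μ.pow N).κ.d s.u2c s.x₂ s.u1c s.u2pb)
      (fun N z z' => by simp [allBlock, inputBlock, funext_iff, forall_and])
      (fun N z z' => by simp [allBlock, inputBlock, funext_iff, forall_and])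
      (fun N z => rfl)
      (fun s hs => by
        obtain ⟨h1, h2, h3, h4, h5⟩ := μ.κ_pos_of_P_ne_zero hs
        positivity) E.density_d₅ hδ

end Model

end block

/-! ### Mutual informations as mean information densities -/

theorem law_eq_marg {Ω T : Type*} [Fintype Ω] (P : PMF Ω) (f : Ω → T) (t : T) :
    law P f t = marg (fun ω => (P ω).toReal) f t := by
  classical
  rw [law, PMF.map_apply, tsum_fintype, ENNReal.toReal_sum fun ω _ => by
    split_ifs <;> simp [P.apply_ne_top]]
  refine Finset.sum_congr rfl fun ω _ => ?_
  by_cases h : f ω = t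
  · rw [if_pos h.symm, if_pos h]
  · rw [if_neg (Ne.symm h), if_neg h, ENNReal.toReal_zero]

theorem mutualInfo_eq_sum {Ω A B : Type*} [Fintype Ω] [Fintype A] [Fintype B] (P : PMF Ω)
    {w : Ω → ℝ} (hw : ∀ ω, (P ω).toReal = w ω) (f : Ω → A) (g : Ω → B) :
    mutualInfo P f g = ∑ ω, w ω * Real.logb 2 (marg w (fun ω => (f ω, g ω)) (f ω, g ω) /
      (marg w f (f ω) * marg w g (g ω))) := by
  obtain rfl : (fun ω => (P ω).toReal) = w := funext hw
  simp only [mutualInfo, law_eq_marg]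
  rw [sum_mul_comp_eq_sum_marg _ (fun ω => (f ω, g ω)) fun t =>
    Real.logb 2 (marg (fun ω => (P ω).toReal) (fun ω => (f ω, g ω)) t /
      (marg (fun ω => (P ω).toReal) f t.1 * marg (fun ω => (P ω).toReal) g t.2)),
    Fintype.sum_prod_type]

theorem condMutualInfo_eq_sum {Ω A B C : Type*} [Fintype Ω] [Fintype A] [Fintype B] [Fintype C]
    (P : PMF Ω) {w : Ω → ℝ} (hw : ∀ ω, (P ω).toReal = w ω) (f : Ω → A) (g : Ω → B) (h : Ω → C) :
    condMutualInfo P f g h = ∑ ω, w ω * Real.logb 2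
      (marg w (fun ω => (f ω, g ω, h ω)) (f ω, g ω, h ω) * marg w h (h ω) /
      (marg w (fun ω => (f ω, h ω)) (f ω, h ω) * marg w (fun ω => (g ω, h ω)) (g ω, h ω))) := by
  obtain rfl : (fun ω => (P ω).toReal) = w := funext hw
  simp only [condMutualInfo, law_eq_marg]
  rw [sum_mul_comp_eq_sum_marg _ (fun ω => (f ω, g ω, h ω)) fun t =>
    Real.logb 2 (marg (fun ω => (P ω).toReal) (fun ω => (f ω, g ω, h ω)) t *
      marg (fun ω => (P ω).toReal) h t.2.2 /
      (marg (fun ω => (P ω).toReal) (fun ω => (f ω, h ω)) (t.1, t.2.2) *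
        marg (fun ω => (P ω).toReal) (fun ω => (g ω, h ω)) t.2))]
  simp only [Fintype.sum_prod_type]

/-- The weight of an event. Marginals are compared in this form, in which the order of the variables
does not matter. -/
def prob {Ω : Type*} [Fintype Ω] (P : Ω → ℝ) (E : Ω → Prop) : ℝ := ∑ ω, P ω * ind (E ω)

theorem marg_eq_prob {Ω T : Type*} [Fintype Ω] (P : Ω → ℝ) (f : Ω → T) (t : T) :
    marg P f t = prob P fun ω => f ω = t := by
  unfold marg prob
  refine Finset.sum_congr rfl fun ω _ => ?_
  by_cases h : f ω = t
  · rw [if_pos h, ind_of_true h, mul_one]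
  · rw [if_neg h, ind_of_false h, mul_zero]

theorem prob_ne_zero {Ω : Type*} [Fintype Ω] {P : Ω → ℝ} (hP : ∀ ω, 0 ≤ P ω) {ω : Ω}
    (hω : P ω ≠ 0) (E : Ω → Prop) (h : E ω) : prob P E ≠ 0 := by
  refine ((lt_of_le_of_ne (hP ω) hω.symm).trans_le ?_).ne'
  have := Finset.single_le_sum (f := fun ω => P ω * ind (E ω))
    (fun ω _ => mul_nonneg (hP ω) (ind_nonneg _)) (Finset.mem_univ ω)
  rwa [ind_of_true h, mul_one] at this

open Classical in
/-- The conditional law of `f` given `g` under the weight `P`; it is uniform where `g` has weight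
`0`. -/
def condLaw {Ω S T : Type*} [Fintype Ω] [Fintype T] (P : Ω → ℝ) (g : Ω → S) (f : Ω → T) (s : S)
    (t : T) : ℝ :=
  if marg P g s = 0 then (Fintype.card T : ℝ)⁻¹ else marg P (fun ω => (g ω, f ω)) (s, t) / marg P g
      s

section condLaw

variable {Ω S T : Type*} [Fintype Ω] [Fintype T]

theorem sum_condLaw [Nonempty T] (P : Ω → ℝ) (g : Ω → S) (f : Ω → T) (s : S) :
    ∑ t, condLaw P g f s t = 1 := by
  unfold condLaw
  split_ifs with h
  · simp
  · rw [← Finset.sum_div, sum_marg_pair, div_self h]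

theorem condLaw_nonneg {P : Ω → ℝ} (hP : ∀ ω, 0 ≤ P ω) (g : Ω → S) (f : Ω → T)
    (s : S) (t : T) : 0 ≤ condLaw P g f s t := by
  unfold condLaw
  split_ifs
  · positivity
  · exact div_nonneg (marg_nonneg hP _ _) (marg_nonneg hP _ _)

theorem marg_pos {Ω S : Type*} [Fintype Ω] {P : Ω → ℝ} (hP : ∀ ω, 0 ≤ P ω) {ω : Ω}
    (hω : P ω ≠ 0) (g : Ω → S) : 0 < marg P g (g ω) :=
  (lt_of_le_of_ne (hP ω) hω.symm).trans_le (le_marg hP g ω)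

theorem condLaw_of_ne_zero {P : Ω → ℝ} (hP : ∀ ω, 0 ≤ P ω) (g : Ω → S) (f : Ω → T)
    {ω : Ω} (hω : P ω ≠ 0) : condLaw P g f (g ω) (f ω) =
    marg P (fun ω => (g ω, f ω)) (g ω, f ω) / marg P g (g ω) := by
  rw [condLaw, if_neg (marg_pos hP hω g).ne']

theorem condLaw_pos {P : Ω → ℝ} (hP : ∀ ω, 0 ≤ P ω) (g : Ω → S) (f : Ω → T)
    {ω : Ω} (hω : P ω ≠ 0) : 0 < condLaw P g f (g ω) (f ω) := by
  rw [condLaw_of_ne_zero hP g f hω]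
  exact div_pos (marg_pos hP hω fun ω => (g ω, f ω)) (marg_pos hP hω g)

theorem marg_le_mul_condLaw {P : Ω → ℝ} (hP : ∀ ω, 0 ≤ P ω) (g : Ω → S) (f : Ω → T)
    (s : S) (t : T) :
    marg P (fun ω => (g ω, f ω)) (s, t) ≤ marg P g s * condLaw P g f s t := by
  by_cases h : marg P g s = 0
  · rw [h, zero_mul, ← h, ← sum_marg_pair P g f s]
    exact Finset.single_le_sum (f := fun t => marg P (fun ω => (g ω, f ω)) (s, t))
      (fun t _ => marg_nonneg hP _ _) (Finset.mem_univ t)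
  · rw [condLaw, if_neg h, mul_div_cancel₀ _ h]

end condLaw

section singleLetter

variable {A C B D Z X Y₁ Y₂ : Type*}

/-! ### The single-letter model -/

/-- The joint law of the single-letter symbols, as a real-valued weight. -/
def jointWeight (q : PMF (InputSymbols A C B D Z X)) (W : Z → X → PMF (Y₁ × Y₂))
    (s : AllSymbols A C B D Z X Y₁ Y₂) : ℝ :=
  (q s.toInputSymbols).toReal * (W s.x₁ s.x₂ (s.y₁, s.y₂)).toReal

theorem jointWeight_nonneg (q : PMF (InputSymbols A C B D Z X)) (W : Z → X → PMF (Y₁ × Y₂))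
    (s : AllSymbols A C B D Z X Y₁ Y₂) : 0 ≤ jointWeight q W s :=
  mul_nonneg ENNReal.toReal_nonneg ENNReal.toReal_nonneg

variable [Fintype A] [Fintype C] [Fintype B] [Fintype D] [Fintype Z] [Fintype X] [Fintype Y₁]
  [Fintype Y₂] (q : PMF (InputSymbols A C B D Z X)) (W : Z → X → PMF (Y₁ × Y₂))

theorem jointLaw_toReal (s : AllSymbols A C B D Z X Y₁ Y₂) :
    (jointLaw q W s).toReal = jointWeight q W s := by
  classical
  rw [jointLaw, PMF.bind_apply, tsum_fintype, Finset.sum_eq_single s.toInputSymbols, jointWeight,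
    ENNReal.toReal_mul, PMF.map_apply, tsum_fintype, Finset.sum_eq_single (s.y₁, s.y₂), if_pos rfl]
  · rintro y - hy
    refine if_neg fun h => hy ?_
    rw [h]
  · simp
  · intro t _ ht
    rw [PMF.map_apply, tsum_fintype, Finset.sum_eq_zero, mul_zero]
    rintro y -
    refine if_neg fun h => ht ?_
    rw [h]
  · simp

theorem sum_toReal_eq_one {S : Type*} [Fintype S] (P : PMF S) : ∑ s, (P s).toReal = 1 := by
  have h := P.tsum_coe
  rw [tsum_fintype] at h
  rw [← ENNReal.toReal_sum fun s _ => P.apply_ne_top s, h, ENNReal.toReal_one]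


/-- The generating laws of the codewords: each layer has its conditional law given the layers on
which it is superposed. -/
def singleLayerLaw : LayerLaw C X A B D :=
  have : Nonempty (InputSymbols A C B D Z X) := ⟨q.support_nonempty.some⟩
  have : Nonempty A := this.map fun s => s.u1c
  have : Nonempty B := ‹Nonempty (InputSymbols A C B D Z X)›.map fun s => s.u1pb
  have : Nonempty D := ‹Nonempty (InputSymbols A C B D Z X)›.map fun s => s.u2pb
  have : Nonempty X := ‹Nonempty (InputSymbols A C B D Z X)›.map fun s => s.x₂
  { c := marg (jointWeight q W) fun s => s.u2c
    x := condLaw (jointWeight q W) (fun s => s.u2c) fun s => s.x₂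
    a := condLaw (jointWeight q W) (fun s => s.u2c) fun s => s.u1c
    b := fun c a => condLaw (jointWeight q W) (fun s => (s.u2c, s.u1c)) (fun s => s.u1pb) (c, a)
    d := fun c x a =>
      condLaw (jointWeight q W) (fun s => (s.u2c, s.x₂, s.u1c)) (fun s => s.u2pb) (c, x, a)
    c_nonneg := marg_nonneg (jointWeight_nonneg q W) _
    x_nonneg := condLaw_nonneg (jointWeight_nonneg q W) _ _
    a_nonneg := condLaw_nonneg (jointWeight_nonneg q W) _ _
    b_nonneg := fun _ _ => condLaw_nonneg (jointWeight_nonneg q W) _ _ _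
    d_nonneg := fun _ _ _ => condLaw_nonneg (jointWeight_nonneg q W) _ _ _
    sum_c := by
      rw [sum_marg]
      simp only [← jointLaw_toReal]
      exact sum_toReal_eq_one _
    sum_x := sum_condLaw _ _ _
    sum_a := sum_condLaw _ _ _
    sum_b := fun _ _ => sum_condLaw _ _ _ _
    sum_d := fun _ _ _ => sum_condLaw _ _ _ _ }

theorem singleLayerLaw_word_pos {s : AllSymbols A C B D Z X Y₁ Y₂} (hs : jointWeight q W s ≠ 0) :
    0 < (singleLayerLaw q W).word s.u2c s.x₂ s.u1c s.u1pb s.u2pb := by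
  have h0 := jointWeight_nonneg q W
  exact mul_pos (mul_pos (mul_pos (mul_pos (marg_pos h0 hs fun s => s.u2c)
    (condLaw_pos h0 (fun s => s.u2c) (fun s => s.x₂) hs))
    (condLaw_pos h0 (fun s => s.u2c) (fun s => s.u1c) hs))
    (condLaw_pos h0 (fun s => (s.u2c, s.u1c)) (fun s => s.u1pb) hs))
    (condLaw_pos h0 (fun s => (s.u2c, s.x₂, s.u1c)) (fun s => s.u2pb) hs)

/-- The single-letter model of the input distribution `q` and the channel `W`. -/
def singleModel : Model A C B D Z X Y₁ Y₂ where
  κ := singleLayerLaw q W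
  p s := (q s).toReal
  W z x y₁ y₂ := (W z x (y₁, y₂)).toReal
  p_nonneg _ := ENNReal.toReal_nonneg
  sum_p := sum_toReal_eq_one q
  W_nonneg _ _ _ _ := ENNReal.toReal_nonneg
  sum_W z x := by
    rw [← Fintype.sum_prod_type fun y => (W z x y).toReal]
    exact sum_toReal_eq_one _
  dominated s hs := by
    -- some output has positive probability, so the auxiliary symbols occur in the joint law
    by_contra hq
    obtain ⟨y, hy⟩ := (W s.x₁ s.x₂).support_nonempty
    have hP : jointWeight q W ⟨s, y.1, y.2⟩ ≠ 0 :=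
      mul_ne_zero hq (ENNReal.toReal_ne_zero.2 ⟨hy, (W s.x₁ s.x₂).apply_ne_top y⟩)
    exact (singleLayerLaw_word_pos q W hP).ne' hs

theorem singleModel_marg_le (c : C) (x : X) :
    marg (singleModel q W).P (fun s => (s.u2c, s.x₂)) (c, x) ≤
      (singleModel q W).κ.c c * (singleModel q W).κ.x c x :=
  marg_le_mul_condLaw (jointWeight_nonneg q W) (fun s => s.u2c) (fun s => s.x₂) c x

/-! ### Information densities of the single-letter model -/

theorem singleModel_c (s : AllSymbols A C B D Z X Y₁ Y₂) : (singleModel q W).κ.c s.u2c =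
    prob (jointWeight q W) fun ω => ω.u2c = s.u2c :=
  marg_eq_prob _ _ _

variable {q W}

theorem singleModel_x {s : AllSymbols A C B D Z X Y₁ Y₂} (hs : jointWeight q W s ≠ 0) :
    (singleModel q W).κ.x s.u2c s.x₂ =
      prob (jointWeight q W) (fun ω => (ω.u2c, ω.x₂) = (s.u2c, s.x₂)) /
        prob (jointWeight q W) fun ω => ω.u2c = s.u2c := by
  rw [← marg_eq_prob, ← marg_eq_prob]
  exact condLaw_of_ne_zero (jointWeight_nonneg q W) (fun s => s.u2c) (fun s => s.x₂) hs

theorem singleModel_a {s : AllSymbols A C B D Z X Y₁ Y₂} (hs : jointWeight q W s ≠ 0) :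
    (singleModel q W).κ.a s.u2c s.u1c =
      prob (jointWeight q W) (fun ω => (ω.u2c, ω.u1c) = (s.u2c, s.u1c)) /
        prob (jointWeight q W) fun ω => ω.u2c = s.u2c := by
  rw [← marg_eq_prob, ← marg_eq_prob]
  exact condLaw_of_ne_zero (jointWeight_nonneg q W) (fun s => s.u2c) (fun s => s.u1c) hs

theorem singleModel_b {s : AllSymbols A C B D Z X Y₁ Y₂} (hs : jointWeight q W s ≠ 0) :
    (singleModel q W).κ.b s.u2c s.u1c s.u1pb =
      prob (jointWeight q W) (fun ω => ((ω.u2c, ω.u1c), ω.u1pb) = ((s.u2c, s.u1c), s.u1pb)) /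
        prob (jointWeight q W) fun ω => (ω.u2c, ω.u1c) = (s.u2c, s.u1c) := by
  rw [← marg_eq_prob, ← marg_eq_prob]
  exact condLaw_of_ne_zero (jointWeight_nonneg q W) (fun s => (s.u2c, s.u1c)) (fun s => s.u1pb) hs

theorem singleModel_d {s : AllSymbols A C B D Z X Y₁ Y₂} (hs : jointWeight q W s ≠ 0) :
    (singleModel q W).κ.d s.u2c s.x₂ s.u1c s.u2pb =
      prob (jointWeight q W)
          (fun ω => ((ω.u2c, ω.x₂, ω.u1c), ω.u2pb) = ((s.u2c, s.x₂, s.u1c), s.u2pb)) /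
        prob (jointWeight q W) fun ω => (ω.u2c, ω.x₂, ω.u1c) = (s.u2c, s.x₂, s.u1c) := by
  rw [← marg_eq_prob, ← marg_eq_prob]
  exact condLaw_of_ne_zero (jointWeight_nonneg q W) (fun s => (s.u2c, s.x₂, s.u1c))
    (fun s => s.u2pb) hs

variable (q W)

/-- A mean information density, computed at the symbols of positive probability, where all the
probabilities involved are nonzero. -/
theorem density_eq_sum {num den F : AllSymbols A C B D Z X Y₁ Y₂ → ℝ}
    (h : ∀ s, jointWeight q W s ≠ 0 → (∀ E : AllSymbols A C B D Z X Y₁ Y₂ → Prop, E s →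
      prob (jointWeight q W) E ≠ 0) → Real.logb 2 (num s / den s) = F s) :
    density (singleModel q W).P num den = ∑ s, jointWeight q W s * F s := by
  refine Finset.sum_congr rfl fun s _ => ?_
  change jointWeight q W s * _ = _
  by_cases hs : jointWeight q W s = 0
  · rw [hs, zero_mul, zero_mul]
  · rw [h s hs fun E hE => prob_ne_zero (jointWeight_nonneg q W) hs E hE]

/-- The covering densities are stated with the generating laws in the numerator, which gives the
negative of the mutual information. -/
theorem density_k₁ : density (singleModel q W).P
    (fun s => (singleModel q W).κ.c s.u2c * (singleModel q W).κ.x s.u2c s.x₂ *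
        (singleModel q W).κ.a s.u2c s.u1c)
    (fun s => marg (singleModel q W).P (fun s => (s.u2c, s.x₂, s.u1c)) (s.u2c, s.x₂, s.u1c)) =
    -(condMutualInfo (jointLaw q W) (fun s => s.u1c) (fun s => s.x₂) (fun s => s.u2c)) := by
  simp only [condMutualInfo_eq_sum _ (jointLaw_toReal q W), ← Finset.sum_neg_distrib, ← mul_neg]
  refine density_eq_sum q W fun s hs pos => ?_
  simp only [show (singleModel q W).P = jointWeight q W from rfl, singleModel_c, singleModel_x hs,
      singleModel_a hs, marg_eq_prob, Prod.mk.injEq, and_comm, and_left_comm]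
  simp only [Real.logb_mul, Real.logb_div, pos, ne_eq, mul_eq_zero, div_eq_zero_iff,
      not_false_eq_true, or_self, and_self]
  ring

theorem density_k₁' : density (singleModel q W).P
    (fun s => (singleModel q W).κ.c s.u2c * (singleModel q W).κ.x s.u2c s.x₂ *
        (singleModel q W).κ.a s.u2c s.u1c * (singleModel q W).κ.d s.u2c s.x₂ s.u1c s.u2pb)
    (fun s => marg (singleModel q W).P (fun s => (s.u2c, s.x₂, s.u1c, s.u2pb)) (s.u2c, s.x₂, s.u1c,
        s.u2pb)) =
    -(condMutualInfo (jointLaw q W) (fun s => s.u1c) (fun s => s.x₂) (fun s => s.u2c)) := by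
  simp only [condMutualInfo_eq_sum _ (jointLaw_toReal q W), ← Finset.sum_neg_distrib, ← mul_neg]
  refine density_eq_sum q W fun s hs pos => ?_
  simp only [show (singleModel q W).P = jointWeight q W from rfl, singleModel_c, singleModel_x hs,
      singleModel_a hs, singleModel_d hs, marg_eq_prob, Prod.mk.injEq, and_comm, and_left_comm,
      and_assoc]
  simp only [Real.logb_mul, Real.logb_div, pos, ne_eq, mul_eq_zero, div_eq_zero_iff,
      not_false_eq_true, or_self, and_self]
  ring

theorem density_k₂ : density (singleModel q W).P
    (fun s => (singleModel q W).κ.c s.u2c * (singleModel q W).κ.x s.u2c s.x₂ *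
        (singleModel q W).κ.a s.u2c s.u1c * (singleModel q W).κ.b s.u2c s.u1c s.u1pb)
    (fun s => marg (singleModel q W).P (fun s => (s.u2c, s.x₂, s.u1c, s.u1pb)) (s.u2c, s.x₂, s.u1c,
        s.u1pb)) =
    -(condMutualInfo (jointLaw q W) (fun s => (s.u1pb, s.u1c)) (fun s => s.x₂) (fun s => s.u2c)) :=
        by
  simp only [condMutualInfo_eq_sum _ (jointLaw_toReal q W), ← Finset.sum_neg_distrib, ← mul_neg]
  refine density_eq_sum q W fun s hs pos => ?_
  simp only [show (singleModel q W).P = jointWeight q W from rfl, singleModel_c, singleModel_x hs,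
      singleModel_a hs, singleModel_b hs, marg_eq_prob, Prod.mk.injEq, and_comm, and_left_comm,
      and_assoc]
  simp only [Real.logb_mul, Real.logb_div, pos, ne_eq, mul_eq_zero, div_eq_zero_iff,
      not_false_eq_true, or_self, and_self]
  ring

theorem density_k₃ : density (singleModel q W).P
    (fun s => (singleModel q W).κ.c s.u2c * (singleModel q W).κ.x s.u2c s.x₂ *
        (singleModel q W).κ.a s.u2c s.u1c * (singleModel q W).κ.b s.u2c s.u1c s.u1pb *
        (singleModel q W).κ.d s.u2c s.x₂ s.u1c s.u2pb)
    (fun s => marg (singleModel q W).P (fun s => (s.u2c, s.x₂, s.u1c, s.u1pb, s.u2pb)) (s.u2c, s.x₂,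
        s.u1c, s.u1pb, s.u2pb)) =
    -(condMutualInfo (jointLaw q W) (fun s => (s.u1pb, s.u1c)) (fun s => s.x₂) (fun s => s.u2c) +
      condMutualInfo (jointLaw q W) (fun s => s.u2pb) (fun s => s.u1pb) (fun s =>
          (s.u1c, s.u2c, s.x₂))) := by
  simp only [condMutualInfo_eq_sum _ (jointLaw_toReal q W), ← Finset.sum_add_distrib, ← mul_add,
      ← Finset.sum_neg_distrib, ← mul_neg]
  refine density_eq_sum q W fun s hs pos => ?_
  simp only [show (singleModel q W).P = jointWeight q W from rfl, singleModel_c, singleModel_x hs,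
      singleModel_a hs, singleModel_b hs, singleModel_d hs, marg_eq_prob, Prod.mk.injEq, and_comm,
      and_left_comm, and_assoc]
  simp only [Real.logb_mul, Real.logb_div, pos, ne_eq, mul_eq_zero, div_eq_zero_iff,
      not_false_eq_true, or_self, and_self]
  ring

theorem density_e₁ : density (singleModel q W).P
    (fun s => marg (singleModel q W).P (fun s => (s.y₁, s.u2c, s.u1c, s.u1pb)) (s.y₁, s.u2c, s.u1c,
        s.u1pb))
    (fun s => marg (singleModel q W).P (fun s => s.y₁) s.y₁ * ((singleModel q W).κ.c s.u2c *
        (singleModel q W).κ.a s.u2c s.u1c * (singleModel q W).κ.b s.u2c s.u1c s.u1pb)) =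
    mutualInfo (jointLaw q W) (fun s => s.y₁) (fun s => (s.u1pb, s.u1c, s.u2c)) := by
  simp only [mutualInfo_eq_sum _ (jointLaw_toReal q W)]
  refine density_eq_sum q W fun s hs pos => ?_
  simp only [show (singleModel q W).P = jointWeight q W from rfl, singleModel_c, singleModel_a hs,
      singleModel_b hs, marg_eq_prob, Prod.mk.injEq, and_comm, and_left_comm, and_assoc]
  simp only [Real.logb_mul, Real.logb_div, pos, ne_eq, mul_eq_zero, div_eq_zero_iff,
      not_false_eq_true, or_self, and_self]
  ring

theorem density_e₂ : density (singleModel q W).P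
    (fun s => marg (singleModel q W).P (fun s => ((s.u2c, s.y₁), s.u1c, s.u1pb)) ((s.u2c, s.y₁),
        s.u1c, s.u1pb))
    (fun s => marg (singleModel q W).P (fun s => (s.u2c, s.y₁)) (s.u2c, s.y₁) *
        ((singleModel q W).κ.a s.u2c s.u1c * (singleModel q W).κ.b s.u2c s.u1c s.u1pb)) =
    condMutualInfo (jointLaw q W) (fun s => s.y₁) (fun s => (s.u1pb, s.u1c)) (fun s => s.u2c) := by
  simp only [condMutualInfo_eq_sum _ (jointLaw_toReal q W)]
  refine density_eq_sum q W fun s hs pos => ?_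
  simp only [show (singleModel q W).P = jointWeight q W from rfl, singleModel_a hs,
      singleModel_b hs, marg_eq_prob, Prod.mk.injEq, and_comm, and_left_comm, and_assoc]
  simp only [Real.logb_mul, Real.logb_div, pos, ne_eq, mul_eq_zero, div_eq_zero_iff,
      not_false_eq_true, or_self, and_self]
  ring

theorem density_e₃ : density (singleModel q W).P
    (fun s => marg (singleModel q W).P (fun s => ((s.u2c, s.u1c, s.y₁), s.u1pb))
        ((s.u2c, s.u1c, s.y₁), s.u1pb))
    (fun s => marg (singleModel q W).P (fun s => (s.u2c, s.u1c, s.y₁)) (s.u2c, s.u1c, s.y₁) *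
        ((singleModel q W).κ.b s.u2c s.u1c s.u1pb)) =
    condMutualInfo (jointLaw q W) (fun s => s.y₁) (fun s => s.u1pb) (fun s => (s.u1c, s.u2c)) := by
  simp only [condMutualInfo_eq_sum _ (jointLaw_toReal q W)]
  refine density_eq_sum q W fun s hs pos => ?_
  simp only [show (singleModel q W).P = jointWeight q W from rfl, singleModel_b hs, marg_eq_prob,
      Prod.mk.injEq, and_comm, and_left_comm, and_assoc]
  simp only [Real.logb_mul, Real.logb_div, pos, ne_eq, mul_eq_zero, div_eq_zero_iff,
      not_false_eq_true, or_self, and_self]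
  ring

theorem density_d₁ : density (singleModel q W).P
    (fun s => marg (singleModel q W).P (fun s => (s.y₂, s.u2c, s.x₂, s.u1c, s.u2pb)) (s.y₂, s.u2c,
        s.x₂, s.u1c, s.u2pb))
    (fun s => marg (singleModel q W).P (fun s => s.y₂) s.y₂ * ((singleModel q W).κ.c s.u2c *
        (singleModel q W).κ.x s.u2c s.x₂ * (singleModel q W).κ.a s.u2c s.u1c *
        (singleModel q W).κ.d s.u2c s.x₂ s.u1c s.u2pb)) =
    mutualInfo (jointLaw q W) (fun s => s.y₂) (fun s => (s.u2pb, s.u1c, s.x₂, s.u2c)) +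
      condMutualInfo (jointLaw q W) (fun s => s.u1c) (fun s => s.x₂) (fun s => s.u2c) := by
  simp only [mutualInfo_eq_sum _ (jointLaw_toReal q W),
      condMutualInfo_eq_sum _ (jointLaw_toReal q W), ← Finset.sum_add_distrib, ← mul_add]
  refine density_eq_sum q W fun s hs pos => ?_
  simp only [show (singleModel q W).P = jointWeight q W from rfl, singleModel_c, singleModel_x hs,
      singleModel_a hs, singleModel_d hs, marg_eq_prob, Prod.mk.injEq, and_comm, and_left_comm,
      and_assoc]
  simp only [Real.logb_mul, Real.logb_div, pos, ne_eq, mul_eq_zero, div_eq_zero_iff,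
      not_false_eq_true, or_self, and_self]
  ring

theorem density_d₂ : density (singleModel q W).P
    (fun s => marg (singleModel q W).P (fun s => ((s.u2c, s.y₂), s.x₂, s.u1c, s.u2pb))
        ((s.u2c, s.y₂), s.x₂, s.u1c, s.u2pb))
    (fun s => marg (singleModel q W).P (fun s => (s.u2c, s.y₂)) (s.u2c, s.y₂) *
        ((singleModel q W).κ.x s.u2c s.x₂ * (singleModel q W).κ.a s.u2c s.u1c *
        (singleModel q W).κ.d s.u2c s.x₂ s.u1c s.u2pb)) =
    condMutualInfo (jointLaw q W) (fun s => s.y₂) (fun s => (s.u2pb, s.u1c, s.x₂)) (fun s =>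
        s.u2c) +
      condMutualInfo (jointLaw q W) (fun s => s.u1c) (fun s => s.x₂) (fun s => s.u2c) := by
  simp only [condMutualInfo_eq_sum _ (jointLaw_toReal q W), ← Finset.sum_add_distrib, ← mul_add]
  refine density_eq_sum q W fun s hs pos => ?_
  simp only [show (singleModel q W).P = jointWeight q W from rfl, singleModel_x hs,
      singleModel_a hs, singleModel_d hs, marg_eq_prob, Prod.mk.injEq, and_comm, and_left_comm,
      and_assoc]
  simp only [Real.logb_mul, Real.logb_div, pos, ne_eq, mul_eq_zero, div_eq_zero_iff,
      not_false_eq_true, or_self, and_self]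
  ring

theorem density_d₃ : density (singleModel q W).P
    (fun s => marg (singleModel q W).P (fun s => ((s.u2c, s.u1c, s.y₂), s.x₂, s.u2pb))
        ((s.u2c, s.u1c, s.y₂), s.x₂, s.u2pb))
    (fun s => marg (singleModel q W).P (fun s => (s.u2c, s.u1c, s.y₂)) (s.u2c, s.u1c, s.y₂) *
        ((singleModel q W).κ.x s.u2c s.x₂ * (singleModel q W).κ.d s.u2c s.x₂ s.u1c s.u2pb)) =
    condMutualInfo (jointLaw q W) (fun s => s.y₂) (fun s => (s.u2pb, s.x₂)) (fun s =>
        (s.u1c, s.u2c)) +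
      condMutualInfo (jointLaw q W) (fun s => s.u1c) (fun s => s.x₂) (fun s => s.u2c) := by
  simp only [condMutualInfo_eq_sum _ (jointLaw_toReal q W), ← Finset.sum_add_distrib, ← mul_add]
  refine density_eq_sum q W fun s hs pos => ?_
  simp only [show (singleModel q W).P = jointWeight q W from rfl, singleModel_x hs,
      singleModel_d hs, marg_eq_prob, Prod.mk.injEq, and_comm, and_left_comm, and_assoc]
  simp only [Real.logb_mul, Real.logb_div, pos, ne_eq, mul_eq_zero, div_eq_zero_iff,
      not_false_eq_true, or_self, and_self]
  ring

theorem density_d₄ : density (singleModel q W).P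
    (fun s => marg (singleModel q W).P (fun s => ((s.u2c, s.x₂, s.y₂), s.u1c, s.u2pb))
        ((s.u2c, s.x₂, s.y₂), s.u1c, s.u2pb))
    (fun s => marg (singleModel q W).P (fun s => (s.u2c, s.x₂, s.y₂)) (s.u2c, s.x₂, s.y₂) *
        ((singleModel q W).κ.a s.u2c s.u1c * (singleModel q W).κ.d s.u2c s.x₂ s.u1c s.u2pb)) =
    condMutualInfo (jointLaw q W) (fun s => s.y₂) (fun s => (s.u2pb, s.u1c)) (fun s =>
        (s.x₂, s.u2c)) +
      condMutualInfo (jointLaw q W) (fun s => s.u1c) (fun s => s.x₂) (fun s => s.u2c) := by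
  simp only [condMutualInfo_eq_sum _ (jointLaw_toReal q W), ← Finset.sum_add_distrib, ← mul_add]
  refine density_eq_sum q W fun s hs pos => ?_
  simp only [show (singleModel q W).P = jointWeight q W from rfl, singleModel_a hs,
      singleModel_d hs, marg_eq_prob, Prod.mk.injEq, and_comm, and_left_comm, and_assoc]
  simp only [Real.logb_mul, Real.logb_div, pos, ne_eq, mul_eq_zero, div_eq_zero_iff,
      not_false_eq_true, or_self, and_self]
  ring

theorem density_d₅ : density (singleModel q W).P
    (fun s => marg (singleModel q W).P (fun s => ((s.u2c, s.x₂, s.u1c, s.y₂), s.u2pb))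
        ((s.u2c, s.x₂, s.u1c, s.y₂), s.u2pb))
    (fun s => marg (singleModel q W).P (fun s => (s.u2c, s.x₂, s.u1c, s.y₂)) (s.u2c, s.x₂, s.u1c,
        s.y₂) * ((singleModel q W).κ.d s.u2c s.x₂ s.u1c s.u2pb)) =
    condMutualInfo (jointLaw q W) (fun s => s.y₂) (fun s => s.u2pb) (fun s =>
        (s.u1c, s.x₂, s.u2c)) := by
  simp only [condMutualInfo_eq_sum _ (jointLaw_toReal q W)]
  refine density_eq_sum q W fun s hs pos => ?_
  simp only [show (singleModel q W).P = jointWeight q W from rfl, singleModel_d hs, marg_eq_prob,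
      Prod.mk.injEq, and_comm, and_left_comm, and_assoc]
  simp only [Real.logb_mul, Real.logb_div, pos, ne_eq, mul_eq_zero, div_eq_zero_iff,
      not_false_eq_true, or_self, and_self]
  ring

/-- The exponents of the single-letter model are the mutual informations of the theorem. -/
def singleExponents : (singleModel q W).Exponents where
  i₁ := condMutualInfo (jointLaw q W) (fun s => s.u1c) (fun s => s.x₂) (fun s => s.u2c)
  i₂ := condMutualInfo (jointLaw q W) (fun s => (s.u1pb, s.u1c)) (fun s => s.x₂) (fun s => s.u2c)
  i₃ := condMutualInfo (jointLaw q W) (fun s => (s.u1pb, s.u1c)) (fun s => s.x₂) (fun s => s.u2c) +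
    condMutualInfo (jointLaw q W) (fun s => s.u2pb) (fun s => s.u1pb) (fun s =>
        (s.u1c, s.u2c, s.x₂))
  e₁ := mutualInfo (jointLaw q W) (fun s => s.y₁) (fun s => (s.u1pb, s.u1c, s.u2c))
  e₂ := condMutualInfo (jointLaw q W) (fun s => s.y₁) (fun s => (s.u1pb, s.u1c)) (fun s => s.u2c)
  e₃ := condMutualInfo (jointLaw q W) (fun s => s.y₁) (fun s => s.u1pb) (fun s => (s.u1c, s.u2c))
  d₁ := mutualInfo (jointLaw q W) (fun s => s.y₂) (fun s => (s.u2pb, s.u1c, s.x₂, s.u2c)) +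
    condMutualInfo (jointLaw q W) (fun s => s.u1c) (fun s => s.x₂) (fun s => s.u2c)
  d₂ := condMutualInfo (jointLaw q W) (fun s => s.y₂) (fun s => (s.u2pb, s.u1c, s.x₂)) (fun s =>
      s.u2c) +
    condMutualInfo (jointLaw q W) (fun s => s.u1c) (fun s => s.x₂) (fun s => s.u2c)
  d₃ := condMutualInfo (jointLaw q W) (fun s => s.y₂) (fun s => (s.u2pb, s.x₂)) (fun s =>
      (s.u1c, s.u2c)) +
    condMutualInfo (jointLaw q W) (fun s => s.u1c) (fun s => s.x₂) (fun s => s.u2c)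
  d₄ := condMutualInfo (jointLaw q W) (fun s => s.y₂) (fun s => (s.u2pb, s.u1c)) (fun s =>
      (s.x₂, s.u2c)) +
    condMutualInfo (jointLaw q W) (fun s => s.u1c) (fun s => s.x₂) (fun s => s.u2c)
  d₅ := condMutualInfo (jointLaw q W) (fun s => s.y₂) (fun s => s.u2pb) (fun s =>
      (s.u1c, s.x₂, s.u2c))
  density_k₁ := density_k₁ q W
  density_k₁' := density_k₁' q W
  density_k₂ := density_k₂ q W
  density_k₃ := density_k₃ q W
  density_e₁ := density_e₁ q W
  density_e₂ := density_e₂ q W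
  density_e₃ := density_e₃ q W
  density_d₁ := density_d₁ q W
  density_d₂ := density_d₂ q W
  density_d₃ := density_d₃ q W
  density_d₄ := density_d₄ q W
  density_d₅ := density_d₅ q W

end singleLetter

/-! ### Numbers of messages -/

theorem one_le_two_rpow_mul {R : ℝ} (hR : 0 ≤ R) (N : ℕ) : (1 : ℝ) ≤ 2 ^ ((N : ℝ) * R) :=
  Real.one_le_rpow one_le_two (mul_nonneg N.cast_nonneg hR)

theorem two_rpow_le_numMessages (R : ℝ) (N : ℕ) : (2 : ℝ) ^ ((N : ℝ) * R) ≤ numMessages R N :=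
  Nat.le_ceil _

theorem numMessages_le {R : ℝ} (hR : 0 ≤ R) (N : ℕ) :
    (numMessages R N : ℝ) ≤ 2 ^ 1 * 2 ^ ((N : ℝ) * R) := by
  have h := (Nat.ceil_lt_add_one (zero_le_one.trans (one_le_two_rpow_mul hR N))).le
  have := one_le_two_rpow_mul hR N
  unfold numMessages
  linarith

theorem numMessages_pos (R : ℝ) (N : ℕ) : 0 < numMessages R N :=
  Nat.ceil_pos.2 (Real.rpow_pos_of_pos two_pos _)

instance nonempty_fin_numMessages (R : ℝ) (N : ℕ) : Nonempty (Fin (numMessages R N)) :=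
  Fin.pos_iff_nonempty.1 (numMessages_pos R N)

theorem numMessages_add_le (R S : ℝ) (N : ℕ) :
    numMessages (R + S) N ≤ numMessages R N * numMessages S N := by
  refine Nat.ceil_le.2 ?_
  rw [mul_add, Real.rpow_add two_pos]
  push_cast
  exact mul_le_mul (two_rpow_le_numMessages R N) (two_rpow_le_numMessages S N)
    (Real.rpow_pos_of_pos two_pos _).le (Nat.cast_nonneg _)

/-- A rate with several messages is positive: at rate `0` there is a single message. -/
theorem pos_of_nontrivial {R : ℝ} (hR : 0 ≤ R) {N : ℕ} (h : Nontrivial (Fin (numMessages R N))) :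
    0 < R := by
  refine lt_of_le_of_ne hR fun h0 => ?_
  rw [Fin.nontrivial_iff_two_le, ← h0] at h
  simp [numMessages] at h

theorem mul_le_two_pow_mul {m n s t : ℝ} {a b N : ℕ} (hn0 : 0 ≤ n)
    (hm : m ≤ 2 ^ a * 2 ^ ((N : ℝ) * s)) (hn : n ≤ 2 ^ b * 2 ^ ((N : ℝ) * t)) :
    m * n ≤ 2 ^ (a + b) * 2 ^ ((N : ℝ) * (s + t)) := by
  rw [mul_add, Real.rpow_add two_pos, pow_add, mul_mul_mul_comm]
  exact mul_le_mul hm hn hn0 (by positivity)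

theorem inv_two_rpow_mul_le {m s e δ : ℝ} {a N : ℕ} (ha : a ≤ 6)
    (hm : m ≤ 2 ^ a * 2 ^ ((N : ℝ) * s)) (h : s + 2 * δ ≤ e) :
    ((2 : ℝ) ^ ((N : ℝ) * (e - δ)))⁻¹ * m ≤ 64 * 2 ^ (-((N : ℝ) * δ)) := by
  have h1 : (2 : ℝ) ^ a ≤ 2 ^ 6 := pow_le_pow_right₀ one_le_two ha
  calc _ ≤ (2 : ℝ) ^ (-((N : ℝ) * (e - δ))) * (2 ^ 6 * 2 ^ ((N : ℝ) * s)) := by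
        rw [Real.rpow_neg zero_le_two]
        refine mul_le_mul_of_nonneg_left (hm.trans ?_) (by positivity)
        exact mul_le_mul_of_nonneg_right h1 (by positivity)
    _ = 64 * 2 ^ (-((N : ℝ) * (e - δ)) + (N : ℝ) * s) := by
        rw [Real.rpow_add two_pos]
        ring
    _ ≤ _ := by
        refine mul_le_mul_of_nonneg_left (Real.rpow_le_rpow_of_exponent_le one_le_two ?_)
          (by norm_num)
        have := mul_le_mul_of_nonneg_left h (Nat.cast_nonneg (α := ℝ) N)
        linarith

theorem two_rpow_le_mul {m s i δ : ℝ} {N : ℕ} (hm : 2 ^ ((N : ℝ) * s) ≤ m)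
    (h : i + 2 * δ ≤ s) : (2 : ℝ) ^ ((N : ℝ) * (i + δ)) ≤ 64 * 2 ^ (-((N : ℝ) * δ)) * m := by
  calc _ ≤ (2 : ℝ) ^ (-((N : ℝ) * δ) + (N : ℝ) * s) := by
        refine Real.rpow_le_rpow_of_exponent_le one_le_two ?_
        have := mul_le_mul_of_nonneg_left h (Nat.cast_nonneg (α := ℝ) N)
        linarith
    _ = 1 * 2 ^ (-((N : ℝ) * δ)) * 2 ^ ((N : ℝ) * s) := by rw [Real.rpow_add two_pos, one_mul]
    _ ≤ _ := by gcongr; norm_num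

/-! ### Achievable rates -/

section coding

variable {A C B D Z X Y₁ Y₂ : Type*} [Fintype A] [Fintype C] [Fintype B] [Fintype D]
  [Fintype Z] [Fintype X] [Fintype Y₁] [Fintype Y₂] {μ : Model A C B D Z X Y₁ Y₂}

/-- The rates satisfy the binning and decoding constraints given by the exponents, with slack `δ`.
A decoding constraint is required only if it protects a message of positive rate. -/
structure Model.Exponents.Admits (E : μ.Exponents) (r : RateTuple) (δ : ℝ) : Prop where
  bin₁ : E.i₁ + δ ≤ r.R1cb
  bin₂ : E.i₂ + δ ≤ r.R1cb + r.R1pbb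
  bin₃ : E.i₃ + δ ≤ r.R1cb + r.R1pbb + r.R2pbb
  d₁ : 0 < r.R2c →
    r.R2c + r.R2pa + (r.R1c + r.R1cb) + (r.R2pb + r.R2pbb) + δ ≤ E.d₁
  d₂ : 0 < r.R2pa → r.R2pa + (r.R1c + r.R1cb) + (r.R2pb + r.R2pbb) + δ ≤ E.d₂
  d₃ : 0 < r.R2pa → r.R2pa + (r.R2pb + r.R2pbb) + δ ≤ E.d₃
  d₄ : 0 < r.R2pb → (r.R1c + r.R1cb) + (r.R2pb + r.R2pbb) + δ ≤ E.d₄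
  d₅ : 0 < r.R2pb → r.R2pb + r.R2pbb + δ ≤ E.d₅
  e₁ : 0 < r.R1c + r.R1pb → r.R2c + (r.R1c + r.R1cb) + (r.R1pb + r.R1pbb) + δ ≤ E.e₁
  e₂ : 0 < r.R1c + r.R1pb → (r.R1c + r.R1cb) + (r.R1pb + r.R1pbb) + δ ≤ E.e₂
  e₃ : 0 < r.R1pb → r.R1pb + r.R1pbb + δ ≤ E.e₃

theorem Model.Exponents.Admits.fits {E : μ.Exponents} {r : RateTuple} {δ : ℝ}
    (h : E.Admits r (2 * δ)) (hr : r.Nonneg)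
    (h₀ : ∀ c x, marg μ.P (fun s => (s.u2c, s.x₂)) (c, x) ≤ μ.κ.c c * μ.κ.x c x) (N : ℕ) {η : ℝ}
    (mass : ∑ s, (μ.pow N).P s *
      ind (¬ (E.typicalSets δ h₀ N).T s.u2c s.x₂ s.u1c s.u1pb s.u2pb) ≤ η)
    (mass₁ : ∑ s, (μ.pow N).P s *
      ind (¬ (E.typicalSets δ h₀ N).T₁ s.u2c s.u1c s.u1pb s.y₁) ≤ η)
    (mass₂ : ∑ s, (μ.pow N).P s *
      ind (¬ (E.typicalSets δ h₀ N).T₂ s.u2c s.x₂ s.u1c s.u2pb s.y₂) ≤ η) :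
    (E.typicalSets δ h₀ N).Fits (Fin (numMessages r.R2c N)) (Fin (numMessages r.R2pa N))
      (Fin (numMessages r.R1c N)) (Fin (numMessages r.R1cb N)) (Fin (numMessages r.R1pb N))
      (Fin (numMessages r.R1pbb N)) (Fin (numMessages r.R2pb N)) (Fin (numMessages r.R2pbb N))
      (64 * 2 ^ (-((N : ℝ) * δ))) η := by
  obtain ⟨h1, h2, h3, h4, h5, h6, h7, h8⟩ := hr
  have l1 := two_rpow_le_numMessages r.R1cb N
  have l2 := two_rpow_le_numMessages r.R1pbb N
  have l3 := two_rpow_le_numMessages r.R2pbb N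
  have uc := numMessages_le h6 N
  have ux := numMessages_le h7 N
  have ua := mul_le_two_pow_mul (Nat.cast_nonneg _) (numMessages_le h4 N) (numMessages_le h1 N)
  have ub := mul_le_two_pow_mul (Nat.cast_nonneg _) (numMessages_le h5 N) (numMessages_le h2 N)
  have ud := mul_le_two_pow_mul (Nat.cast_nonneg _) (numMessages_le h8 N) (numMessages_le h3 N)
  have l12 : (2 : ℝ) ^ ((N : ℝ) * (r.R1cb + r.R1pbb)) ≤
      numMessages r.R1cb N * numMessages r.R1pbb N := by
    rw [mul_add, Real.rpow_add two_pos]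
    gcongr
  have l123 : (2 : ℝ) ^ ((N : ℝ) * (r.R1cb + r.R1pbb + r.R2pbb)) ≤
      numMessages r.R1cb N * numMessages r.R1pbb N * numMessages r.R2pbb N := by
    rw [mul_add, Real.rpow_add two_pos]
    gcongr
  have user₁ : Nontrivial (Fin (numMessages r.R1c N) × Fin (numMessages r.R1pb N)) →
      0 < r.R1c + r.R1pb := by
    rintro ⟨v, w, hvw⟩
    by_cases ha : v.1 = w.1
    · linarith [pos_of_nontrivial h5 ⟨v.2, w.2, fun hb => hvw (Prod.ext ha hb)⟩]
    · linarith [pos_of_nontrivial h4 ⟨v.1, w.1, ha⟩]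
  constructor
  case ρ_nonneg => positivity
  case mass => exact mass
  case mass₁ => exact mass₁
  case mass₂ => exact mass₂
  all_goals simp only [Fintype.card_prod, Fintype.card_fin, Nat.cast_mul]
  case bin₁ => exact two_rpow_le_mul l1 h.bin₁
  case bin₂ => exact two_rpow_le_mul l12 h.bin₂
  case bin₃ => exact two_rpow_le_mul l123 h.bin₃
  case α₁_le =>
    exact fun hn => inv_two_rpow_mul_le (by norm_num) (mul_le_two_pow_mul (by positivity) uc
      (mul_le_two_pow_mul (by positivity) ua ub)) (by linarith [h.e₁ (user₁ hn)])
  case α₂_le =>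
    exact fun hn => inv_two_rpow_mul_le (by norm_num) (mul_le_two_pow_mul (by positivity) ua ub)
      (by linarith [h.e₂ (user₁ hn)])
  case α₃_le =>
    exact fun hn => inv_two_rpow_mul_le (by norm_num) ub
      (by linarith [h.e₃ (pos_of_nontrivial h5 hn)])
  case β₁_le =>
    exact fun hn => inv_two_rpow_mul_le (by norm_num) (mul_le_two_pow_mul (by positivity) uc
      (mul_le_two_pow_mul (by positivity) ux (mul_le_two_pow_mul (by positivity) ua ud)))
      (by linarith [h.d₁ (pos_of_nontrivial h6 hn)])
  case β₂_le =>
    exact fun hn => inv_two_rpow_mul_le (by norm_num) (mul_le_two_pow_mul (by positivity) ux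
      (mul_le_two_pow_mul (by positivity) ua ud)) (by linarith [h.d₂ (pos_of_nontrivial h7 hn)])
  case β₃_le =>
    exact fun hn => inv_two_rpow_mul_le (by norm_num) (mul_le_two_pow_mul (by positivity) ux ud)
      (by linarith [h.d₃ (pos_of_nontrivial h7 hn)])
  case β₄_le =>
    exact fun hn => inv_two_rpow_mul_le (by norm_num) (mul_le_two_pow_mul (by positivity) ua ud)
      (by linarith [h.d₄ (pos_of_nontrivial h8 hn)])
  case β₅_le =>
    exact fun hn => inv_two_rpow_mul_le (by norm_num) ud
      (by linarith [h.d₅ (pos_of_nontrivial h8 hn)])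

theorem tendsto_two_rpow_neg {δ : ℝ} (hδ : 0 < δ) :
    Tendsto (fun N : ℕ => (64 : ℝ) * 2 ^ (-((N : ℝ) * δ))) atTop (𝓝 0) := by
  have h : Tendsto (fun N : ℕ => ((2 : ℝ) ^ (-δ)) ^ N) atTop (𝓝 0) :=
    tendsto_pow_atTop_nhds_zero_of_lt_one (by positivity)
      (Real.rpow_lt_one_of_one_lt_of_neg one_lt_two (neg_lt_zero.2 hδ))
  have := h.const_mul 64
  rw [mul_zero] at this
  refine this.congr fun N => ?_
  rw [← Real.rpow_natCast, ← Real.rpow_mul zero_le_two]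
  congr 2
  ring

variable (q : PMF (InputSymbols A C B D Z X)) (W : Z → X → PMF (Y₁ × Y₂))

/-- Rates with slack in all the constraints are achievable by random binning, superposition coding
and joint typicality decoding. -/
theorem achievable_of_admits {r : RateTuple} (hr : r.Nonneg) {δ : ℝ} (hδ : 0 < δ)
    (h : (singleExponents q W).Admits r (2 * δ)) :
    Achievable W (r.R1c + r.R1pb) (r.R2c + r.R2pa + r.R2pb) := by
  obtain ⟨h1, h2, h3, h4, h5, h6, h7, h8⟩ := id hr
  refine ⟨by positivity, by positivity, ?_⟩
  set E := singleExponents q W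
  have h₀ := singleModel_marg_le q W
  have m := E.tendsto_mass h₀ hδ
  have m₁ := E.tendsto_mass₁ h₀ hδ
  have m₂ := E.tendsto_mass₂ h₀ hδ
  set f : ℕ → ℝ := fun N => ∑ s, ((singleModel q W).pow N).P s *
    ind (¬ (E.typicalSets δ h₀ N).T s.u2c s.x₂ s.u1c s.u1pb s.u2pb)
  set f₁ : ℕ → ℝ := fun N => ∑ s, ((singleModel q W).pow N).P s *
    ind (¬ (E.typicalSets δ h₀ N).T₁ s.u2c s.u1c s.u1pb s.y₁)
  set f₂ : ℕ → ℝ := fun N => ∑ s, ((singleModel q W).pow N).P s *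
    ind (¬ (E.typicalSets δ h₀ N).T₂ s.u2c s.x₂ s.u1c s.u2pb s.y₂)
  have fits := fun N => h.fits hr h₀ N (η := max (f N) (max (f₁ N) (f₂ N))) (le_max_left _ _)
    ((le_max_left _ _).trans (le_max_right _ _)) ((le_max_right _ _).trans (le_max_right _ _))
  have : Nonempty Z := ⟨q.support_nonempty.some.x₁⟩
  have inj₁ : ∀ N, ∃ ι : Fin (numMessages (r.R1c + r.R1pb) N) →
      Fin (numMessages r.R1c N) × Fin (numMessages r.R1pb N), Function.Injective ι := fun N => by
    refine (Function.Embedding.nonempty_of_card_le ?_).elim fun ι => ⟨ι, ι.injective⟩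
    simpa only [Fintype.card_prod, Fintype.card_fin] using numMessages_add_le r.R1c r.R1pb N
  have inj₂ : ∀ N, ∃ ι : Fin (numMessages (r.R2c + r.R2pa + r.R2pb) N) →
      Fin (numMessages r.R2c N) × Fin (numMessages r.R2pa N) × Fin (numMessages r.R2pb N),
      Function.Injective ι := fun N => by
    refine (Function.Embedding.nonempty_of_card_le ?_).elim fun ι => ⟨ι, ι.injective⟩
    simp only [Fintype.card_prod, Fintype.card_fin]
    rw [add_assoc]
    exact (numMessages_add_le _ _ N).trans (Nat.mul_le_mul_left _ (numMessages_add_le _ _ N))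
  have codes : ∀ N, ∃ c : Code Z X Y₁ Y₂ N (numMessages (r.R1c + r.R1pb) N)
      (numMessages (r.R2c + r.R2pa + r.R2pb) N),
      c.errorProb W ≤ 12 * max (f N) (max (f₁ N) (f₂ N)) + 32 * (64 * 2 ^ (-((N : ℝ) * δ))) := by
    intro N
    obtain ⟨ι₁, hι₁⟩ := inj₁ N
    obtain ⟨ι₂, hι₂⟩ := inj₂ N
    obtain ⟨enc₁, enc₂, dec₁, dec₂, hc⟩ := Model.exists_code (fits N) hι₁ hι₂
    refine ⟨⟨enc₁, enc₂, dec₁, dec₂⟩, ?_⟩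
    have p₁ : (0 : ℝ) < numMessages (r.R1c + r.R1pb) N := by exact_mod_cast numMessages_pos _ N
    have p₂ : (0 : ℝ) < numMessages (r.R2c + r.R2pa + r.R2pb) N := by
      exact_mod_cast numMessages_pos _ N
    rw [Code.errorProb, div_le_iff₀ (mul_pos p₁ p₂)]
    simp only [Fintype.card_fin] at hc
    exact hc
  choose c hc using codes
  refine ⟨c, squeeze_zero (fun N => ?_) hc ?_⟩
  · refine div_nonneg (Finset.sum_nonneg fun _ _ => Finset.sum_nonneg fun _ _ =>
      Finset.sum_nonneg fun _ _ => Finset.sum_nonneg fun _ _ => ?_) (by positivity)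
    split_ifs
    · exact le_rfl
    · exact Finset.prod_nonneg fun _ _ => ENNReal.toReal_nonneg
  · have := ((m.max (m₁.max m₂)).const_mul 12).add ((tendsto_two_rpow_neg hδ).const_mul 32)
    simpa using this

theorem eventually_add_le {p : Prop} {a b : ℝ} (h : p → a < b) :
    ∀ᶠ δ in 𝓝[>] (0 : ℝ), p → a + 4 * δ ≤ b := by
  by_cases hp : p
  · filter_upwards [Ioo_mem_nhdsGT (show (0 : ℝ) < (b - a) / 4 by linarith [h hp])] with δ hδ _
    linarith [hδ.2]
  · exact Eventually.of_forall fun _ h => absurd h hp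

/-- It suffices that the decoding constraints which protect a message of positive rate are strict:
a slightly larger rate `R1cb` gives slack in the binning constraints. -/
theorem achievable_of_lt {r : RateTuple} (hr : r.Nonneg)
    (hbin : BinningConstraints (jointLaw q W) r)
    (d₁ : 0 < r.R2c → r.R2c + r.R2pa + (r.R1c + r.R1cb) + (r.R2pb + r.R2pbb) <
      (singleExponents q W).d₁)
    (d₂ : 0 < r.R2pa → r.R2pa + (r.R1c + r.R1cb) + (r.R2pb + r.R2pbb) < (singleExponents q W).d₂)
    (d₃ : 0 < r.R2pa → r.R2pa + (r.R2pb + r.R2pbb) < (singleExponents q W).d₃)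
    (d₄ : 0 < r.R2pb → (r.R1c + r.R1cb) + (r.R2pb + r.R2pbb) < (singleExponents q W).d₄)
    (d₅ : 0 < r.R2pb → r.R2pb + r.R2pbb < (singleExponents q W).d₅)
    (e₁ : 0 < r.R1c + r.R1pb → r.R2c + (r.R1c + r.R1cb) + (r.R1pb + r.R1pbb) <
      (singleExponents q W).e₁)
    (e₂ : 0 < r.R1c + r.R1pb → (r.R1c + r.R1cb) + (r.R1pb + r.R1pbb) < (singleExponents q W).e₂)
    (e₃ : 0 < r.R1pb → r.R1pb + r.R1pbb < (singleExponents q W).e₃) :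
    Achievable W (r.R1c + r.R1pb) (r.R2c + r.R2pa + r.R2pb) := by
  obtain ⟨b₁, b₂, b₃⟩ := hbin
  obtain ⟨δ, hδ, hd₁, hd₂, hd₃, hd₄, hd₅, he₁, he₂, he₃⟩ := (eventually_mem_nhdsWithin.and
    ((eventually_add_le d₁).and ((eventually_add_le d₂).and ((eventually_add_le d₃).and
    ((eventually_add_le d₄).and ((eventually_add_le d₅).and ((eventually_add_le e₁).and
    ((eventually_add_le e₂).and (eventually_add_le e₃))))))))).exists
  have hδ : 0 < δ := hδ
  refine achievable_of_admits q W (r := { r with R1cb := r.R1cb + 2 * δ })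
    ⟨by linarith [hr.1], hr.2⟩ hδ ⟨?_, ?_, ?_, ?_, ?_, ?_, ?_, ?_, ?_, ?_, ?_⟩
  · exact add_le_add_left b₁ _
  · change _ ≤ r.R1cb + 2 * δ + r.R1pbb
    refine (add_le_add_left b₂ _).trans ?_
    linarith
  · change _ ≤ r.R1cb + 2 * δ + r.R1pbb + r.R2pbb
    refine (add_le_add_left b₃ _).trans ?_
    linarith
  all_goals
    intro hp
    dsimp only at hp ⊢
  · linarith [hd₁ hp]
  · linarith [hd₂ hp]
  · linarith [hd₃ hp]
  · linarith [hd₄ hp]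
  · linarith [hd₅ hp]
  · linarith [he₁ hp]
  · linarith [he₂ hp]
  · linarith [he₃ hp]

/-- Lowering all the message rates makes every decoding constraint strict that protects a message
of positive rate. -/
theorem achievable_scaled {r : RateTuple} (hr : r.Nonneg)
    (hbin : BinningConstraints (jointLaw q W) r)
    (hdec : DecodingConstraints (fun a b => a ≤ b) (jointLaw q W) r) {t : ℝ} (ht : 0 < t)
    (ht1 : t < 1) :
    Achievable W (t * (r.R1c + r.R1pb)) (t * (r.R2c + r.R2pa + r.R2pb)) := by
  obtain ⟨-, -, -, h4, h5, h6, h7, h8⟩ := id hr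
  have le : ∀ {x : ℝ}, 0 ≤ x → t * x ≤ x := fun hx => mul_le_of_le_one_left hx ht1.le
  have lt : ∀ {x : ℝ}, 0 < t * x → t * x < x := fun hx =>
    mul_lt_of_lt_one_left (pos_of_mul_pos_right hx ht.le) ht1
  have lt₂ : 0 < t * r.R1c + t * r.R1pb → t * r.R1c + t * r.R1pb < r.R1c + r.R1pb := fun hp => by
    rw [← mul_add] at hp ⊢
    exact lt hp
  obtain ⟨d₁, d₂, d₃, d₄, d₅, e₁, e₂, e₃⟩ := hdec
  have key := achievable_of_lt q W (r := { r with
    R1c := t * r.R1c, R1pb := t * r.R1pb, R2c := t * r.R2c, R2pa := t * r.R2pa,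
    R2pb := t * r.R2pb })
    ⟨hr.1, hr.2.1, hr.2.2.1, mul_nonneg ht.le h4, mul_nonneg ht.le h5, mul_nonneg ht.le h6,
      mul_nonneg ht.le h7, mul_nonneg ht.le h8⟩ hbin
    (fun hp => lt_of_lt_of_le (by dsimp only at hp ⊢; linarith [lt hp, le h7, le h4, le h8]) d₁)
    (fun hp => lt_of_lt_of_le (by dsimp only at hp ⊢; linarith [lt hp, le h4, le h8]) d₂)
    (fun hp => lt_of_lt_of_le (by dsimp only at hp ⊢; linarith [lt hp, le h8]) d₃)
    (fun hp => lt_of_lt_of_le (by dsimp only at hp ⊢; linarith [lt hp, le h4]) d₄)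
    (fun hp => lt_of_lt_of_le (by dsimp only at hp ⊢; linarith [lt hp]) d₅)
    (fun hp => lt_of_lt_of_le (by dsimp only at hp ⊢; linarith [lt₂ hp, le h6]) e₁)
    (fun hp => lt_of_lt_of_le (by dsimp only at hp ⊢; linarith [lt₂ hp]) e₂)
    (fun hp => lt_of_lt_of_le (by dsimp only at hp ⊢; linarith [lt hp]) e₃)
  simpa only [mul_add] using key

end coding

end

end CogIC

/-- Every rate pair of the region lies in the capacity region (the closure of the achievable
pairs), and it is itself achievable when the decoding constraints hold strictly. -/
theorem theorem1 {A1c A2c A1pb A2pb X₁ X₂ Y₁ Y₂ : Type*}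
    [Fintype A1c] [Fintype A2c] [Fintype A1pb] [Fintype A2pb]
    [Fintype X₁] [Fintype X₂] [Fintype Y₁] [Fintype Y₂]
    (W : X₁ → X₂ → PMF (Y₁ × Y₂))
    (q : PMF (CogIC.InputSymbols A1c A2c A1pb A2pb X₁ X₂))
    (r : CogIC.RateTuple) (hr : r.Nonneg)
    (hbin : CogIC.BinningConstraints (CogIC.jointLaw q W) r)
    (hdec : CogIC.DecodingConstraints (fun a b => a ≤ b) (CogIC.jointLaw q W) r)
    (R₁ R₂ : ℝ) (hR₁ : R₁ = r.R1c + r.R1pb) (hR₂ : R₂ = r.R2c + r.R2pa + r.R2pb) :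
    (R₁, R₂) ∈ CogIC.capacityRegion W ∧
      (CogIC.DecodingConstraints (fun a b => a < b) (CogIC.jointLaw q W) r →
        CogIC.Achievable W R₁ R₂) := by
  subst hR₁ hR₂
  refine ⟨?_, fun hlt => ?_⟩
  · have lim : Tendsto (fun t : ℝ => (t * (r.R1c + r.R1pb), t * (r.R2c + r.R2pa + r.R2pb)))
        (𝓝[<] 1) (𝓝 (r.R1c + r.R1pb, r.R2c + r.R2pa + r.R2pb)) := by
      refine tendsto_nhdsWithin_of_tendsto_nhds (Continuous.tendsto' (by fun_prop) _ _ ?_)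
      simp
    refine mem_closure_of_tendsto lim ?_
    filter_upwards [Ioo_mem_nhdsLT (zero_lt_one' ℝ)] with t ht
    exact CogIC.achievable_scaled q W hr hbin hdec ht.1 ht.2
  · obtain ⟨d₁, d₂, d₃, d₄, d₅, e₁, e₂, e₃⟩ := hlt
    exact CogIC.achievable_of_lt q W hr hbin (fun _ => d₁) (fun _ => d₂) (fun _ => d₃)
      (fun _ => d₄) (fun _ => d₅) (fun _ => e₁) (fun _ => e₂) (fun _ => e₃)
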